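/- **Setting.** Let $(y_i,x_i)_{i\ge 1}$ be i.i.d. copies of $(Y,X)$ with $Y$ real and $X\in\mathbb R^d$, $d\ge1$, and let $\mathcal X$ be the support of $X$. Let $\nu$ be a locally finite Borel measure on $\mathbb R^d$ (for example Lebesgue measure, possibly with point masses in some coordinates), let $f_X$ be the density of $X$ with respect to $\nu$, let $f_{Y|X}(\cdot\mid x)$ be a conditional density of $Y$ given $X=x$ (a probability density for every $x\in\mathcal X$), so that $f_{Y,X}(y,x)=f_{Y|X}(y\mid x)f_X(x)$ is the joint density with respect to $dy\otimes\nu$, and let $f_Y$ be the Lebesgue density of $Y$. Let $\tau\in(0,1)$, $\epsilon\in(0,\tfrac12)$, $I=[\epsilon,1-\epsilon]$; $Q_Y[\tau]$ and $Q_Y[\eta\mid X=x]$ denote the unconditional and the conditional quantiles, defined as $\inf\{q: F(q)\ge\cdot\}$. Let $\xi_\tau$ be the matching function: for every $x\in\mathcal X$, $\xi_\tau(x)\in I$ and $Q_Y[\xi_\tau(x)\mid X=x]=Q_Y[\tau]$. **Estimators.** With $\rho_p(u)=u(p-1[u<0])$, let $\hat\beta(\eta)$, $\eta\in I$, be a minimizer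 of $b\mapsto\frac1n\sum_{i\le n}\rho_\eta(y_i-x_i'b)$ and $\hat Q_Y[\tau]$ a minimizer of $q\mapsto\frac1n\sum_{i\le n}\rho_\tau(y_i-q)$. Let $\epsilon=\eta_1<\dots<\eta_m=1-\epsilon$ be a grid (depending on $n$). Let $\hat\xi_\tau(x)$ be $\epsilon$ if $\hat Q_Y[\tau]<x'\hat\beta(\eta_1)$; $\eta_j$ if $x'\hat\beta(\eta_j)\le\hat Q_Y[\tau]<x'\hat\beta(\eta_{j+1})$, $1\le j<m$; and $\eta_m$ if $x'\hat\beta(\eta_m)\le\hat Q_Y[\tau]$ (any admissible value if several cases apply). Let $K_h(u)=h^{-1}K(u/h)$. The feasible and the oracle estimators are $$\widehat{UQPE}(\tau)=\frac{\sum_{i\le n}K_h(y_i-\hat Q_Y[\tau])\,\hat\beta_1(\hat\xi_\tau(x_i))}{\sum_{i\le n}K_h(y_i-\hat Q_Y[\tau])},\qquad \widetilde{UQPE}(\tau)=\frac{\sum_{i\le n}K_h(y_i-Q_Y[\tau])\,\beta_1(\xi_\tau(x_i))}{\sum_{i\le n}K_h(y_i-Q_Y[\tau])}.$$ **Assumptions.**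 1. (Matching) (a) $Q_Y[\eta\mid X=x]=x'\beta(\eta)$ for $x\in\mathcal X$, $\eta\in I$, and $E|X|<\infty$. (b) There is $c>0$ with $f_{Y|X}(y\mid x)\ge c$ for all $x\in\mathcal X$ and $y\in[x'\beta(\epsilon),x'\beta(1-\epsilon)]$. (c) For $\eta\in I$ the matrix $J(\eta)=E[f_{Y|X}(X'\beta(\eta)\mid X)XX']$ exists and is invertible, $J$ is differentiable on $I$ with bounded derivative, and, uniformly in $\eta\in I$, $\hat\beta(\eta)-\beta(\eta)=J(\eta)^{-1}\frac1n\sum_{i\le n}(\eta-1\{y_i\le x_i'\beta(\eta)\})x_i+o_p(n^{-1/2})$. (d) $\hat Q_Y[\tau]-Q_Y[\tau]=f_Y(Q_Y[\tau])^{-1}\frac1n\sum_{i\le n}(\tau-1\{y_i\le Q_Y[\tau]\})+o_p(n^{-1/2})$. (e) $\max_j(\eta_j-\eta_{j-1})=o(n^{-1/2})$. 2. (Kernel) $r\ge2$ is an integer; $K$ is symmetric about $0$ and twice differentiable; $\int K=1$; $\int u^jK(u)\,du=0$ for $1\le j\le r-1$; $\int|u|^r|K(u)|\,du<\infty$; $K'$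 is integrable with $\int K'=0$; $u^jK(u)\to0$ as $u\to\pm\infty$ for $1\le j\le r+1$; $K'$ and $K''$ are bounded; $K'(u)^2$ and $uK'(u)^2$ are integrable. 3. (Bandwidth) $h=h_n$ is of exact order $n^{-a}$ ($c_1n^{-a}\le h_n\le c_2n^{-a}$ for all large $n$, with constants $c_1,c_2>0$), where $1/(1+2r)\le a<1/2$. 4. (Smoothness) $f_Y$ is $r+1$ times continuously differentiable with bounded derivatives; for every $x\in\mathcal X$, $y\mapsto f_{Y,X}(y,x)$ is $r+1$ times continuously differentiable, with derivatives bounded uniformly in $y\in\mathbb R$ and $x\in\mathcal X$. 5. (Uniformity) (i) Uniformly in $x\in\mathcal X$, $\hat\xi_\tau(x)-\xi_\tau(x)=f_{Y|X}(x'\beta(\xi_\tau(x))\mid x)\big[-x'(\hat\beta(\xi_\tau(x))-\beta(\xi_\tau(x)))+(\hat Q_Y[\tau]-Q_Y[\tau])\big]+o_p(n^{-1/2})$; (ii) $\beta_1$ is differentiable on $I$ with bounded derivative, and $f_{Y|X}$ is bounded on $\mathbb R\times\mathcal X$. **Theorem.** Under these assumptions, as $n\to\infty$, $$\widehat{UQPE}(\tau)=\widetilde{UQPE}(\tau)+o_p\big(n^{-1/2}h^{-1/2}\big).$$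 -/

import Mathlib

open MeasureTheory ProbabilityTheory Filter Topology Set
open scoped Matrix

noncomputable section

namespace UQPE

/-! ### Stochastic orders

Probabilities of sets that need not be measurable are outer probabilities, as is customary for
suprema of processes; no measurability of estimators is required. -/

/-- `Z n = o_p(r n)`. -/
def IsLittleOp {Ω F : Type*} [MeasurableSpace Ω] [Norm F] (μ : Measure Ω)
    (Z : ℕ → Ω → F) (r : ℕ → ℝ) : Prop :=
  ∀ δ : ℝ, 0 < δ → Tendsto (fun n => μ {ω | δ * r n < ‖Z n ω‖}) atTop (𝓝 0)

/-- `Z n t = o_p(r n)` uniformly in `t ∈ T`, that is `sup_{t ∈ T} ‖Z n t‖ = o_p(r n)`. -/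
def IsUniformLittleOp {Ω ι F : Type*} [MeasurableSpace Ω] [Norm F] (μ : Measure Ω)
    (T : Set ι) (Z : ℕ → ι → Ω → F) (r : ℕ → ℝ) : Prop :=
  ∀ δ : ℝ, 0 < δ → Tendsto (fun n => μ {ω | ∃ t ∈ T, δ * r n < ‖Z n t ω‖}) atTop (𝓝 0)

/-! ### Quantiles and the matching map -/

/-- The `p`-quantile `inf {q : m (-∞, q] ≥ p}` of a probability measure `m` on the line. -/
def quantile (m : Measure ℝ) (p : ℝ) : ℝ :=
  sInf {q : ℝ | ENNReal.ofReal p ≤ m (Iic q)}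

/-- The law of `Y` given `X = x`, where `f y x` is the conditional density of `Y` at `y` given
`X = x`. -/
def condLaw {d : ℕ} (f : ℝ → (Fin d → ℝ) → ℝ) (x : Fin d → ℝ) : Measure ℝ :=
  volume.withDensity fun y => ENNReal.ofReal (f y x)

/-- The matching map: all `η ∈ (0,1)` with `Q_Y[η | X = x] = Q_Y[τ]`, where `Q = Q_Y[τ]`. -/
def matchingSet {d : ℕ} (f : ℝ → (Fin d → ℝ) → ℝ) (Q : ℝ) (x : Fin d → ℝ) : Set ℝ :=
  {η | η ∈ Ioo (0 : ℝ) 1 ∧ quantile (condLaw f x) η = Q}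

/-! ### Estimators -/

/-- The check function `ρ_p(u) = u (p - 1[u < 0])`. -/
def checkFn (p u : ℝ) : ℝ := u * (p - if u < 0 then 1 else 0)

/-- `b` is a `p`-quantile-regression coefficient of the sample `(y_i, x_i)`, `i < n`. -/
def IsQRCoef {d : ℕ} (n : ℕ) (y : ℕ → ℝ) (x : ℕ → Fin d → ℝ) (p : ℝ) (b : Fin d → ℝ) : Prop :=
  IsMinOn (fun b' : Fin d → ℝ => (n : ℝ)⁻¹ * ∑ i ∈ Finset.range n, checkFn p (y i - x i ⬝ᵥ b'))
    univ b

/-- `q` is a `p`-sample-quantile of `y_i`, `i < n`. -/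
def IsSampleQuantile (n : ℕ) (y : ℕ → ℝ) (p q : ℝ) : Prop :=
  IsMinOn (fun q' : ℝ => (n : ℝ)⁻¹ * ∑ i ∈ Finset.range n, checkFn p (y i - q')) univ q

/-- `e` is a value of the estimated matching function at `x`, for the grid
`g 0 < ⋯ < g m`, the estimated coefficients `b` and the estimated unconditional quantile `q`.
If the estimated conditional quantiles cross, several values may be admissible, and any of them
may be chosen. -/
def IsMatch {d m : ℕ} (ε : ℝ) (g : Fin (m + 1) → ℝ) (b : ℝ → Fin d → ℝ) (q : ℝ)
    (x : Fin d → ℝ) (e : ℝ) : Prop :=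
  (q < x ⬝ᵥ b (g 0) ∧ e = ε) ∨
  (∃ j : Fin m, x ⬝ᵥ b (g j.castSucc) ≤ q ∧ q < x ⬝ᵥ b (g j.succ) ∧ e = g j.castSucc) ∨
  (x ⬝ᵥ b (g (Fin.last m)) ≤ q ∧ e = g (Fin.last m))

/-- The rescaled kernel `K_h(u) = K(u / h) / h`. -/
def rescale (K : ℝ → ℝ) (h u : ℝ) : ℝ := h⁻¹ * K (u / h)

/-- The Nadaraya–Watson regression of `w_i` on `y_i`, `i < n`, evaluated at `q`. -/
def nadarayaWatson (K : ℝ → ℝ) (h : ℝ) (n : ℕ) (y w : ℕ → ℝ) (q : ℝ) : ℝ :=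
  (∑ i ∈ Finset.range n, rescale K h (y i - q) * w i) /
    ∑ i ∈ Finset.range n, rescale K h (y i - q)

/-! ### Assumptions -/

/-- `(y_i, x_i)`, `i = 0, 1, …`, are independent and identically distributed. -/
structure IsRandomSample {Ω : Type*} [MeasurableSpace Ω] {d : ℕ} (μ : Measure Ω)
    (y : ℕ → Ω → ℝ) (x : ℕ → Ω → Fin d → ℝ) : Prop where
  measurable_y : ∀ i, Measurable (y i)
  measurable_x : ∀ i, Measurable (x i)
  indep : iIndepFun (fun i ω => (y i ω, x i ω)) μ
  identDistrib : ∀ i, IdentDistrib (fun ω => (y i ω, x i ω)) (fun ω => (y 0 ω, x 0 ω)) μ μ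

/-- `fX` is the density of `X` with respect to `ν`, `f y x` is a conditional density of `Y` given
`X = x` (for every `x` in the support of `X`), so that `f y x * fX x` is the joint density of
`(Y, X)` with respect to `dy ⊗ ν`, and `fY` is the density of `Y`. The measure `ν` on the
covariate space may have discrete components, since a covariate may be a constant. -/
structure HasDensities {Ω : Type*} [MeasurableSpace Ω] {d : ℕ} (μ : Measure Ω)
    (Y : Ω → ℝ) (X : Ω → Fin d → ℝ) (ν : Measure (Fin d → ℝ))
    (fX : (Fin d → ℝ) → ℝ) (f : ℝ → (Fin d → ℝ) → ℝ) (fY : ℝ → ℝ) : Prop where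
  measurable_fX : Measurable fX
  measurable_f : Measurable fun p : ℝ × (Fin d → ℝ) => f p.1 p.2
  measurable_fY : Measurable fY
  fX_nonneg : ∀ x, 0 ≤ fX x
  f_nonneg : ∀ y x, 0 ≤ f y x
  fY_nonneg : ∀ y, 0 ≤ fY y
  joint : μ.map (fun ω => (Y ω, X ω)) =
    (volume.prod ν).withDensity fun p => ENNReal.ofReal (f p.1 p.2 * fX p.2)
  marginal : μ.map Y = volume.withDensity fun y => ENNReal.ofReal (fY y)
  cond : ∀ x ∈ (μ.map X).support, IsProbabilityMeasure (condLaw f x)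

/-- The matrix `J(η) = E[f_{Y|X}(X'β(η) | X) X X']`. -/
def J {Ω : Type*} [MeasurableSpace Ω] {d : ℕ} (μ : Measure Ω) (X : Ω → Fin d → ℝ)
    (f : ℝ → (Fin d → ℝ) → ℝ) (β : ℝ → Fin d → ℝ) (η : ℝ) : Matrix (Fin d) (Fin d) ℝ :=
  Matrix.of fun i j => ∫ ω, f (X ω ⬝ᵥ β η) (X ω) * (X ω i * X ω j) ∂μ

/-- The influence function `Ψ_i(η) = J(η)⁻¹ (η - 1{y_i ≤ x_i'β(η)}) x_i`, as a function of the
observation `(y_i, x_i) = (y, x)`. -/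
def influenceQR {d : ℕ} (Jη : Matrix (Fin d) (Fin d) ℝ) (b : Fin d → ℝ) (η : ℝ)
    (y : ℝ) (x : Fin d → ℝ) : Fin d → ℝ :=
  Jη⁻¹ *ᵥ ((η - if y ≤ x ⬝ᵥ b then 1 else 0) • x)

/-- The influence function `ψ_i(τ) = f_Y(Q)⁻¹ (τ - 1{y_i ≤ Q})` with `Q = Q_Y[τ]`, as a function
of the observation `y_i = y`. -/
def influenceUQ (fYQ Q τ y : ℝ) : ℝ := fYQ⁻¹ * (τ - if y ≤ Q then 1 else 0)

/-- The assumption on the quantile regression model and on the first-step estimators. -/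
structure MatchingAssumption {Ω : Type*} [MeasurableSpace Ω] {d : ℕ} (μ : Measure Ω)
    (y : ℕ → Ω → ℝ) (x : ℕ → Ω → Fin d → ℝ)
    (f : ℝ → (Fin d → ℝ) → ℝ) (fY : ℝ → ℝ) (τ ε : ℝ) (β : ℝ → Fin d → ℝ)
    (βhat : ℕ → ℝ → Ω → Fin d → ℝ) (Qhat : ℕ → Ω → ℝ)
    (m : ℕ → ℕ) (grid : (n : ℕ) → Fin (m n + 1) → ℝ) : Prop where
  /-- Conditional quantiles are linear. -/
  linear : ∀ x' ∈ (μ.map (x 0)).support, ∀ η ∈ Icc ε (1 - ε),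
    quantile (condLaw f x') η = x' ⬝ᵥ β η
  integrable_X : Integrable (x 0) μ
  /-- The conditional density is bounded away from zero on the range of the modelled conditional
  quantiles. -/
  density_pos : ∃ c : ℝ, 0 < c ∧ ∀ x' ∈ (μ.map (x 0)).support,
    ∀ y' ∈ Icc (x' ⬝ᵥ β ε) (x' ⬝ᵥ β (1 - ε)), c ≤ f y' x'
  /-- The matrix `J(η)` exists, is invertible and has uniformly bounded derivatives. -/
  J_integrable : ∀ η ∈ Icc ε (1 - ε), ∀ i j,
    Integrable (fun ω => f (x 0 ω ⬝ᵥ β η) (x 0 ω) * (x 0 ω i * x 0 ω j)) μ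
  J_invertible : ∀ η ∈ Icc ε (1 - ε), IsUnit (J μ (x 0) f β η).det
  J_differentiable : ∀ i j, DifferentiableOn ℝ (fun η => J μ (x 0) f β η i j) (Icc ε (1 - ε))
  J_deriv_bounded : ∃ C : ℝ, ∀ i j, ∀ η ∈ Icc ε (1 - ε),
    |derivWithin (fun η => J μ (x 0) f β η i j) (Icc ε (1 - ε)) η| ≤ C
  /-- The uniform Bahadur representation of the quantile regression estimator. -/
  bahadur : IsUniformLittleOp μ (Icc ε (1 - ε))
    (fun n η ω => βhat n η ω - β η - (n : ℝ)⁻¹ • ∑ i ∈ Finset.range n,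
      influenceQR (J μ (x 0) f β η) (β η) η (y i ω) (x i ω))
    (fun n => (n : ℝ) ^ (-(1 / 2) : ℝ))
  /-- The linear representation of the sample quantile. -/
  unconditional : IsLittleOp μ
    (fun n ω => Qhat n ω - quantile (μ.map (y 0)) τ - (n : ℝ)⁻¹ * ∑ i ∈ Finset.range n,
      influenceUQ (fY (quantile (μ.map (y 0)) τ)) (quantile (μ.map (y 0)) τ) τ (y i ω))
    (fun n => (n : ℝ) ^ (-(1 / 2) : ℝ))
  /-- The grid runs from `ε` to `1 - ε` and its mesh is `o(n^{-1/2})`. -/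
  grid_strictMono : ∀ n, StrictMono (grid n)
  grid_first : ∀ n, grid n 0 = ε
  grid_last : ∀ n, grid n (Fin.last (m n)) = 1 - ε
  grid_mesh : ∃ Δ : ℕ → ℝ, (∀ n, ∀ j : Fin (m n), grid n j.succ - grid n j.castSucc ≤ Δ n) ∧
    Tendsto (fun n : ℕ => (n : ℝ) ^ (1 / 2 : ℝ) * Δ n) atTop (𝓝 0)

/-- The assumption on the kernel, of order `r`. -/
structure KernelAssumption (K : ℝ → ℝ) (r : ℕ) : Prop where
  two_le : 2 ≤ r
  symm : ∀ u, K (-u) = K u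
  integrable : Integrable K
  integral_eq_one : ∫ u, K u = 1
  moment_integrable : ∀ j ∈ Finset.Icc 1 (r - 1), Integrable fun u => u ^ j * K u
  moment_eq_zero : ∀ j ∈ Finset.Icc 1 (r - 1), ∫ u, u ^ j * K u = 0
  moment_r : Integrable fun u => |u| ^ r * K u
  differentiable : Differentiable ℝ K
  differentiable_deriv : Differentiable ℝ (deriv K)
  deriv_integrable : Integrable (deriv K)
  integral_deriv : ∫ u, deriv K u = 0
  decay_atTop : ∀ j ∈ Finset.Icc 1 (r + 1), Tendsto (fun u => u ^ j * K u) atTop (𝓝 0)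
  decay_atBot : ∀ j ∈ Finset.Icc 1 (r + 1), Tendsto (fun u => u ^ j * K u) atBot (𝓝 0)
  deriv_bounded : ∃ C : ℝ, ∀ u, |deriv K u| ≤ C
  deriv_two_bounded : ∃ C : ℝ, ∀ u, |deriv (deriv K) u| ≤ C
  deriv_sq_integrable : Integrable fun u => deriv K u ^ 2
  mul_deriv_sq_integrable : Integrable fun u => u * deriv K u ^ 2

/-- `h ∝ n^{-a}` with `1/(1+2r) ≤ a < 1/2`; the ratio `h / n^{-a}` only has to stay eventually
between two positive constants. -/
structure BandwidthAssumption (h : ℕ → ℝ) (a : ℝ) (r : ℕ) : Prop where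
  lower : 1 / (1 + 2 * (r : ℝ)) ≤ a
  upper : a < 1 / 2
  rate : ∃ c C : ℝ, 0 < c ∧ ∀ᶠ n : ℕ in atTop,
    c * (n : ℝ) ^ (-a) ≤ h n ∧ h n ≤ C * (n : ℝ) ^ (-a)

/-- The smoothness assumption on the densities; derivatives of the joint density are taken with
respect to `y`. -/
structure DensityAssumption {d : ℕ} (S : Set (Fin d → ℝ)) (fX : (Fin d → ℝ) → ℝ)
    (f : ℝ → (Fin d → ℝ) → ℝ) (fY : ℝ → ℝ) (r : ℕ) : Prop where
  marginal_contDiff : ContDiff ℝ ((r + 1 : ℕ) : WithTop ℕ∞) fY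
  marginal_bounded : ∃ C : ℝ, ∀ j ∈ Finset.Icc 1 (r + 1), ∀ y, |iteratedDeriv j fY y| ≤ C
  joint_contDiff : ∀ x ∈ S, ContDiff ℝ ((r + 1 : ℕ) : WithTop ℕ∞) fun y => f y x * fX x
  joint_bounded : ∃ C : ℝ, ∀ x ∈ S, ∀ j ∈ Finset.Icc 1 (r + 1), ∀ y,
    |iteratedDeriv j (fun y => f y x * fX x) y| ≤ C

/-- The uniformity assumption: the remainder of the linear expansion of the estimated matching
function is uniform over the support `S` of `X`, and `dβ₁/dη` and the conditional density are
bounded. -/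
structure ApproxAssumption {Ω : Type*} [MeasurableSpace Ω] {d : ℕ} [NeZero d] (μ : Measure Ω)
    (S : Set (Fin d → ℝ)) (f : ℝ → (Fin d → ℝ) → ℝ) (ε Q : ℝ) (β : ℝ → Fin d → ℝ)
    (ξ : (Fin d → ℝ) → ℝ) (βhat : ℕ → ℝ → Ω → Fin d → ℝ) (Qhat : ℕ → Ω → ℝ)
    (ξhat : ℕ → (Fin d → ℝ) → Ω → ℝ) : Prop where
  remainder : IsUniformLittleOp μ S
    (fun n x ω => ξhat n x ω - ξ x - f (x ⬝ᵥ β (ξ x)) x *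
      (-(x ⬝ᵥ (βhat n (ξ x) ω - β (ξ x))) + (Qhat n ω - Q)))
    (fun n => (n : ℝ) ^ (-(1 / 2) : ℝ))
  beta_differentiable : DifferentiableOn ℝ (fun η => β η 0) (Icc ε (1 - ε))
  beta_deriv_bounded : ∃ C : ℝ, ∀ η ∈ Icc ε (1 - ε),
    |derivWithin (fun η => β η 0) (Icc ε (1 - ε)) η| ≤ C
  density_bounded : ∃ C : ℝ, ∀ x ∈ S, ∀ y, f y x ≤ C

end UQPE

end

/-! Both estimators are ratios of kernel means, and the target rate `(n h)^{-1/2}` is larger than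
`n^{-1/2}` by the diverging factor `h^{-1/2}`. So it suffices that two perturbations are negligible:
replacing the estimated weights by the oracle weights, and moving the evaluation point from `Qhat`
to `Q`. Smoothing bias plays no role, because the two kernel estimators being compared share it. The
denominator tends to a positive constant, so numerator and denominator can be treated separately
(`isLittleOp_div_sub_div`).

Weights. The mean of `|K_h(y_i - Qhat)|` is `O_p(1)`, so a uniform bound on the weight error over
the support of `X` is enough (`isUniformLittleOp_weight`). By the Bahadur representation it reduces
to the process `(η - 1{y ≤ x'β(η)}) x`, averaged over the sample. Its increments have variance
linear in `η' - η`; dyadic chaining with Chebyshev's inequality loses only powers of `log n`, which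
`h` absorbs, and monotonicity of the indicators in `η` fills the gaps between grid points
(`isUniformLittleOp_belowMean`). The expansion of the matching function and the bounded derivative
of `β₁` carry the rate over to the weights.

That transfer needs `x'(βhat - β)` to be small uniformly in `x`, hence a bounded support, which is
not assumed but forced (`isBounded_support`). Matching errors are at most 1 and the conditional
density at `Q` is at least `c`, so the uniform expansion bounds `x'(βhat(ξ(x)) - β(ξ(x)))` on one
event of high probability for all `x`. If the support contained points of norm tending to infinity,
dividing by the norm would give a unit direction `v` and a level `η` for which the influence mean in
direction `v` is `o_p(n^{-1/2})`. The central limit theorem then makes the score degenerate: `X'a =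
0` almost surely with `a = v J(η)⁻¹`, so `v = a J(η) = 0`, a contradiction.

Evaluation point. The change of a kernel mean between `Q` and `Qhat` is at most the integral of its
absolute derivative over an interval of half-length `M n^{-1/2}`. That derivative has bounded mean,
by integration by parts in `y`, and standard deviation of order `(n h^3)^{-1/2}`
(`isLittleOp_kernelMean_sub`). Relative to `(n h)^{-1/2}` the change is of order `h^{1/2} + n^{-1/2}
h^{-1}`, which vanishes because `a < 1/2`. The bounded mean needs `ν` to be finite on the support,
again a consequence of boundedness. -/

noncomputable section

namespace UQPE

/-! ### Calculus of stochastic orders with outer probabilities. -/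

section StochasticOrders

variable {Ω ι κ F G : Type*} [MeasurableSpace Ω] {μ : Measure Ω}

/-- `Z n = O_p(r n)`. -/
def IsBigOp [Norm F] (μ : Measure Ω) (Z : ℕ → Ω → F) (r : ℕ → ℝ) : Prop :=
  ∀ κ : ENNReal, 0 < κ → ∃ M : ℝ, 0 < M ∧ ∀ᶠ n in atTop, μ {ω | M * r n < ‖Z n ω‖} ≤ κ

theorem IsLittleOp.uniform [Norm F] {Z : ℕ → Ω → F} {r : ℕ → ℝ} (hZ : IsLittleOp μ Z r)
    (T : Set ι) : IsUniformLittleOp μ T (fun n _ ω => Z n ω) r := by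
  intro δ hδ
  refine tendsto_of_tendsto_of_tendsto_of_le_of_le tendsto_const_nhds (hZ δ hδ)
    (fun _ => zero_le) fun n => measure_mono ?_
  rintro ω ⟨t, -, h⟩
  exact h

theorem IsUniformLittleOp.at [Norm F] {T : Set ι} {Z : ℕ → ι → Ω → F} {r : ℕ → ℝ}
    (hZ : IsUniformLittleOp μ T Z r) {t : ι} (ht : t ∈ T) :
    IsLittleOp μ (fun n ω => Z n t ω) r := by
  intro δ hδ
  exact tendsto_of_tendsto_of_tendsto_of_le_of_le tendsto_const_nhds (hZ δ hδ)
    (fun _ => zero_le) fun n => measure_mono fun ω h => ⟨t, ht, h⟩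

/-- The exceptional event covers all indices at once, so the index may depend on `ω`; this is what
permits evaluation at the estimated matching level. -/
theorem IsUniformLittleOp.comp [Norm F] {T : Set ι} {Z : ℕ → ι → Ω → F} {r : ℕ → ℝ}
    (hZ : IsUniformLittleOp μ T Z r) {T' : Set κ} {s : ℕ → κ → Ω → ι}
    (hs : ∀ n, ∀ t ∈ T', ∀ ω, s n t ω ∈ T) :
    IsUniformLittleOp μ T' (fun n t ω => Z n (s n t ω) ω) r := by
  intro δ hδ
  refine tendsto_of_tendsto_of_tendsto_of_le_of_le tendsto_const_nhds (hZ δ hδ)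
    (fun _ => zero_le) fun n => measure_mono ?_
  rintro ω ⟨t, ht, h⟩
  exact ⟨s n t ω, hs n t ht ω, h⟩

theorem IsUniformLittleOp.pi {d : ℕ} {T : Set ι} {Z : ℕ → ι → Ω → Fin d → ℝ} {r : ℕ → ℝ}
    (hr : ∀ᶠ n in atTop, 0 ≤ r n)
    (hZ : ∀ j, IsUniformLittleOp μ T (fun n t ω => Z n t ω j) r) :
    IsUniformLittleOp μ T Z r := by
  intro δ hδ
  have hlim := tendsto_finsetSum Finset.univ fun j _ => hZ j δ hδ
  rw [Finset.sum_const_zero] at hlim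
  refine tendsto_of_tendsto_of_tendsto_of_le_of_le' tendsto_const_nhds hlim
    (Eventually.of_forall fun _ => zero_le) ?_
  filter_upwards [hr] with n hn
  refine le_trans (measure_mono ?_) (measure_biUnion_finset_le _ _)
  rintro ω ⟨t, ht, h⟩
  by_contra hcon
  simp only [Finset.mem_univ, iUnion_true, mem_iUnion, mem_ofPred_eq, not_exists, not_and,
    not_lt] at hcon
  exact absurd ((pi_norm_le_iff_of_nonneg (by positivity)).2 fun j => hcon j t ht) (not_le.2 h)

theorem IsUniformLittleOp.mono_rate [Norm F] {T : Set ι} {Z : ℕ → ι → Ω → F} {r s : ℕ → ℝ}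
    (hZ : IsUniformLittleOp μ T Z r) (hrs : ∀ᶠ n in atTop, r n ≤ s n) :
    IsUniformLittleOp μ T Z s := by
  intro δ hδ
  refine tendsto_of_tendsto_of_tendsto_of_le_of_le' tendsto_const_nhds (hZ δ hδ)
    (Eventually.of_forall fun _ => zero_le) ?_
  filter_upwards [hrs] with n hn
  refine measure_mono ?_
  rintro ω ⟨t, ht, h⟩
  exact ⟨t, ht, lt_of_le_of_lt (by gcongr) h⟩

/-- A process dominated by the sum of two uniformly negligible processes is negligible. -/
theorem IsUniformLittleOp.of_le_add [Norm F] [Norm G] {E : Type*} [Norm E] {T : Set ι}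
    {A : ℕ → ι → Ω → F} {B : ℕ → ι → Ω → G} {Z : ℕ → ι → Ω → E} {r : ℕ → ℝ}
    (hA : IsUniformLittleOp μ T A r) (hB : IsUniformLittleOp μ T B r) {C : ℝ}
    (h : ∀ᶠ n in atTop, ∀ᵐ ω ∂μ, ∀ t ∈ T, ‖Z n t ω‖ ≤ C * ‖A n t ω‖ + C * ‖B n t ω‖)
    (hA0 : ∀ n t ω, 0 ≤ ‖A n t ω‖) (hB0 : ∀ n t ω, 0 ≤ ‖B n t ω‖) :
    IsUniformLittleOp μ T Z r := by
  intro δ hδ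
  -- Positive whatever the sign of `C`, so the threshold can be split into two parts `δ / (2D)`.
  set D := |C| + 1 with hD
  have hDpos : 0 < D := by positivity
  have hδ' : 0 < δ / (2 * D) := by positivity
  have hlim := (hA _ hδ').add (hB _ hδ')
  rw [add_zero] at hlim
  refine tendsto_of_tendsto_of_tendsto_of_le_of_le' tendsto_const_nhds hlim
    (Eventually.of_forall fun _ => zero_le) ?_
  filter_upwards [h] with n hn
  refine le_trans (measure_mono_ae ?_) (measure_union_le _ _)
  filter_upwards [hn] with ω hω
  rintro ⟨t, ht, hlt⟩
  change ω ∈ (_ ∪ _ : Set Ω)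
  by_contra hcon
  simp only [mem_ofPred_eq, not_or, not_exists, not_and, not_lt, mem_union] at hcon
  have ha := hcon.1 t ht
  have hb := hcon.2 t ht
  have hCD : C ≤ D := (le_abs_self C).trans (by simp [hD])
  have h1 : ‖Z n t ω‖ ≤ D * ‖A n t ω‖ + D * ‖B n t ω‖ :=
    (hω t ht).trans (add_le_add (mul_le_mul_of_nonneg_right hCD (hA0 _ _ _))
      (mul_le_mul_of_nonneg_right hCD (hB0 _ _ _)))
  have h2 : D * ‖A n t ω‖ + D * ‖B n t ω‖ ≤ D * (δ / (2 * D) * r n) + D * (δ / (2 * D) * r n) := by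
    gcongr
  have h3 : D * (δ / (2 * D) * r n) + D * (δ / (2 * D) * r n) = δ * r n := by
    field_simp; ring
  linarith

theorem isLittleOp_iff_uniform [Norm F] {Z : ℕ → Ω → F} {r : ℕ → ℝ} :
    IsLittleOp μ Z r ↔ IsUniformLittleOp μ (univ : Set Unit) (fun n _ ω => Z n ω) r :=
  ⟨fun h => h.uniform _, fun h => h.at (mem_univ ())⟩

theorem IsLittleOp.mono_rate [Norm F] {Z : ℕ → Ω → F} {r s : ℕ → ℝ}
    (hZ : IsLittleOp μ Z r) (hrs : ∀ᶠ n in atTop, r n ≤ s n) : IsLittleOp μ Z s :=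
  isLittleOp_iff_uniform.2 ((hZ.uniform _).mono_rate hrs)

theorem IsLittleOp.of_le_add {A B Z : ℕ → Ω → ℝ} {r : ℕ → ℝ} (hA : IsLittleOp μ A r)
    (hB : IsLittleOp μ B r) (C : ℝ)
    (h : ∀ᶠ n in atTop, ∀ᵐ ω ∂μ, |Z n ω| ≤ C * |A n ω| + C * |B n ω|) : IsLittleOp μ Z r :=
  isLittleOp_iff_uniform.2 <| (hA.uniform _).of_le_add (hB.uniform _) (C := C)
    (by filter_upwards [h] with n hn; filter_upwards [hn] with ω hω t _ using hω)
    (fun _ _ _ => norm_nonneg _) (fun _ _ _ => norm_nonneg _)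

theorem IsLittleOp.isBigOp [Norm F] {Z : ℕ → Ω → F} {r : ℕ → ℝ} (hZ : IsLittleOp μ Z r) :
    IsBigOp μ Z r := by
  intro κ hκ
  exact ⟨1, one_pos, (ENNReal.tendsto_nhds_zero.1 (hZ 1 one_pos)) κ hκ⟩

/-- A quantity bounded by the product of an `O_p(1)` term and any uniform bound of an
`o_p(r n)` process is `o_p(r n)`. -/
theorem IsBigOp.mul_uniformLittleOp {A Z : ℕ → Ω → ℝ} {T : Set ι} [Norm F]
    {D : ℕ → ι → Ω → F} {r : ℕ → ℝ} (hA : IsBigOp μ A fun _ => 1)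
    (hD : IsUniformLittleOp μ T D r) (hr : ∀ᶠ n in atTop, 0 ≤ r n)
    (h : ∀ᶠ n in atTop, ∀ᵐ ω ∂μ, ∀ b, 0 ≤ b → (∀ t ∈ T, ‖D n t ω‖ ≤ b) → |Z n ω| ≤ |A n ω| * b) :
    IsLittleOp μ Z r := by
  intro δ hδ
  rw [ENNReal.tendsto_nhds_zero]
  intro κ hκ
  obtain ⟨M, hM, hAM⟩ := hA (κ / 2) (ENNReal.half_pos hκ.ne')
  have hDM := (ENNReal.tendsto_nhds_zero.1 (hD (δ / M) (by positivity))) (κ / 2)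
    (ENNReal.half_pos hκ.ne')
  filter_upwards [hAM, hDM, h, hr] with n h1 h2 h3 h4
  rw [← ENNReal.add_halves κ]
  refine le_trans (measure_mono_ae ?_) ((measure_union_le _ _).trans (add_le_add h1 h2))
  filter_upwards [h3] with ω hω
  intro hlt
  change ω ∈ (_ ∪ _ : Set Ω)
  by_contra hcon
  simp only [mem_ofPred_eq, not_or, not_exists, not_and, not_lt, mul_one, mem_union] at hcon
  have hb : 0 ≤ δ / M * r n := by positivity
  have := hω _ hb hcon.2
  have h5 : |A n ω| * (δ / M * r n) ≤ M * (δ / M * r n) :=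
    mul_le_mul_of_nonneg_right hcon.1 hb
  have h6 : M * (δ / M * r n) = δ * r n := by field_simp
  have h7 : δ * r n < |Z n ω| := hlt
  linarith

theorem IsBigOp.mul_littleOp {A B Z : ℕ → Ω → ℝ} {r : ℕ → ℝ} (hA : IsBigOp μ A fun _ => 1)
    (hB : IsLittleOp μ B r) (hr : ∀ᶠ n in atTop, 0 ≤ r n)
    (h : ∀ᶠ n in atTop, ∀ᵐ ω ∂μ, |Z n ω| ≤ |A n ω| * |B n ω|) : IsLittleOp μ Z r := by
  refine hA.mul_uniformLittleOp (hB.uniform (univ : Set Unit)) hr ?_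
  filter_upwards [h] with n hn
  filter_upwards [hn] with ω hω b _ hb
  exact hω.trans (mul_le_mul_of_nonneg_left (hb () trivial) (abs_nonneg _))

theorem IsBigOp.isLittleOp [Norm F] {Z : ℕ → Ω → F} {r s : ℕ → ℝ} (hZ : IsBigOp μ Z s)
    (hsr : ∀ δ : ℝ, 0 < δ → ∀ᶠ n in atTop, s n ≤ δ * r n) : IsLittleOp μ Z r := by
  intro δ hδ
  rw [ENNReal.tendsto_nhds_zero]
  intro κ hκ
  obtain ⟨M, hM, hZM⟩ := hZ κ hκ
  filter_upwards [hZM, hsr (δ / M) (by positivity)] with n h1 h2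
  refine le_trans (measure_mono fun ω hω => ?_) h1
  have h3 : M * s n ≤ M * (δ / M * r n) := by gcongr
  have h4 : M * (δ / M * r n) = δ * r n := by field_simp
  have h5 : δ * r n < ‖Z n ω‖ := hω
  exact lt_of_le_of_lt (h3.trans h4.le) h5

theorem IsBigOp.of_le {A Z : ℕ → Ω → ℝ} {r : ℕ → ℝ} (hA : IsBigOp μ A r) {C : ℝ}
    (hr : ∀ᶠ n in atTop, 0 ≤ r n)
    (h : ∀ᶠ n in atTop, ∀ᵐ ω ∂μ, |Z n ω| ≤ C * |A n ω|) : IsBigOp μ Z r := by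
  intro κ hκ
  obtain ⟨M, hM, hAM⟩ := hA κ hκ
  refine ⟨(|C| + 1) * M, by positivity, ?_⟩
  filter_upwards [hAM, h, hr] with n h1 h2 h3
  refine le_trans (measure_mono_ae ?_) h1
  filter_upwards [h2] with ω hω
  intro hlt
  by_contra hcon
  have h4 : |A n ω| ≤ M * r n := not_lt.1 hcon
  have h5 : (|C| + 1) * M * r n < |Z n ω| := hlt
  have h6 : C * |A n ω| ≤ (|C| + 1) * |A n ω| :=
    mul_le_mul_of_nonneg_right (by linarith [le_abs_self C]) (abs_nonneg _)
  have h7 : (|C| + 1) * |A n ω| ≤ (|C| + 1) * (M * r n) := by gcongr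
  linarith

theorem IsBigOp.of_le_add {A B Z : ℕ → Ω → ℝ} {r : ℕ → ℝ} (hA : IsBigOp μ A r)
    (hB : IsBigOp μ B r)
    (h : ∀ᶠ n in atTop, ∀ᵐ ω ∂μ, |Z n ω| ≤ |A n ω| + |B n ω|) : IsBigOp μ Z r := by
  intro κ hκ
  obtain ⟨M, hM, hAM⟩ := hA (κ / 2) (ENNReal.half_pos hκ.ne')
  obtain ⟨N, hN, hBN⟩ := hB (κ / 2) (ENNReal.half_pos hκ.ne')
  refine ⟨M + N, by positivity, ?_⟩
  filter_upwards [hAM, hBN, h] with n h1 h2 h3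
  rw [← ENNReal.add_halves κ]
  refine le_trans (measure_mono_ae ?_) ((measure_union_le _ _).trans (add_le_add h1 h2))
  filter_upwards [h3] with ω hω
  intro hlt
  change ω ∈ (_ ∪ _ : Set Ω)
  by_contra hcon
  simp only [mem_ofPred_eq, not_or, not_lt, mem_union] at hcon
  have h5 : (M + N) * r n < |Z n ω| := hlt
  have h6 : |A n ω| ≤ M * r n := hcon.1
  have h7 : |B n ω| ≤ N * r n := hcon.2
  linarith

/-- Markov's inequality in real form. -/
theorem measure_lt_abs_le_of_lintegral_le {V : Ω → ℝ} (hV : AEMeasurable V μ) {e t : ℝ}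
    (ht : 0 < t) (he : ∫⁻ ω, ENNReal.ofReal |V ω| ∂μ ≤ ENNReal.ofReal e) :
    μ {ω | t < |V ω|} ≤ ENNReal.ofReal (e / t) := by
  have hmeas : AEMeasurable (fun ω => ENNReal.ofReal |V ω|) μ := by fun_prop
  have h1 := meas_ge_le_lintegral_div hmeas (ε := ENNReal.ofReal t)
    (by simpa using ht) ENNReal.ofReal_ne_top
  rw [ENNReal.ofReal_div_of_pos ht]
  refine le_trans (measure_mono fun ω (hω : t < |V ω|) => ?_) (h1.trans (by gcongr))
  exact ENNReal.ofReal_le_ofReal hω.le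

theorem isBigOp_of_lintegral_le {V : ℕ → Ω → ℝ} {r : ℕ → ℝ} {C : ℝ}
    (hr : ∀ᶠ n in atTop, 0 < r n) (hV : ∀ᶠ n in atTop, AEMeasurable (V n) μ)
    (he : ∀ᶠ n in atTop, ∫⁻ ω, ENNReal.ofReal |V n ω| ∂μ ≤ ENNReal.ofReal (C * r n)) :
    IsBigOp μ V r := by
  intro κ hκ
  obtain ⟨δ, hδ, hδκ⟩ : ∃ δ : ℝ, 0 < δ ∧ ENNReal.ofReal δ ≤ κ := by
    obtain ⟨q, hq, hqκ⟩ := ENNReal.lt_iff_exists_nnreal_btwn.1 hκ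
    exact ⟨q, by simpa using hq, by simpa using hqκ.le⟩
  refine ⟨(|C| + 1) / δ, by positivity, ?_⟩
  filter_upwards [hr, hV, he] with n h1 h2 h3
  have h4 := measure_lt_abs_le_of_lintegral_le h2 (t := (|C| + 1) / δ * r n) (by positivity) h3
  refine h4.trans (le_trans (ENNReal.ofReal_le_ofReal ?_) hδκ)
  rw [div_le_iff₀ (by positivity)]
  have : δ * ((|C| + 1) / δ * r n) = (|C| + 1) * r n := by field_simp
  rw [this]
  gcongr
  linarith [le_abs_self C]

theorem isLittleOp_of_lintegral_le {V : ℕ → Ω → ℝ} {r e : ℕ → ℝ}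
    (hr : ∀ᶠ n in atTop, 0 < r n) (hV : ∀ᶠ n in atTop, AEMeasurable (V n) μ)
    (he : ∀ᶠ n in atTop, ∫⁻ ω, ENNReal.ofReal |V n ω| ∂μ ≤ ENNReal.ofReal (e n))
    (her : Tendsto (fun n => e n / r n) atTop (𝓝 0)) : IsLittleOp μ V r := by
  intro δ hδ
  have hlim : Tendsto (fun n => ENNReal.ofReal (e n / r n / δ)) atTop (𝓝 0) := by
    simpa using ENNReal.tendsto_ofReal (her.div_const δ)
  refine tendsto_of_tendsto_of_tendsto_of_le_of_le' tendsto_const_nhds hlim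
    (Eventually.of_forall fun _ => zero_le) ?_
  filter_upwards [hr, hV, he] with n h1 h2 h3
  have h4 := measure_lt_abs_le_of_lintegral_le h2 (t := δ * r n) (by positivity) h3
  rwa [div_div, mul_comm (r n)]

end StochasticOrders

/-! ### Moments and Chebyshev bounds for i.i.d. sample means. -/

section SampleMean

variable {Ω E : Type*} [MeasurableSpace Ω] [MeasurableSpace E] {μ : Measure Ω}

/-- The mean of `φ (Z i)`, `i < n`. -/
def sampleMean (Z : ℕ → Ω → E) (φ : E → ℝ) (n : ℕ) (ω : Ω) : ℝ :=
  (n : ℝ)⁻¹ * ∑ i ∈ Finset.range n, φ (Z i ω)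

variable {Z : ℕ → Ω → E}

theorem memLp_sampleMean (hid : ∀ i, IdentDistrib (Z i) (Z 0) μ μ) {φ : E → ℝ} (hφ : Measurable φ)
    (h2 : MemLp (fun ω => φ (Z 0 ω)) 2 μ) (n : ℕ) : MemLp (sampleMean Z φ n) 2 μ := by
  unfold sampleMean
  have hi : ∀ i ∈ Finset.range n, MemLp (fun ω => φ (Z i ω)) 2 μ :=
    fun i _ => IdentDistrib.memLp_iff (g := fun ω => φ (Z 0 ω)) ((hid i).comp hφ) |>.2 h2
  exact (memLp_finsetSum (Finset.range n) hi).const_mul _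

theorem integral_sampleMean (hid : ∀ i, IdentDistrib (Z i) (Z 0) μ μ) {φ : E → ℝ}
    (hφ : Measurable φ) (h1 : Integrable (fun ω => φ (Z 0 ω)) μ) {n : ℕ} (hn : n ≠ 0) :
    ∫ ω, sampleMean Z φ n ω ∂μ = ∫ ω, φ (Z 0 ω) ∂μ := by
  unfold sampleMean
  have hi : ∀ i, IdentDistrib (fun ω => φ (Z i ω)) (fun ω => φ (Z 0 ω)) μ μ :=
    fun i => (hid i).comp hφ
  rw [integral_const_mul, integral_finsetSum _ fun i _ => (hi i).integrable_iff.2 h1]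
  simp_rw [(hi _).integral_eq]
  simp [hn]

theorem variance_sampleMean_le [IsProbabilityMeasure μ] (hi : iIndepFun Z μ) (hid : ∀ i, IdentDistrib (Z i) (Z 0) μ μ)
    {φ : E → ℝ} (hφ : Measurable φ) (h2 : MemLp (fun ω => φ (Z 0 ω)) 2 μ) {n : ℕ} (hn : n ≠ 0) :
    Var[sampleMean Z φ n; μ] ≤ (∫ ω, φ (Z 0 ω) ^ 2 ∂μ) / n := by
  have hii : ∀ i, IdentDistrib (fun ω => φ (Z i ω)) (fun ω => φ (Z 0 ω)) μ μ :=
    fun i => (hid i).comp hφ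
  have hsum : Var[fun ω => ∑ i ∈ Finset.range n, φ (Z i ω); μ] =
      n * Var[fun ω => φ (Z 0 ω); μ] := by
    have := IndepFun.variance_sum (s := Finset.range n) (X := fun i ω => φ (Z i ω))
      (fun i _ => (hii i).memLp_iff.2 h2)
      (fun i _ j _ hij => (hi.indepFun hij).comp hφ hφ)
    have h3 : (∑ i ∈ Finset.range n, fun ω => φ (Z i ω)) =
        fun ω => ∑ i ∈ Finset.range n, φ (Z i ω) := by ext; simp
    rw [h3] at this
    rw [this]
    simp [(hii _).variance_eq]
  have hmain : Var[sampleMean Z φ n; μ] = Var[fun ω => φ (Z 0 ω); μ] / n := by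
    unfold sampleMean
    rw [variance_const_mul, hsum]
    field_simp
  rw [hmain]
  gcongr
  exact variance_le_expectation_sq h2.1

theorem measure_sampleMean_sub_le [IsProbabilityMeasure μ] (hi : iIndepFun Z μ)
    (hid : ∀ i, IdentDistrib (Z i) (Z 0) μ μ) {φ : E → ℝ} (hφ : Measurable φ)
    (h2 : MemLp (fun ω => φ (Z 0 ω)) 2 μ) {n : ℕ} (hn : n ≠ 0) {t : ℝ} (ht : 0 < t) :
    μ {ω | t < |sampleMean Z φ n ω - ∫ ω, φ (Z 0 ω) ∂μ|} ≤
      ENNReal.ofReal ((∫ ω, φ (Z 0 ω) ^ 2 ∂μ) / n / t ^ 2) := by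
  have h1 : Integrable (fun ω => φ (Z 0 ω)) μ := h2.integrable (by norm_num)
  rw [← integral_sampleMean hid hφ h1 hn]
  refine le_trans (measure_mono fun ω hω => ?_)
    ((meas_ge_le_variance_div_sq (memLp_sampleMean hid hφ h2 n) ht).trans
      (ENNReal.ofReal_le_ofReal ?_))
  · rw [mem_ofPred_eq] at hω ⊢
    exact hω.le
  · gcongr
    exact variance_sampleMean_le hi hid hφ h2 hn

/-- Jensen in the form `(E|S|)² ≤ E S²`, which is the variance plus the squared mean. Keeping the
mean and the standard deviation apart matters for the derivative of a kernel mean, where the former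
stays bounded. -/
theorem lintegral_abs_sampleMean_le [IsProbabilityMeasure μ] (hi : iIndepFun Z μ)
    (hid : ∀ i, IdentDistrib (Z i) (Z 0) μ μ) {φ : E → ℝ} (hφ : Measurable φ)
    (h2 : MemLp (fun ω => φ (Z 0 ω)) 2 μ) {n : ℕ} (hn : n ≠ 0) :
    ∫⁻ ω, ENNReal.ofReal |sampleMean Z φ n ω| ∂μ ≤
      ENNReal.ofReal (|∫ ω, φ (Z 0 ω) ∂μ| + √((∫ ω, φ (Z 0 ω) ^ 2 ∂μ) / n)) := by
  have h1 : Integrable (fun ω => φ (Z 0 ω)) μ := h2.integrable (by norm_num)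
  have hL := memLp_sampleMean hid hφ h2 n
  have hint : Integrable (sampleMean Z φ n) μ := hL.integrable (by norm_num)
  rw [← ofReal_integral_eq_lintegral_ofReal hint.abs (ae_of_all _ fun _ => abs_nonneg _)]
  refine ENNReal.ofReal_le_ofReal ?_
  have hv := variance_sampleMean_le hi hid hφ h2 hn
  rw [variance_eq_sub hL, integral_sampleMean hid hφ h1 hn] at hv
  have hv' := variance_nonneg (fun ω => |sampleMean Z φ n ω|) μ
  rw [variance_eq_sub (show MemLp (fun ω => |sampleMean Z φ n ω|) 2 μ from hL.abs)] at hv'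
  simp only [Pi.pow_apply, sq_abs] at hv hv'
  have hV0 : 0 ≤ (∫ ω, φ (Z 0 ω) ^ 2 ∂μ) / n :=
    div_nonneg (integral_nonneg fun _ => sq_nonneg _) (Nat.cast_nonneg _)
  refine abs_le_of_sq_le_sq' ?_ (by positivity) |>.2
  have h5 := Real.sq_sqrt hV0
  have h6 := Real.sqrt_nonneg ((∫ ω, φ (Z 0 ω) ^ 2 ∂μ) / n)
  have h7 := abs_nonneg (∫ ω, φ (Z 0 ω) ∂μ)
  have h8 := sq_abs (∫ ω, φ (Z 0 ω) ∂μ)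
  nlinarith [mul_nonneg h7 h6]

theorem isBigOp_sampleMean_sub [IsProbabilityMeasure μ] (hi : iIndepFun Z μ)
    (hid : ∀ i, IdentDistrib (Z i) (Z 0) μ μ) {φ : E → ℝ} (hφ : Measurable φ)
    (h2 : MemLp (fun ω => φ (Z 0 ω)) 2 μ) :
    IsBigOp μ (fun n ω => sampleMean Z φ n ω - ∫ ω, φ (Z 0 ω) ∂μ)
      fun n => (n : ℝ) ^ (-(1 / 2) : ℝ) := by
  intro κ hκ
  obtain ⟨δ, hδ, hδκ⟩ : ∃ δ : ℝ, 0 < δ ∧ ENNReal.ofReal δ ≤ κ := by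
    obtain ⟨q, hq, hqκ⟩ := ENNReal.lt_iff_exists_nnreal_btwn.1 hκ
    exact ⟨q, by simpa using hq, by simpa using hqκ.le⟩
  set V := ∫ ω, φ (Z 0 ω) ^ 2 ∂μ with hV
  have hV0 : 0 ≤ V := integral_nonneg fun _ => sq_nonneg _
  -- Chebyshev at level `M n^{-1/2}` gives `V / M²`, at most `δ` for this `M`; the summand 1 keeps
  -- `M` positive when `V = 0`.
  have hM : 0 < √((V + 1) / δ) := Real.sqrt_pos.2 (by positivity)
  refine ⟨√((V + 1) / δ), hM, ?_⟩
  filter_upwards [eventually_ge_atTop 1] with n hn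
  have hn0 : (0 : ℝ) < n := by exact_mod_cast hn
  have hr : 0 < (n : ℝ) ^ (-(1 / 2) : ℝ) := Real.rpow_pos_of_pos hn0 _
  refine (measure_sampleMean_sub_le hi hid hφ h2 (by omega) (mul_pos hM hr)).trans
    ((ENNReal.ofReal_le_ofReal ?_).trans hδκ)
  have hr2 : ((n : ℝ) ^ (-(1 / 2) : ℝ)) ^ 2 = (n : ℝ)⁻¹ := by
    rw [← Real.rpow_natCast, ← Real.rpow_mul hn0.le]
    norm_num [Real.rpow_neg_one]
  rw [mul_pow, hr2, Real.sq_sqrt (by positivity), ← hV]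
  rw [div_div, div_le_iff₀ (by positivity)]
  field_simp
  linarith

end SampleMean

/-! ### Maximal inequality by dyadic chaining. -/

section Chaining

variable {Ω : Type*} [MeasurableSpace Ω] {μ : Measure Ω}

/-- Dyadic chaining with second moments. -/
theorem measure_exists_lt_abs_sub_le {t : ℝ} (ht : 0 < t) (L : ℕ) :
    ∀ (C : ℝ) (D : ℕ → Ω → ℝ), 0 ≤ C →
    (∀ i j, i ≤ j → j ≤ 2 ^ L →
      μ {ω | t < |D j ω - D i ω|} ≤ ENNReal.ofReal (C * (j - i : ℝ))) →
    μ {ω | ∃ j ≤ 2 ^ L, (L + 1) * t < |D j ω - D 0 ω|} ≤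
      ENNReal.ofReal ((L + 1) * C * 2 ^ L) := by
  induction L with
  | zero =>
    intro C D hC h
    have := h 0 1 (by norm_num) (by norm_num)
    simp only [Nat.cast_one, Nat.cast_zero, sub_zero, mul_one] at this
    simp only [CharP.cast_eq_zero, zero_add, one_mul, pow_zero, mul_one]
    refine le_trans (measure_mono ?_) this
    rintro ω ⟨j, hj, hlt⟩
    interval_cases j
    · simp only [sub_self, abs_zero] at hlt
      linarith
    · exact hlt
  | succ L ih =>
    intro C D hC h
    -- The even indices form a chain of depth `L` whose unit increments cost `2C`. An odd index is
    -- one further increment from its left neighbour, and there are `2 ^ L` of those at cost `C`.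
    -- Each level therefore adds one `t` to the threshold and at most `C * 2 ^ (L + 1)` to the
    -- probability.
    have h1 := ih (2 * C) (fun j => D (2 * j)) (by positivity) (by
      intro i j hij hj
      have := h (2 * i) (2 * j) (by omega) (by rw [pow_succ]; omega)
      refine this.trans (ENNReal.ofReal_le_ofReal (le_of_eq ?_))
      push_cast; ring)
    have h2 : μ (⋃ j ∈ Finset.range (2 ^ L), {ω | t < |D (2 * j + 1) ω - D (2 * j) ω|}) ≤
        ENNReal.ofReal (2 ^ L * C) := by
      refine (measure_biUnion_finset_le _ _).trans ?_
      refine (Finset.sum_le_sum fun j hj => h (2 * j) (2 * j + 1) (by omega) (by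
        have := Finset.mem_range.1 hj
        rw [pow_succ]; omega)).trans ?_
      simp only [Nat.cast_add, Nat.cast_one, add_sub_cancel_left, mul_one, Finset.sum_const,
        Finset.card_range, nsmul_eq_mul]
      rw [ENNReal.ofReal_mul (by positivity)]
      gcongr
      simp
    have h3 := (measure_union_le _ _).trans (add_le_add h1 h2)
    rw [← ENNReal.ofReal_add (by positivity) (by positivity)] at h3
    refine le_trans (measure_mono ?_) (h3.trans (ENNReal.ofReal_le_ofReal ?_))
    · rintro ω ⟨j, hj, hlt⟩
      by_contra hcon
      simp only [mul_zero, mem_union, mem_ofPred_eq, not_or, not_exists, not_and, not_lt,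
        mem_iUnion, Finset.mem_range] at hcon
      obtain ⟨hc1, hc2⟩ := hcon
      rw [pow_succ] at hj
      push_cast at hlt
      obtain ⟨k, rfl | rfl⟩ := Nat.even_or_odd' j
      · have := hc1 k (by omega)
        nlinarith
      · have ha := hc1 k (by omega)
        have hb := hc2 k (by omega)
        have := abs_sub_le (D (2 * k + 1) ω) (D (2 * k) ω) (D 0 ω)
        linarith
    · push_cast
      have : 0 ≤ 2 ^ L * C := by positivity
      rw [pow_succ]
      nlinarith

end Chaining

/-! ### Quantiles of laws without atoms. -/

section Quantile

variable {m : Measure ℝ}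

theorem quantile_eq_sInf_cdf [IsProbabilityMeasure m] (p : ℝ) : quantile m p = sInf {q | p ≤ cdf m q} := by
  unfold quantile
  congr 1
  ext q
  rw [mem_ofPred_eq, mem_ofPred_eq, ← ofReal_cdf, ENNReal.ofReal_le_ofReal_iff (cdf_nonneg m q)]

theorem nonempty_setOf_le_cdf {p : ℝ} (hp : p < 1) : {q | p ≤ cdf m q}.Nonempty := by
  obtain ⟨q, hq⟩ := ((tendsto_cdf_atTop m).eventually (lt_mem_nhds hp)).exists
  exact ⟨q, hq.le⟩

theorem bddBelow_setOf_le_cdf {p : ℝ} (hp : 0 < p) : BddBelow {q | p ≤ cdf m q} := by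
  obtain ⟨q, hq⟩ := ((tendsto_cdf_atBot m).eventually (gt_mem_nhds hp)).exists
  refine ⟨q, fun q' hq' => ?_⟩
  by_contra hlt
  have h1 := monotone_cdf m (not_le.1 hlt).le
  have h2 : p ≤ cdf m q' := hq'
  linarith

theorem quantile_mono [IsProbabilityMeasure m] {p p' : ℝ} (hp : 0 < p) (hpp : p ≤ p') (hp' : p' < 1) :
    quantile m p ≤ quantile m p' := by
  rw [quantile_eq_sInf_cdf, quantile_eq_sInf_cdf]
  exact csInf_le_csInf (bddBelow_setOf_le_cdf hp) (nonempty_setOf_le_cdf hp')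
    fun q (hq : p' ≤ cdf m q) => hpp.trans hq

/-- Right continuity gives `≥`; below the quantile the distribution function is less than `p`, so
its left limit is at most `p`, and without an atom there is no jump. -/
theorem cdf_quantile [IsProbabilityMeasure m] [NullSingletonClass m] {p : ℝ} (hp : p ∈ Ioo (0 : ℝ) 1) :
    cdf m (quantile m p) = p := by
  have hne := nonempty_setOf_le_cdf (m := m) hp.2
  have hbdd := bddBelow_setOf_le_cdf (m := m) hp.1
  rw [quantile_eq_sInf_cdf]
  set Q := sInf {q | p ≤ cdf m q} with hQ
  have hright : ∀ q, Q < q → p ≤ cdf m q := by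
    intro q hq
    obtain ⟨q', hq', hlt⟩ := exists_lt_of_csInf_lt hne hq
    exact (show p ≤ cdf m q' from hq').trans (monotone_cdf m hlt.le)
  have hleft : ∀ q, q < Q → cdf m q < p := by
    intro q hq
    by_contra hcon
    exact absurd (csInf_le hbdd (show q ∈ {q | p ≤ cdf m q} from not_lt.1 hcon)) (not_le.2 hq)
  apply le_antisymm
  · have hs : (cdf m).measure {Q} = 0 := by rw [measure_cdf]; exact measure_singleton Q
    rw [StieltjesFunction.measure_singleton, ENNReal.ofReal_eq_zero] at hs
    have hl : Function.leftLim (cdf m) Q ≤ p := by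
      refine le_of_tendsto ((monotone_cdf m).tendsto_leftLim Q) ?_
      filter_upwards [self_mem_nhdsWithin] with q hq using (hleft q hq).le
    linarith
  · have hc : Tendsto (cdf m) (𝓝[>] Q) (𝓝 (cdf m Q)) :=
      ((cdf m).right_continuous Q).mono_left (nhdsWithin_mono _ Ioi_subset_Ici_self)
    refine ge_of_tendsto hc ?_
    filter_upwards [self_mem_nhdsWithin] with q hq using hright q hq

theorem measure_Iic_quantile [IsProbabilityMeasure m] [NullSingletonClass m] {p : ℝ} (hp : p ∈ Ioo (0 : ℝ) 1) :
    m (Iic (quantile m p)) = ENNReal.ofReal p := by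
  rw [← ofReal_cdf, cdf_quantile hp]

end Quantile

/-! ### Disintegration along the conditional densities. -/

section Densities

variable {Ω : Type*} [MeasurableSpace Ω] {d : ℕ} {μ : Measure Ω}
    {Y : Ω → ℝ} {X : Ω → Fin d → ℝ} {ν : Measure (Fin d → ℝ)}
    {fX : (Fin d → ℝ) → ℝ} {f : ℝ → (Fin d → ℝ) → ℝ} {fY : ℝ → ℝ}

instance nullSingletonClass_condLaw (x : Fin d → ℝ) : NullSingletonClass (condLaw f x) := by
  unfold condLaw; infer_instance

theorem ae_mem_support (hX : Measurable X) : ∀ᵐ ω ∂μ, X ω ∈ (μ.map X).support :=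
  ae_of_ae_map hX.aemeasurable Measure.support_mem_ae

theorem measurableSet_support (m : Measure (Fin d → ℝ)) : MeasurableSet m.support :=
  Measure.isClosed_support.measurableSet

/-- The conditional law is a probability measure, and the density bounds hold, only on the support
of `X`. Restricting `ν` to it loses nothing, since `X` lies there almost surely. -/
theorem HasDensities.map_eq [SFinite ν] (hd : HasDensities μ Y X ν fX f fY) (hY : Measurable Y)
    (hX : Measurable X) :
    μ.map (fun ω => (Y ω, X ω)) = (volume.prod (ν.restrict (μ.map X).support)).withDensity
      fun p => ENNReal.ofReal (f p.1 p.2 * fX p.2) := by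
  set S := (μ.map X).support
  have hS : MeasurableSet S := measurableSet_support _
  have h1 : (μ.map fun ω => (Y ω, X ω)).restrict (univ ×ˢ S) = μ.map fun ω => (Y ω, X ω) := by
    refine Measure.restrict_eq_self_of_ae_mem ?_
    refine (ae_map_iff (by fun_prop) (MeasurableSet.univ.prod hS)).2 ?_
    filter_upwards [ae_mem_support hX] with ω hω using ⟨mem_univ _, hω⟩
  rw [← h1, hd.joint, restrict_withDensity (MeasurableSet.univ.prod hS), ← Measure.prod_restrict,
    Measure.restrict_univ]

theorem HasDensities.lintegral_eq [SFinite ν] (hd : HasDensities μ Y X ν fX f fY)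
    (hY : Measurable Y) (hX : Measurable X) {φ : ℝ × (Fin d → ℝ) → ENNReal} (hφ : Measurable φ) :
    ∫⁻ ω, φ (Y ω, X ω) ∂μ = ∫⁻ x in (μ.map X).support, ENNReal.ofReal (fX x) *
      ∫⁻ y, φ (y, x) ∂(condLaw f x) ∂ν := by
  have hf := hd.measurable_f
  have hfX := hd.measurable_fX
  have hmeas : Measurable fun p : ℝ × (Fin d → ℝ) => ENNReal.ofReal (f p.1 p.2 * fX p.2) := by
    fun_prop
  rw [← lintegral_map hφ (show Measurable fun ω => (Y ω, X ω) by fun_prop), hd.map_eq hY hX,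
    lintegral_withDensity_eq_lintegral_mul _ hmeas hφ,
    lintegral_prod_symm' _ (hmeas.mul hφ)]
  refine lintegral_congr fun x => ?_
  have hfx : Measurable fun y => ENNReal.ofReal (f y x) :=
    (hf.comp (measurable_id.prodMk measurable_const)).ennreal_ofReal
  rw [condLaw, lintegral_withDensity_eq_lintegral_mul _ hfx (by fun_prop),
    ← lintegral_const_mul _ (by fun_prop)]
  refine lintegral_congr fun y => ?_
  simp only [Pi.mul_apply]
  rw [ENNReal.ofReal_mul (hd.f_nonneg y x)]
  ring

theorem HasDensities.lintegral_fst_eq [SFinite ν] (hd : HasDensities μ Y X ν fX f fY)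
    (hY : Measurable Y) (hX : Measurable X) {g : (Fin d → ℝ) → ENNReal} (hg : Measurable g) :
    ∫⁻ ω, g (X ω) ∂μ = ∫⁻ x in (μ.map X).support, ENNReal.ofReal (fX x) * g x ∂ν := by
  rw [hd.lintegral_eq hY hX (φ := fun p => g p.2) (by fun_prop)]
  refine setLIntegral_congr_fun (measurableSet_support _) fun x hx => ?_
  have := hd.cond x hx
  simp

/-- The law of `Y` given `X = x` is `condLaw f x`. -/
theorem HasDensities.lintegral_cond [SFinite ν] (hd : HasDensities μ Y X ν fX f fY)
    (hY : Measurable Y) (hX : Measurable X) {φ : ℝ × (Fin d → ℝ) → ENNReal} (hφ : Measurable φ)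
    {G : (Fin d → ℝ) → ENNReal} (hG : Measurable G)
    (hGφ : ∀ x ∈ (μ.map X).support, ∫⁻ y, φ (y, x) ∂(condLaw f x) = G x) :
    ∫⁻ ω, φ (Y ω, X ω) ∂μ = ∫⁻ ω, G (X ω) ∂μ := by
  rw [hd.lintegral_eq hY hX hφ, hd.lintegral_fst_eq hY hX hG]
  exact setLIntegral_congr_fun (measurableSet_support _) fun x hx => by
    simp only [hGφ x hx]

/-- The law of `Y` is a mixture of conditional laws with densities at most `C`. Expectations of
kernel terms thereby reduce to Lebesgue integrals, computable by scaling. -/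
theorem HasDensities.lintegral_le [SFinite ν] [IsProbabilityMeasure μ]
    (hd : HasDensities μ Y X ν fX f fY)
    (hY : Measurable Y) (hX : Measurable X) {C : ℝ}
    (hC : ∀ x ∈ (μ.map X).support, ∀ y, f y x ≤ C) {φ : ℝ → ENNReal} (hφ : Measurable φ) :
    ∫⁻ ω, φ (Y ω) ∂μ ≤ ENNReal.ofReal C * ∫⁻ y, φ y := by
  rw [hd.lintegral_eq hY hX (φ := fun p => φ p.1) (by fun_prop)]
  calc _ ≤ ∫⁻ x in (μ.map X).support, ENNReal.ofReal (fX x) *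
        (ENNReal.ofReal C * ∫⁻ y, φ y) ∂ν := by
        refine setLIntegral_mono' (measurableSet_support _) fun x hx => ?_
        gcongr
        have hfx : Measurable fun y => ENNReal.ofReal (f y x) :=
          (hd.measurable_f.comp (measurable_id.prodMk measurable_const)).ennreal_ofReal
        rw [condLaw, lintegral_withDensity_eq_lintegral_mul _ hfx hφ,
          ← lintegral_const_mul _ hφ]
        refine lintegral_mono fun y => ?_
        simp only [Pi.mul_apply]
        gcongr
        exact hC x hx y
    _ = _ := by
        rw [← hd.lintegral_fst_eq hY hX (g := fun _ => ENNReal.ofReal C * ∫⁻ y, φ y)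
          measurable_const]
        simp

/-- The integral over `y` is the inner one, so that integration by parts and changes of variable in
`y` can be done at fixed `x`. -/
theorem HasDensities.integral_eq [SFinite ν] (hd : HasDensities μ Y X ν fX f fY)
    (hY : Measurable Y) (hX : Measurable X) {φ : ℝ × (Fin d → ℝ) → ℝ} (hφ : Measurable φ)
    (hi : Integrable (fun ω => φ (Y ω, X ω)) μ) :
    ∫ ω, φ (Y ω, X ω) ∂μ =
      ∫ x in (μ.map X).support, (∫ y, (f y x * fX x) * φ (y, x)) ∂ν := by
  have hf := hd.measurable_f
  have hfX := hd.measurable_fX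
  have hmeas : Measurable fun p : ℝ × (Fin d → ℝ) => ENNReal.ofReal (f p.1 p.2 * fX p.2) := by
    fun_prop
  have hp : Measurable fun ω => (Y ω, X ω) := by fun_prop
  have hi' := (integrable_map_measure (μ := μ) hφ.aestronglyMeasurable hp.aemeasurable).2 hi
  rw [← integral_map (μ := μ) hp.aemeasurable (f := φ) hφ.aestronglyMeasurable]
  rw [hd.map_eq hY hX] at hi' ⊢
  rw [integrable_withDensity_iff_integrable_smul' hmeas (by simp)] at hi'
  rw [integral_withDensity_eq_integral_toReal_smul hmeas (by simp), integral_prod_symm _ hi']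
  refine integral_congr_ae (ae_of_all _ fun x => ?_)
  refine integral_congr_ae (ae_of_all _ fun y => ?_)
  simp only [smul_eq_mul]
  rw [ENNReal.toReal_ofReal (mul_nonneg (hd.f_nonneg _ _) (hd.fX_nonneg _))]

theorem HasDensities.lintegral_fX [SFinite ν] [IsProbabilityMeasure μ]
    (hd : HasDensities μ Y X ν fX f fY) (hY : Measurable Y) (hX : Measurable X) :
    ∫⁻ x in (μ.map X).support, ENNReal.ofReal (fX x) ∂ν = 1 := by
  have := hd.lintegral_fst_eq hY hX (g := fun _ => 1) measurable_const
  simpa using this.symm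

theorem HasDensities.integrable_fX [SFinite ν] [IsProbabilityMeasure μ]
    (hd : HasDensities μ Y X ν fX f fY) (hY : Measurable Y) (hX : Measurable X) :
    Integrable fX (ν.restrict (μ.map X).support) := by
  refine ⟨hd.measurable_fX.aestronglyMeasurable, ?_⟩
  rw [hasFiniteIntegral_iff_ofReal (ae_of_all _ hd.fX_nonneg), hd.lintegral_fX hY hX]
  exact ENNReal.one_lt_top

theorem HasDensities.integral_fX [SFinite ν] [IsProbabilityMeasure μ]
    (hd : HasDensities μ Y X ν fX f fY) (hY : Measurable Y) (hX : Measurable X) :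
    ∫ x in (μ.map X).support, fX x ∂ν = 1 := by
  rw [integral_eq_lintegral_of_nonneg_ae (ae_of_all _ hd.fX_nonneg)
    hd.measurable_fX.aestronglyMeasurable, hd.lintegral_fX hY hX, ENNReal.toReal_one]

theorem HasDensities.measure_le_quantile [IsProbabilityMeasure μ]
    (hd : HasDensities μ Y X ν fX f fY) (hY : Measurable Y) {τ : ℝ} (hτ : τ ∈ Ioo (0 : ℝ) 1) :
    μ {ω | Y ω ≤ quantile (μ.map Y) τ} = ENNReal.ofReal τ := by
  have : IsProbabilityMeasure (μ.map Y) := Measure.isProbabilityMeasure_map hY.aemeasurable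
  have : NullSingletonClass (μ.map Y) := by rw [hd.marginal]; infer_instance
  rw [← measure_Iic_quantile (m := μ.map Y) hτ, Measure.map_apply hY measurableSet_Iic]
  rfl

end Densities

/-! ### Moments of the quantile regression score. -/

section Score

variable {Ω : Type*} [MeasurableSpace Ω] {d : ℕ} {μ : Measure Ω}
    {Y : Ω → ℝ} {X : Ω → Fin d → ℝ} {ν : Measure (Fin d → ℝ)}
    {fX : (Fin d → ℝ) → ℝ} {f : ℝ → (Fin d → ℝ) → ℝ} {fY : ℝ → ℝ}

/-- The indicator of `y ≤ x'b`. -/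
def belowInd (b : Fin d → ℝ) (p : ℝ × (Fin d → ℝ)) : ℝ := if p.1 ≤ p.2 ⬝ᵥ b then 1 else 0

theorem measurable_dotProduct_const (b : Fin d → ℝ) : Measurable fun x : Fin d → ℝ => x ⬝ᵥ b :=
  (continuous_id.dotProduct continuous_const).measurable

@[fun_prop]
theorem measurable_belowInd (b : Fin d → ℝ) : Measurable (belowInd b) :=
  Measurable.ite (measurableSet_le measurable_fst
    ((measurable_dotProduct_const b).comp measurable_snd)) measurable_const measurable_const

theorem belowInd_nonneg (b : Fin d → ℝ) (p : ℝ × (Fin d → ℝ)) : 0 ≤ belowInd b p := by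
  unfold belowInd; split_ifs <;> norm_num

theorem belowInd_le_one (b : Fin d → ℝ) (p : ℝ × (Fin d → ℝ)) : belowInd b p ≤ 1 := by
  unfold belowInd; split_ifs <;> norm_num

theorem belowInd_mono {b b' : Fin d → ℝ} {p : ℝ × (Fin d → ℝ)} (h : p.2 ⬝ᵥ b ≤ p.2 ⬝ᵥ b') :
    belowInd b p ≤ belowInd b' p := by
  unfold belowInd
  split_ifs with h1 h2
  · rfl
  · exact absurd (h1.trans h) h2
  · norm_num
  · rfl

/-- Nested events: the difference of their indicators is again an indicator. -/
theorem belowInd_sub_sq {b b' : Fin d → ℝ} {p : ℝ × (Fin d → ℝ)} (h : p.2 ⬝ᵥ b ≤ p.2 ⬝ᵥ b') :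
    (belowInd b' p - belowInd b p) ^ 2 = belowInd b' p - belowInd b p := by
  have := belowInd_mono h
  unfold belowInd at *
  split_ifs at * <;> norm_num at *

theorem integrable_mul_belowInd {g : (Fin d → ℝ) → ℝ} (hY : Measurable Y) (hX : Measurable X)
    (hgi : Integrable (fun ω => g (X ω)) μ) (b : Fin d → ℝ) :
    Integrable (fun ω => g (X ω) * belowInd b (Y ω, X ω)) μ := by
  have hm : Measurable fun ω => belowInd b (Y ω, X ω) :=
    (measurable_belowInd b).comp (hY.prodMk hX)
  refine hgi.mul_bdd (c := 1) hm.aestronglyMeasurable (ae_of_all _ fun ω => ?_)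
  rw [Real.norm_eq_abs, abs_of_nonneg (belowInd_nonneg _ _)]
  exact belowInd_le_one _ _

/-- Conditionally on `X = x` the event has probability `η`, which factors out. For `g ≥ 0` this can
be done with lower Lebesgue integrals; signed `g` is handled afterwards by positive and negative
parts. -/
theorem HasDensities.integral_mul_belowInd_of_nonneg [SFinite ν]
    (hd : HasDensities μ Y X ν fX f fY) (hY : Measurable Y) (hX : Measurable X) {b : Fin d → ℝ}
    {η : ℝ} (hη : 0 ≤ η)
    (hb : ∀ x ∈ (μ.map X).support, condLaw f x (Iic (x ⬝ᵥ b)) = ENNReal.ofReal η)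
    {g : (Fin d → ℝ) → ℝ} (hg : Measurable g) (hg0 : ∀ x, 0 ≤ g x) :
    ∫ ω, g (X ω) * belowInd b (Y ω, X ω) ∂μ = η * ∫ ω, g (X ω) ∂μ := by
  have hm : Measurable fun ω => belowInd b (Y ω, X ω) :=
    (measurable_belowInd b).comp (hY.prodMk hX)
  rw [integral_eq_lintegral_of_nonneg_ae
      (ae_of_all _ fun ω => mul_nonneg (hg0 _) (belowInd_nonneg _ _))
      ((hg.comp hX).mul hm).aestronglyMeasurable,
    integral_eq_lintegral_of_nonneg_ae (ae_of_all _ fun ω => hg0 _)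
      (hg.comp hX).aestronglyMeasurable,
    hd.lintegral_cond hY hX (φ := fun p => ENNReal.ofReal (g p.2 * belowInd b p))
      (G := fun x => ENNReal.ofReal η * ENNReal.ofReal (g x)) (by fun_prop) (by fun_prop),
    lintegral_const_mul _ (by fun_prop), ENNReal.toReal_mul, ENNReal.toReal_ofReal hη]
  intro x hx
  rw [← hb x hx, ← lintegral_indicator_one measurableSet_Iic, ← lintegral_mul_const _
    (measurable_one.indicator measurableSet_Iic)]
  refine lintegral_congr fun y => ?_
  unfold belowInd
  by_cases h : y ≤ x ⬝ᵥ b <;> simp [h]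

theorem HasDensities.integral_mul_belowInd [SFinite ν]
    (hd : HasDensities μ Y X ν fX f fY) (hY : Measurable Y) (hX : Measurable X) {b : Fin d → ℝ}
    {η : ℝ} (hη : 0 ≤ η)
    (hb : ∀ x ∈ (μ.map X).support, condLaw f x (Iic (x ⬝ᵥ b)) = ENNReal.ofReal η)
    {g : (Fin d → ℝ) → ℝ} (hg : Measurable g) (hgi : Integrable (fun ω => g (X ω)) μ) :
    ∫ ω, g (X ω) * belowInd b (Y ω, X ω) ∂μ = η * ∫ ω, g (X ω) ∂μ := by
  have h1 := hd.integral_mul_belowInd_of_nonneg hY hX hη hb (g := fun x => max (g x) 0)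
    (by fun_prop) (fun x => le_max_right _ _)
  have h2 := hd.integral_mul_belowInd_of_nonneg hY hX hη hb (g := fun x => max (-g x) 0)
    (by fun_prop) (fun x => le_max_right _ _)
  have hsplit : ∀ x, g x = max (g x) 0 - max (-g x) 0 := fun x => by
    rcases le_total 0 (g x) with h | h <;> simp [h]
  have hi1 : Integrable (fun ω => max (g (X ω)) 0) μ := hgi.pos_part
  have hi2 : Integrable (fun ω => max (-g (X ω)) 0) μ := hgi.neg_part
  calc _ = ∫ ω, (max (g (X ω)) 0 * belowInd b (Y ω, X ω)
        - max (-g (X ω)) 0 * belowInd b (Y ω, X ω)) ∂μ := by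
        refine integral_congr_ae (ae_of_all _ fun ω => ?_)
        simp only
        rw [← sub_mul, ← hsplit]
    _ = η * (∫ ω, max (g (X ω)) 0 ∂μ - ∫ ω, max (-g (X ω)) 0 ∂μ) := by
        rw [integral_sub (integrable_mul_belowInd (g := fun x => max (g x) 0) hY hX hi1 b)
          (integrable_mul_belowInd (g := fun x => max (-g x) 0) hY hX hi2 b), h1, h2]
        ring
    _ = _ := by
        rw [← integral_sub hi1 hi2]
        simp_rw [← hsplit]

/-- The squared difference is the indicator of an event of conditional probability `η' - η`. This
linear modulus is what makes chaining with second moments possible. -/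
theorem HasDensities.integral_mul_belowInd_sub_sq [SFinite ν]
    (hd : HasDensities μ Y X ν fX f fY) (hY : Measurable Y) (hX : Measurable X) {b b' : Fin d → ℝ}
    {η η' : ℝ} (hη : 0 ≤ η) (hη' : 0 ≤ η')
    (hb : ∀ x ∈ (μ.map X).support, condLaw f x (Iic (x ⬝ᵥ b)) = ENNReal.ofReal η)
    (hb' : ∀ x ∈ (μ.map X).support, condLaw f x (Iic (x ⬝ᵥ b')) = ENNReal.ofReal η')
    (hbb : ∀ x ∈ (μ.map X).support, x ⬝ᵥ b ≤ x ⬝ᵥ b')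
    {g : (Fin d → ℝ) → ℝ} (hg : Measurable g) (hgi : MemLp (fun ω => g (X ω)) 2 μ) :
    ∫ ω, (g (X ω) * (belowInd b' (Y ω, X ω) - belowInd b (Y ω, X ω))) ^ 2 ∂μ =
      (η' - η) * ∫ ω, g (X ω) ^ 2 ∂μ := by
  have hgi2 : Integrable (fun ω => (fun x => g x ^ 2) (X ω)) μ := hgi.integrable_sq
  have hg2 : Measurable fun x => g x ^ 2 := by fun_prop
  rw [sub_mul, ← hd.integral_mul_belowInd hY hX hη hb hg2 hgi2,
    ← hd.integral_mul_belowInd hY hX hη' hb' hg2 hgi2,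
    ← integral_sub (integrable_mul_belowInd (g := fun x => g x ^ 2) hY hX hgi2 b')
      (integrable_mul_belowInd (g := fun x => g x ^ 2) hY hX hgi2 b)]
  refine integral_congr_ae ?_
  filter_upwards [ae_mem_support hX] with ω hω
  rw [mul_pow, belowInd_sub_sq (hbb _ hω)]
  ring

/-- The score `(η - 1{y ≤ x'b}) a'x`. -/
def score (b : Fin d → ℝ) (η : ℝ) (a : Fin d → ℝ) (p : ℝ × (Fin d → ℝ)) : ℝ :=
  (η - belowInd b p) * (p.2 ⬝ᵥ a)

theorem measurable_score (b : Fin d → ℝ) (η : ℝ) (a : Fin d → ℝ) : Measurable (score b η a) := by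
  have := measurable_belowInd b
  have : Measurable fun p : ℝ × (Fin d → ℝ) => p.2 ⬝ᵥ a :=
    (measurable_dotProduct_const a).comp measurable_snd
  unfold score
  fun_prop

/-- Moving `J⁻¹` onto the test vector `v` turns a linear functional of the Bahadur term into a
scalar i.i.d. mean in the direction `v J⁻¹`. -/
theorem sampleMean_score {Ω : Type*} (Jη : Matrix (Fin d) (Fin d) ℝ) (b : Fin d → ℝ) (η : ℝ)
    (v : Fin d → ℝ) (y : ℕ → Ω → ℝ) (x : ℕ → Ω → Fin d → ℝ) (n : ℕ) (ω : Ω) :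
    v ⬝ᵥ ((n : ℝ)⁻¹ • ∑ i ∈ Finset.range n, influenceQR Jη b η (y i ω) (x i ω)) =
      sampleMean (fun i ω => (y i ω, x i ω)) (score b η (v ᵥ* Jη⁻¹)) n ω := by
  unfold sampleMean
  rw [dotProduct_smul, dotProduct_sum, smul_eq_mul]
  congr 1
  refine Finset.sum_congr rfl fun i _ => ?_
  unfold influenceQR score belowInd
  rw [Matrix.dotProduct_mulVec, dotProduct_smul, smul_eq_mul, dotProduct_comm (v ᵥ* Jη⁻¹)]

theorem abs_dotProduct_le (a x : Fin d → ℝ) : |x ⬝ᵥ a| ≤ ‖a‖ * ∑ j, |x j| := by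
  unfold dotProduct
  refine (Finset.abs_sum_le_sum_abs _ _).trans ?_
  rw [Finset.mul_sum]
  refine Finset.sum_le_sum fun j _ => ?_
  rw [abs_mul, mul_comm]
  gcongr
  exact norm_le_pi_norm a j

theorem abs_score_le {η : ℝ} (hη : η ∈ Icc (0 : ℝ) 1) (b a : Fin d → ℝ)
    (p : ℝ × (Fin d → ℝ)) : |score b η a p| ≤ ‖a‖ * ∑ j, |p.2 j| := by
  unfold score
  rw [abs_mul]
  have h1 : |η - belowInd b p| ≤ 1 := by
    have h2 := belowInd_nonneg b p
    have h3 := belowInd_le_one b p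
    rw [abs_le]
    constructor <;> linarith [hη.1, hη.2]
  calc _ ≤ 1 * |p.2 ⬝ᵥ a| := by gcongr
    _ ≤ _ := by rw [one_mul]; exact abs_dotProduct_le a p.2

/-- The indicator is 0 or 1 and `η` stays at distance at least `ε` from both, so a vanishing score
forces `x'a = 0`. -/
theorem le_score_sq {η ε : ℝ} (hε : 0 ≤ ε) (hη : η ∈ Icc ε (1 - ε)) (b a : Fin d → ℝ)
    (p : ℝ × (Fin d → ℝ)) : ε ^ 2 * (p.2 ⬝ᵥ a) ^ 2 ≤ score b η a p ^ 2 := by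
  unfold score
  rw [mul_pow]
  gcongr ?_ * _
  unfold belowInd
  split_ifs <;> nlinarith [hη.1, hη.2]

theorem memLp_score (hY : Measurable Y) (hX : Measurable X)
    (h2 : ∀ j, MemLp (fun ω => X ω j) 2 μ) {η : ℝ} (hη : η ∈ Icc (0 : ℝ) 1) (b a : Fin d → ℝ) :
    MemLp (fun ω => score b η a (Y ω, X ω)) 2 μ := by
  have hsum : MemLp (fun ω => ‖a‖ * ∑ j, |X ω j|) 2 μ :=
    (memLp_finsetSum Finset.univ fun j _ => (h2 j).abs).const_mul _
  refine hsum.mono ((measurable_score b η a).comp (hY.prodMk hX)).aestronglyMeasurable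
    (ae_of_all _ fun ω => ?_)
  rw [Real.norm_eq_abs, Real.norm_eq_abs]
  exact (abs_score_le hη b a _).trans (le_abs_self _)

theorem HasDensities.integral_score [IsProbabilityMeasure μ] [SFinite ν] (hd : HasDensities μ Y X ν fX f fY)
    (hY : Measurable Y) (hX : Measurable X)
    (h2 : ∀ j, MemLp (fun ω => X ω j) 2 μ) {η : ℝ} (hη : 0 ≤ η) {b : Fin d → ℝ}
    (hb : ∀ x ∈ (μ.map X).support, condLaw f x (Iic (x ⬝ᵥ b)) = ENNReal.ofReal η)
    (a : Fin d → ℝ) : ∫ ω, score b η a (Y ω, X ω) ∂μ = 0 := by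
  have hgi : Integrable (fun ω => X ω ⬝ᵥ a) μ := by
    unfold dotProduct
    exact integrable_finsetSum _ fun j _ => ((h2 j).integrable (by norm_num)).mul_const _
  have h := hd.integral_mul_belowInd hY hX hη hb (measurable_dotProduct_const a) hgi
  calc _ = ∫ ω, (η * (X ω ⬝ᵥ a) - (X ω ⬝ᵥ a) * belowInd b (Y ω, X ω)) ∂μ := by
        refine integral_congr_ae (ae_of_all _ fun ω => ?_)
        simp only [score]
        ring
    _ = 0 := by
        rw [integral_sub (hgi.const_mul _)
          (integrable_mul_belowInd (g := fun x => x ⬝ᵥ a) hY hX hgi b), h, integral_const_mul,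
          sub_self]

/-- Mean-square continuity of the score in its level and its direction. It allows the scores along a
sequence of support points to be replaced by the score at the limit. -/
theorem HasDensities.integral_score_sub_sq_le [SFinite ν] (hd : HasDensities μ Y X ν fX f fY)
    (hY : Measurable Y) (hX : Measurable X)
    (h2 : ∀ j, MemLp (fun ω => X ω j) 2 μ) {η η' : ℝ} (hη : η ∈ Icc (0 : ℝ) 1)
    (hη' : η' ∈ Icc (0 : ℝ) 1) {b b' : Fin d → ℝ}
    (hb : ∀ x ∈ (μ.map X).support, condLaw f x (Iic (x ⬝ᵥ b)) = ENNReal.ofReal η)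
    (hb' : ∀ x ∈ (μ.map X).support, condLaw f x (Iic (x ⬝ᵥ b')) = ENNReal.ofReal η')
    (hbb : (∀ x ∈ (μ.map X).support, x ⬝ᵥ b ≤ x ⬝ᵥ b') ∨
      ∀ x ∈ (μ.map X).support, x ⬝ᵥ b' ≤ x ⬝ᵥ b) (a a' : Fin d → ℝ) :
    ∫ ω, (score b η a (Y ω, X ω) - score b' η' a' (Y ω, X ω)) ^ 2 ∂μ ≤
      (4 * ‖a‖ ^ 2 * ((η - η') ^ 2 + |η - η'|) + 2 * ‖a - a'‖ ^ 2) *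
        ∫ ω, (∑ j, |X ω j|) ^ 2 ∂μ := by
  set N : (Fin d → ℝ) → ℝ := fun x => ∑ j, |x j| with hN
  have hNm : Measurable N := by fun_prop
  have hN2 : MemLp (fun ω => N (X ω)) 2 μ := memLp_finsetSum Finset.univ fun j _ => (h2 j).abs
  have hNi : Integrable (fun ω => N (X ω) ^ 2) μ := hN2.integrable_sq
  have hD : ∫ ω, (N (X ω) * (belowInd b (Y ω, X ω) - belowInd b' (Y ω, X ω))) ^ 2 ∂μ ≤
      |η - η'| * ∫ ω, N (X ω) ^ 2 ∂μ := by
    have h0 : 0 ≤ ∫ ω, N (X ω) ^ 2 ∂μ := integral_nonneg fun _ => sq_nonneg _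
    rcases hbb with hbb | hbb
    · have := hd.integral_mul_belowInd_sub_sq hY hX hη.1 hη'.1 hb hb' hbb hNm hN2
      rw [abs_sub_comm]
      calc _ = _ := integral_congr_ae (ae_of_all _ fun ω => by ring)
        _ = _ := this
        _ ≤ _ := by gcongr; exact le_abs_self _
    · rw [hd.integral_mul_belowInd_sub_sq hY hX hη'.1 hη.1 hb' hb hbb hNm hN2]
      gcongr
      exact le_abs_self _
  have hDi : Integrable
      (fun ω => (N (X ω) * (belowInd b (Y ω, X ω) - belowInd b' (Y ω, X ω))) ^ 2) μ := by
    have hm : ∀ b : Fin d → ℝ, Measurable fun ω => belowInd b (Y ω, X ω) :=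
      fun b => (measurable_belowInd b).comp (hY.prodMk hX)
    have := hm b
    have := hm b'
    refine hNi.mono (by fun_prop) (ae_of_all _ fun ω => ?_)
    rw [Real.norm_of_nonneg (sq_nonneg _), Real.norm_of_nonneg (sq_nonneg _), mul_pow]
    refine mul_le_of_le_one_right (sq_nonneg _) ?_
    have h1 := belowInd_nonneg b (Y ω, X ω)
    have h2 := belowInd_le_one b (Y ω, X ω)
    have h3 := belowInd_nonneg b' (Y ω, X ω)
    have h4 := belowInd_le_one b' (Y ω, X ω)
    rw [sq_le_one_iff_abs_le_one, abs_le]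
    constructor <;> linarith
  calc _ ≤ ∫ ω, (4 * ‖a‖ ^ 2 * ((η - η') ^ 2 * N (X ω) ^ 2 +
          (N (X ω) * (belowInd b (Y ω, X ω) - belowInd b' (Y ω, X ω))) ^ 2) +
          2 * ‖a - a'‖ ^ 2 * N (X ω) ^ 2) ∂μ := by
        refine integral_mono_of_nonneg (ae_of_all _ fun ω => sq_nonneg _)
          ((((hNi.const_mul _).add hDi).const_mul _).add (hNi.const_mul _))
          (ae_of_all _ fun ω => ?_)
        simp only [score]
        set u := belowInd b (Y ω, X ω)
        set u' := belowInd b' (Y ω, X ω)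
        have h1 : (X ω ⬝ᵥ a) ^ 2 ≤ (‖a‖ * N (X ω)) ^ 2 :=
          sq_le_sq' (abs_le.1 (abs_dotProduct_le a (X ω))).1
            (abs_le.1 (abs_dotProduct_le a (X ω))).2
        have h2 : (X ω ⬝ᵥ (a - a')) ^ 2 ≤ (‖a - a'‖ * N (X ω)) ^ 2 :=
          sq_le_sq' (abs_le.1 (abs_dotProduct_le (a - a') (X ω))).1
            (abs_le.1 (abs_dotProduct_le (a - a') (X ω))).2
        have h3 : (η' - u') ^ 2 ≤ 1 := by
          have h1 := belowInd_nonneg b' (Y ω, X ω)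
          have h2 := belowInd_le_one b' (Y ω, X ω)
          rw [sq_le_one_iff_abs_le_one, abs_le]
          constructor <;> linarith [hη'.1, hη'.2]
        -- Change the level and indicator first, with direction `a` kept, then the direction. Using
        -- `(s + t)² ≤ 2s² + 2t²` twice produces the constants 4 and 2.
        have hsplit : (η - u) * (X ω ⬝ᵥ a) - (η' - u') * (X ω ⬝ᵥ a') =
            ((η - η') - (u - u')) * (X ω ⬝ᵥ a) + (η' - u') * (X ω ⬝ᵥ (a - a')) := by
          rw [dotProduct_sub]; ring
        rw [hsplit]
        have h4 : (((η - η') - (u - u')) * (X ω ⬝ᵥ a) + (η' - u') * (X ω ⬝ᵥ (a - a'))) ^ 2 ≤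
            2 * ((η - η') - (u - u')) ^ 2 * (X ω ⬝ᵥ a) ^ 2 +
              2 * ((η' - u') ^ 2 * (X ω ⬝ᵥ (a - a')) ^ 2) := by
          nlinarith [sq_nonneg (((η - η') - (u - u')) * (X ω ⬝ᵥ a) -
            (η' - u') * (X ω ⬝ᵥ (a - a')))]
        have h5 : ((η - η') - (u - u')) ^ 2 ≤ 2 * (η - η') ^ 2 + 2 * (u - u') ^ 2 := by
          nlinarith [sq_nonneg ((η - η') + (u - u'))]
        have h6 : 2 * ((η - η') - (u - u')) ^ 2 * (X ω ⬝ᵥ a) ^ 2 ≤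
            2 * (2 * (η - η') ^ 2 + 2 * (u - u') ^ 2) * (‖a‖ * N (X ω)) ^ 2 := by gcongr
        have h7 : (η' - u') ^ 2 * (X ω ⬝ᵥ (a - a')) ^ 2 ≤ 1 * (‖a - a'‖ * N (X ω)) ^ 2 := by
          gcongr
        linarith
    _ = 4 * ‖a‖ ^ 2 * ((η - η') ^ 2 * ∫ ω, N (X ω) ^ 2 ∂μ +
          ∫ ω, (N (X ω) * (belowInd b (Y ω, X ω) - belowInd b' (Y ω, X ω))) ^ 2 ∂μ) +
          2 * ‖a - a'‖ ^ 2 * ∫ ω, N (X ω) ^ 2 ∂μ := by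
        have hsum : Integrable (fun ω => (η - η') ^ 2 * N (X ω) ^ 2 +
            (N (X ω) * (belowInd b (Y ω, X ω) - belowInd b' (Y ω, X ω))) ^ 2) μ :=
          (hNi.const_mul _).add hDi
        rw [integral_add (hsum.const_mul _) (hNi.const_mul _),
          integral_const_mul, integral_add (hNi.const_mul _) hDi, integral_const_mul,
          integral_const_mul]
    _ ≤ 4 * ‖a‖ ^ 2 * ((η - η') ^ 2 * ∫ ω, N (X ω) ^ 2 ∂μ +
          |η - η'| * ∫ ω, N (X ω) ^ 2 ∂μ) +
          2 * ‖a - a'‖ ^ 2 * ∫ ω, N (X ω) ^ 2 ∂μ := by gcongr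
    _ = _ := by ring

end Score

/-! ### Degeneracy from the central limit theorem. -/

section CentralLimit

variable {Ω E : Type*} [MeasurableSpace Ω] [MeasurableSpace E] {μ : Measure Ω}
  [IsProbabilityMeasure μ] {Z : ℕ → Ω → E}

/-- By the central limit theorem, a centred sample mean is not `o_p(n^{-1/2})` unless it
vanishes. -/
theorem integral_sq_eq_zero_of_isLittleOp (hi : iIndepFun Z μ)
    (hid : ∀ i, IdentDistrib (Z i) (Z 0) μ μ) {φ : E → ℝ} (hφ : Measurable φ)
    (h2 : MemLp (fun ω => φ (Z 0 ω)) 2 μ) (h0 : ∫ ω, φ (Z 0 ω) ∂μ = 0)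
    (hlittle : IsLittleOp μ (sampleMean Z φ) fun n => (n : ℝ) ^ (-(1 / 2) : ℝ)) :
    ∫ ω, φ (Z 0 ω) ^ 2 ∂μ = 0 := by
  have hiX : iIndepFun (fun i ω => φ (Z i ω)) μ := hi.comp (fun _ => φ) fun _ => hφ
  have hidX : ∀ i, IdentDistrib (fun ω => φ (Z i ω)) (fun ω => φ (Z 0 ω)) μ μ :=
    fun i => (hid i).comp hφ
  have hclt := tendstoInDistribution_inv_sqrt_mul_sum_sub (X := fun i ω => φ (Z i ω))
    (Y := id) (P' := gaussianReal 0 Var[fun ω => φ (Z 0 ω); μ].toNNReal)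
    HasLaw.id h2 hiX hidX
  have hmeas : TendstoInMeasure μ
      (fun (n : ℕ) ω => (√n)⁻¹ * (∑ k ∈ Finset.range n, φ (Z k ω) - n * ∫ ω, φ (Z 0 ω) ∂μ))
      atTop fun _ => (0 : ℝ) := by
    rw [tendstoInMeasure_iff_norm]
    intro δ hδ
    refine tendsto_of_tendsto_of_tendsto_of_le_of_le' tendsto_const_nhds
      (hlittle (δ / 2) (by positivity)) (Eventually.of_forall fun _ => zero_le) ?_
    filter_upwards [eventually_ge_atTop 1] with n hn
    refine measure_mono fun ω hω => ?_
    have hn0 : (0 : ℝ) < n := by exact_mod_cast hn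
    have hs : (0 : ℝ) < √n := Real.sqrt_pos.2 hn0
    have hω' : δ ≤ ‖(√n)⁻¹ * (∑ k ∈ Finset.range n, φ (Z k ω) - n * ∫ ω, φ (Z 0 ω) ∂μ) - 0‖ := hω
    change δ / 2 * (n : ℝ) ^ (-(1 / 2) : ℝ) < ‖sampleMean Z φ n ω‖
    have hrp : (n : ℝ) ^ (-(1 / 2) : ℝ) = (√n)⁻¹ := by
      rw [Real.rpow_neg hn0.le, Real.sqrt_eq_rpow]
    have hsm : (√n)⁻¹ * (∑ k ∈ Finset.range n, φ (Z k ω) - n * ∫ ω, φ (Z 0 ω) ∂μ) - 0 =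
        √n * sampleMean Z φ n ω := by
      unfold sampleMean
      rw [h0, mul_zero, sub_zero, sub_zero, ← mul_assoc]
      congr 1
      rw [inv_eq_iff_eq_inv, mul_inv, inv_inv]
      field_simp
      exact Real.sq_sqrt hn0.le
    rw [hsm, norm_mul, Real.norm_of_nonneg hs.le] at hω'
    rw [hrp, ← div_eq_mul_inv, div_lt_iff₀ hs]
    linarith
  have hdist := hmeas.tendstoInDistribution_of_aemeasurable
    (fun n => hclt.forall_aemeasurable n) aemeasurable_const
  -- The rescaled sums converge both to a centred Gaussian and to 0; uniqueness of the limit makes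
  -- the Gaussian a point mass, so its variance is 0.
  have huniq := tendstoInDistribution_unique _ hclt hdist
  have hv : Var[fun ω => φ (Z 0 ω); μ] = 0 := by
    have h1 := congrArg (fun m : Measure ℝ => Var[id; m]) huniq
    simp only [Measure.map_const, measure_univ, one_smul, Measure.map_id] at h1
    rw [variance_id_gaussianReal, variance_dirac] at h1
    have := variance_nonneg (fun ω => φ (Z 0 ω)) μ
    rwa [Real.coe_toNNReal _ this] at h1
  rwa [variance_of_integral_eq_zero h2.1.aemeasurable h0] at hv

end CentralLimit

/-! ### Consequences of the matching assumption. -/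

section Model

variable {Ω : Type*} [MeasurableSpace Ω] {μ : Measure Ω} {d : ℕ}
    {y : ℕ → Ω → ℝ} {x : ℕ → Ω → Fin d → ℝ} {ν : Measure (Fin d → ℝ)}
    {fX : (Fin d → ℝ) → ℝ} {f : ℝ → (Fin d → ℝ) → ℝ} {fY : ℝ → ℝ}
    {τ ε : ℝ} {β : ℝ → Fin d → ℝ} {ξ : (Fin d → ℝ) → ℝ}
    {m : ℕ → ℕ} {grid : (n : ℕ) → Fin (m n + 1) → ℝ}
    {βhat : ℕ → ℝ → Ω → Fin d → ℝ} {Qhat : ℕ → Ω → ℝ} {ξhat : ℕ → (Fin d → ℝ) → Ω → ℝ}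

theorem Icc_subset_Ioo_zero_one (hε : ε ∈ Ioo (0 : ℝ) (1 / 2)) {η : ℝ} (hη : η ∈ Icc ε (1 - ε)) :
    η ∈ Ioo (0 : ℝ) 1 :=
  ⟨hε.1.trans_le hη.1, by linarith [hη.2, hε.1]⟩

theorem condLaw_Iic_eq (hdens : HasDensities μ (y 0) (x 0) ν fX f fY)
    (hε : ε ∈ Ioo (0 : ℝ) (1 / 2))
    (hm : MatchingAssumption μ y x f fY τ ε β βhat Qhat m grid) {η : ℝ} (hη : η ∈ Icc ε (1 - ε))
    {x' : Fin d → ℝ} (hx : x' ∈ (μ.map (x 0)).support) :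
    condLaw f x' (Iic (x' ⬝ᵥ β η)) = ENNReal.ofReal η := by
  have := hdens.cond x' hx
  rw [← hm.linear x' hx η hη, measure_Iic_quantile (Icc_subset_Ioo_zero_one hε hη)]

theorem dotProduct_mono (hdens : HasDensities μ (y 0) (x 0) ν fX f fY)
    (hε : ε ∈ Ioo (0 : ℝ) (1 / 2))
    (hm : MatchingAssumption μ y x f fY τ ε β βhat Qhat m grid) {η η' : ℝ}
    (hη : η ∈ Icc ε (1 - ε)) (hη' : η' ∈ Icc ε (1 - ε)) (hle : η ≤ η')
    {x' : Fin d → ℝ} (hx : x' ∈ (μ.map (x 0)).support) : x' ⬝ᵥ β η ≤ x' ⬝ᵥ β η' := by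
  have := hdens.cond x' hx
  rw [← hm.linear x' hx η hη, ← hm.linear x' hx η' hη']
  exact quantile_mono (Icc_subset_Ioo_zero_one hε hη).1 hle (Icc_subset_Ioo_zero_one hε hη').2

/-- Second moments come from the diagonal of `J(ε)`: the density in that integrand is at least `c`,
so `X_j²` is at most `c⁻¹` times it. -/
theorem memLp_covariate (hs : IsRandomSample μ y x)
    (hdens : HasDensities μ (y 0) (x 0) ν fX f fY) (hε : ε ∈ Ioo (0 : ℝ) (1 / 2))
    (hm : MatchingAssumption μ y x f fY τ ε β βhat Qhat m grid) (j : Fin d) :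
    MemLp (fun ω => x 0 ω j) 2 μ := by
  have hεI : ε ∈ Icc ε (1 - ε) := ⟨le_rfl, by linarith [hε.1, hε.2]⟩
  have hεI' : 1 - ε ∈ Icc ε (1 - ε) := ⟨by linarith [hε.1, hε.2], le_rfl⟩
  obtain ⟨c, hc, hcf⟩ := hm.density_pos
  have hxj : Measurable fun ω => x 0 ω j := (measurable_pi_apply j).comp (hs.measurable_x 0)
  rw [memLp_two_iff_integrable_sq hxj.aestronglyMeasurable]
  refine ((hm.J_integrable ε hεI j j).const_mul c⁻¹).mono (by fun_prop) ?_
  filter_upwards [ae_mem_support (hs.measurable_x 0)] with ω hω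
  have h1 := hcf _ hω (x 0 ω ⬝ᵥ β ε) ⟨le_rfl, dotProduct_mono hdens hε hm hεI hεI'
    (by linarith [hε.2]) hω⟩
  rw [Real.norm_of_nonneg (sq_nonneg _)]
  refine le_trans ?_ (le_abs_self _)
  rw [← div_eq_inv_mul, le_div_iff₀ hc]
  nlinarith [sq_nonneg (x 0 ω j)]

theorem dotProduct_matching (hm : MatchingAssumption μ y x f fY τ ε β βhat Qhat m grid)
    (hξ : ∀ x' ∈ (μ.map (x 0)).support,
      ξ x' ∈ matchingSet f (quantile (μ.map (y 0)) τ) x' ∩ Icc ε (1 - ε))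
    {x' : Fin d → ℝ} (hx : x' ∈ (μ.map (x 0)).support) :
    x' ⬝ᵥ β (ξ x') = quantile (μ.map (y 0)) τ := by
  rw [← hm.linear x' hx _ (hξ x' hx).2]
  exact (hξ x' hx).1.2

/-- `Q = x'β(ξ(x))` lies between `x'β(ε)` and `x'β(1 - ε)`, because conditional quantiles increase
in the level, and there the lower bound on the density applies. -/
theorem exists_le_density (hdens : HasDensities μ (y 0) (x 0) ν fX f fY)
    (hε : ε ∈ Ioo (0 : ℝ) (1 / 2))
    (hm : MatchingAssumption μ y x f fY τ ε β βhat Qhat m grid)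
    (hξ : ∀ x' ∈ (μ.map (x 0)).support,
      ξ x' ∈ matchingSet f (quantile (μ.map (y 0)) τ) x' ∩ Icc ε (1 - ε)) :
    ∃ c : ℝ, 0 < c ∧ ∀ x' ∈ (μ.map (x 0)).support, c ≤ f (quantile (μ.map (y 0)) τ) x' := by
  obtain ⟨c, hc, hcf⟩ := hm.density_pos
  have hεI : ε ∈ Icc ε (1 - ε) := ⟨le_rfl, by linarith [hε.1, hε.2]⟩
  have hεI' : 1 - ε ∈ Icc ε (1 - ε) := ⟨by linarith [hε.1, hε.2], le_rfl⟩
  refine ⟨c, hc, fun x' hx => hcf x' hx _ ?_⟩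
  rw [← dotProduct_matching hm hξ hx]
  exact ⟨dotProduct_mono hdens hε hm hεI (hξ x' hx).2 (hξ x' hx).2.1 hx,
    dotProduct_mono hdens hε hm (hξ x' hx).2 hεI' (hξ x' hx).2.2 hx⟩

/-- The matching level is the conditional distribution function at `Q`. This identifies `ξ` on the
support with a measurable function, although no measurability of `ξ` is assumed. -/
theorem condLaw_real_Iic_quantile (hdens : HasDensities μ (y 0) (x 0) ν fX f fY)
    (hξ : ∀ x' ∈ (μ.map (x 0)).support,
      ξ x' ∈ matchingSet f (quantile (μ.map (y 0)) τ) x' ∩ Icc ε (1 - ε))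
    {x' : Fin d → ℝ} (hx : x' ∈ (μ.map (x 0)).support) :
    (condLaw f x' (Iic (quantile (μ.map (y 0)) τ))).toReal = ξ x' := by
  have := hdens.cond x' hx
  have h := (hξ x' hx).1
  rw [← h.2, measure_Iic_quantile h.1, ENNReal.toReal_ofReal h.1.1.le]

theorem measurable_condLaw_Iic (hdens : HasDensities μ (y 0) (x 0) ν fX f fY) (q : ℝ) :
    Measurable fun x' => (condLaw f x' (Iic q)).toReal := by
  have h : ∀ x', condLaw f x' (Iic q) = ∫⁻ y' in Iic q, ENNReal.ofReal (f y' x') := fun x' => by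
    rw [condLaw, withDensity_apply _ measurableSet_Iic]
  simp_rw [h]
  have hf := hdens.measurable_f
  have : Measurable fun p : (Fin d → ℝ) × ℝ => ENNReal.ofReal (f p.2 p.1) :=
    (hf.comp measurable_swap).ennreal_ofReal
  exact this.lintegral_prod_right'.ennreal_toReal

theorem grid_mem_Icc (hm : MatchingAssumption μ y x f fY τ ε β βhat Qhat m grid) (n : ℕ)
    (j : Fin (m n + 1)) : grid n j ∈ Icc ε (1 - ε) := by
  constructor
  · rw [← hm.grid_first n]
    exact (hm.grid_strictMono n).monotone (Fin.zero_le j)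
  · rw [← hm.grid_last n]
    exact (hm.grid_strictMono n).monotone (Fin.le_last j)

theorem matchEstimate_mem_Icc (hm : MatchingAssumption μ y x f fY τ ε β βhat Qhat m grid)
    {n : ℕ} {b : ℝ → Fin d → ℝ} {q : ℝ} {x' : Fin d → ℝ} {e : ℝ}
    (he : IsMatch ε (grid n) b q x' e) : e ∈ Icc ε (1 - ε) := by
  rcases he with ⟨-, he⟩ | ⟨j, -, -, rfl⟩ | ⟨-, rfl⟩
  · rw [he]
    exact (hm.grid_first n) ▸ grid_mem_Icc hm n 0
  · exact grid_mem_Icc hm n _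
  · exact grid_mem_Icc hm n _

/-- The influence function is bounded and, since `Y` has no atoms, centred. The bound by `|(fY
Q)⁻¹|` also covers the convention `0⁻¹ = 0`. -/
theorem isBigOp_sampleQuantile [IsProbabilityMeasure μ] (hs : IsRandomSample μ y x)
    (hdens : HasDensities μ (y 0) (x 0) ν fX f fY) (hτ : τ ∈ Ioo (0 : ℝ) 1)
    (hm : MatchingAssumption μ y x f fY τ ε β βhat Qhat m grid) :
    IsBigOp μ (fun n ω => Qhat n ω - quantile (μ.map (y 0)) τ)
      fun n => (n : ℝ) ^ (-(1 / 2) : ℝ) := by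
  set Q := quantile (μ.map (y 0)) τ with hQ
  set φ : ℝ × (Fin d → ℝ) → ℝ := fun p => influenceUQ (fY Q) Q τ p.1 with hφdef
  have hind : Measurable fun y' : ℝ => if y' ≤ Q then (1 : ℝ) else 0 :=
    Measurable.ite measurableSet_Iic measurable_const measurable_const
  have hφ : Measurable φ := by
    have : Measurable fun p : ℝ × (Fin d → ℝ) => if p.1 ≤ Q then (1 : ℝ) else 0 :=
      hind.comp measurable_fst
    simp only [hφdef, influenceUQ]
    fun_prop
  have hmeas : Measurable fun ω => φ (y 0 ω, x 0 ω) :=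
    hφ.comp ((hs.measurable_y 0).prodMk (hs.measurable_x 0))
  have h2 : MemLp (fun ω => φ (y 0 ω, x 0 ω)) 2 μ := by
    refine MemLp.of_bound hmeas.aestronglyMeasurable (|(fY Q)⁻¹| * 1) (ae_of_all _ fun ω => ?_)
    simp only [hφdef, influenceUQ]
    rw [Real.norm_eq_abs, abs_mul]
    gcongr
    rw [abs_le]
    split_ifs <;> constructor <;> linarith [hτ.1, hτ.2]
  have h0 : ∫ ω, φ (y 0 ω, x 0 ω) ∂μ = 0 := by
    simp only [hφdef, influenceUQ]
    have hset : MeasurableSet {ω | y 0 ω ≤ Q} := hs.measurable_y 0 measurableSet_Iic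
    have hind1 : (fun ω => if y 0 ω ≤ Q then (1 : ℝ) else 0) = {ω | y 0 ω ≤ Q}.indicator 1 := by
      ext ω
      simp [indicator_apply]
    have hii : Integrable (fun ω => if y 0 ω ≤ Q then (1 : ℝ) else 0) μ := by
      rw [hind1]
      exact (integrable_const (1 : ℝ)).indicator hset
    rw [integral_const_mul, integral_sub (integrable_const _) hii, hind1,
      integral_indicator_one hset, measureReal_def, hQ,
      hdens.measure_le_quantile (hs.measurable_y 0) hτ, ENNReal.toReal_ofReal hτ.1.le]
    simp
  have hmean := isBigOp_sampleMean_sub hs.indep hs.identDistrib hφ h2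
  refine hmean.of_le_add hm.unconditional.isBigOp ?_
  refine Eventually.of_forall fun n => ae_of_all _ fun ω => ?_
  rw [h0, sub_zero]
  have : Qhat n ω - Q = sampleMean (fun i ω => (y i ω, x i ω)) φ n ω +
      (Qhat n ω - Q - (n : ℝ)⁻¹ * ∑ i ∈ Finset.range n, influenceUQ (fY Q) Q τ (y i ω)) := by
    simp only [sampleMean, hφdef]
    ring
  exact (congrArg abs this).le.trans (abs_add_le _ _)

/-- Adjugate over a nonvanishing determinant. Continuity provides a uniform bound on the compact
interval of levels and convergence along sequences of levels. -/
theorem continuousOn_J_inv (hm : MatchingAssumption μ y x f fY τ ε β βhat Qhat m grid) :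
    ContinuousOn (fun η => (J μ (x 0) f β η)⁻¹) (Icc ε (1 - ε)) := by
  have hJ : ContinuousOn (fun η => J μ (x 0) f β η) (Icc ε (1 - ε)) :=
    continuousOn_pi.2 fun i => continuousOn_pi.2 fun j => (hm.J_differentiable i j).continuousOn
  have hdet : ContinuousOn (fun η => (J μ (x 0) f β η).det) (Icc ε (1 - ε)) :=
    (continuous_id.matrix_det).comp_continuousOn hJ
  have hadj : ContinuousOn (fun η => (J μ (x 0) f β η).adjugate) (Icc ε (1 - ε)) :=
    (continuous_id.matrix_adjugate).comp_continuousOn hJ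
  have h := (hdet.inv₀ fun η hη => (hm.J_invertible η hη).ne_zero).smul hadj
  refine h.congr fun η _ => ?_
  rw [Matrix.inv_def, Ring.inverse_eq_inv']
  rfl

/-- Each entry of `a J` is the expectation of a product containing the factor `X'a`. -/
theorem J_vecMul_eq_zero (hm : MatchingAssumption μ y x f fY τ ε β βhat Qhat m grid) {η : ℝ}
    (hη : η ∈ Icc ε (1 - ε)) {a : Fin d → ℝ} (ha : ∀ᵐ ω ∂μ, x 0 ω ⬝ᵥ a = 0) :
    a ᵥ* J μ (x 0) f β η = 0 := by
  ext j
  change ∑ i, a i * (∫ ω, f (x 0 ω ⬝ᵥ β η) (x 0 ω) * (x 0 ω i * x 0 ω j) ∂μ) = 0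
  simp_rw [← integral_const_mul]
  rw [← integral_finsetSum _ fun i _ => (hm.J_integrable η hη i j).const_mul _]
  rw [← integral_zero Ω ℝ (μ := μ)]
  refine integral_congr_ae ?_
  filter_upwards [ha] with ω hω
  calc _ = f (x 0 ω ⬝ᵥ β η) (x 0 ω) * x 0 ω j * (x 0 ω ⬝ᵥ a) := by
        rw [dotProduct.eq_def (x 0 ω) a, Finset.mul_sum]
        exact Finset.sum_congr rfl fun i _ => by ring
    _ = 0 := by rw [hω, mul_zero]

theorem abs_dotProduct_le_card (a v : Fin d → ℝ) : |v ⬝ᵥ a| ≤ d * ‖v‖ * ‖a‖ := by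
  refine (abs_dotProduct_le a v).trans ?_
  have : ∑ j, |v j| ≤ d * ‖v‖ := by
    calc _ ≤ ∑ _j : Fin d, ‖v‖ := Finset.sum_le_sum fun j _ => norm_le_pi_norm v j
      _ = _ := by simp
  calc _ ≤ ‖a‖ * (d * ‖v‖) := by gcongr
    _ = _ := by ring

/-- A direction in which the score has a negligible sample mean does not exist. -/
theorem not_isLittleOp_score [IsProbabilityMeasure μ] [SFinite ν] (hs : IsRandomSample μ y x)
    (hdens : HasDensities μ (y 0) (x 0) ν fX f fY) (hε : ε ∈ Ioo (0 : ℝ) (1 / 2))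
    (hm : MatchingAssumption μ y x f fY τ ε β βhat Qhat m grid) {η : ℝ} (hη : η ∈ Icc ε (1 - ε))
    {v : Fin d → ℝ} (hv : v ≠ 0) :
    ¬ IsLittleOp μ (sampleMean (fun i ω => (y i ω, x i ω))
      (score (β η) η (v ᵥ* (J μ (x 0) f β η)⁻¹))) fun n => (n : ℝ) ^ (-(1 / 2) : ℝ) := by
  intro hlit
  set a := v ᵥ* (J μ (x 0) f β η)⁻¹ with ha
  have hηI := Icc_subset_Ioo_zero_one hε hη
  have hX2 := memLp_covariate hs hdens hε hm
  have hsc2 := memLp_score (hs.measurable_y 0) (hs.measurable_x 0) hX2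
    (Ioo_subset_Icc_self hηI) (β η) a
  have hz := integral_sq_eq_zero_of_isLittleOp hs.indep hs.identDistrib
    (measurable_score (β η) η a) hsc2
    (hdens.integral_score (hs.measurable_y 0) (hs.measurable_x 0) hX2 hηI.1.le
      (fun x' hx => condLaw_Iic_eq hdens hε hm hη hx) a) hlit
  rw [integral_eq_zero_iff_of_nonneg (fun _ => sq_nonneg _) hsc2.integrable_sq] at hz
  have hxa : ∀ᵐ ω ∂μ, x 0 ω ⬝ᵥ a = 0 := by
    filter_upwards [hz] with ω hω
    have h1 := le_score_sq hε.1.le hη (β η) a (y 0 ω, x 0 ω)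
    simp only [Pi.zero_apply] at hω
    rw [hω] at h1
    have h2 : 0 < ε ^ 2 := pow_pos hε.1 2
    have h3 : (x 0 ω ⬝ᵥ a) ^ 2 ≤ 0 := by
      by_contra hcon
      have := mul_pos h2 (not_le.1 hcon)
      exact absurd h1 (not_le.2 this)
    exact pow_eq_zero_iff (two_ne_zero) |>.1 (le_antisymm h3 (sq_nonneg _))
  -- Here `a J = 0` while `a = v J⁻¹`; invertibility leaves `v = 0`.
  have h := J_vecMul_eq_zero hm hη hxa
  rw [ha, Matrix.vecMul_vecMul, Matrix.nonsing_inv_mul _ (hm.J_invertible η hη),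
    Matrix.vecMul_one] at h
  exact hv h

end Model

/-! ### Boundedness of the covariate support. -/

section BoundedSupport

variable {Ω : Type*} [MeasurableSpace Ω] {μ : Measure Ω} {d : ℕ} [NeZero d]
    {y : ℕ → Ω → ℝ} {x : ℕ → Ω → Fin d → ℝ} {ν : Measure (Fin d → ℝ)}
    {fX : (Fin d → ℝ) → ℝ} {f : ℝ → (Fin d → ℝ) → ℝ} {fY : ℝ → ℝ}
    {τ ε : ℝ} {β : ℝ → Fin d → ℝ} {ξ : (Fin d → ℝ) → ℝ}
    {m : ℕ → ℕ} {grid : (n : ℕ) → Fin (m n + 1) → ℝ}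
    {βhat : ℕ → ℝ → Ω → Fin d → ℝ} {Qhat : ℕ → Ω → ℝ} {ξhat : ℕ → (Fin d → ℝ) → Ω → ℝ}

theorem rpow_neg_half_pos {n : ℕ} (hn : 1 ≤ n) : 0 < (n : ℝ) ^ (-(1 / 2) : ℝ) :=
  Real.rpow_pos_of_pos (by exact_mod_cast hn) _

theorem rpow_neg_half_le_one {n : ℕ} (hn : 1 ≤ n) : (n : ℝ) ^ (-(1 / 2) : ℝ) ≤ 1 :=
  Real.rpow_le_one_of_one_le_of_nonpos (by exact_mod_cast hn) (by norm_num)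

theorem tendsto_rpow_neg_half : Tendsto (fun n : ℕ => (n : ℝ) ^ (-(1 / 2) : ℝ)) atTop (𝓝 0) :=
  (tendsto_rpow_neg_atTop (by norm_num : (0 : ℝ) < 1 / 2)).comp tendsto_natCast_atTop_atTop

/-- When the uniform expansion of the estimated matching function holds at `x'`, the prediction
error of the quantile regression at `x'` is bounded. -/
theorem abs_dotProduct_sub_le {c r e e' F q u : ℝ} (hc : 0 < c) (hF : c ≤ F)
    (he : |e - e'| ≤ 1) (hr : r ≤ 1) (h : |e - e' - F * (-u + q)| ≤ r) (hq : |q| ≤ 1) :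
    |u| ≤ 2 / c + 1 := by
  -- One unit comes from the matching error, both levels lying in `I`, and one from the remainder.
  have h1 : F * |-u + q| ≤ 2 := by
    have h0 := abs_sub_abs_le_abs_sub (F * (-u + q)) (e - e')
    rw [abs_sub_comm (F * (-u + q)), abs_mul, abs_of_pos (hc.trans_le hF)] at h0
    linarith
  have h2 : |-u + q| ≤ 2 / c := by
    rw [le_div_iff₀ hc, mul_comm]
    exact (mul_le_mul_of_nonneg_right hF (abs_nonneg _)).trans h1
  have h3 : u = q - (-u + q) := by ring
  rw [h3]
  calc _ ≤ |q| + |-u + q| := abs_sub _ _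
    _ ≤ _ := by linarith

/-- On one event, the same for all `k`, the prediction error at `X k` is bounded by a constant.
Dividing by `‖X k‖` makes it arbitrarily small at fixed `n`, so only the Bahadur remainder is left,
and it is `o_p(n^{-1/2})`. Mean-square continuity then replaces the direction and level at `X k` by
their limits. -/
theorem isLittleOp_score_of_tendsto [IsProbabilityMeasure μ] [SFinite ν]
    (hs : IsRandomSample μ y x)
    (hdens : HasDensities μ (y 0) (x 0) ν fX f fY) (hτ : τ ∈ Ioo (0 : ℝ) 1)
    (hε : ε ∈ Ioo (0 : ℝ) (1 / 2))
    (hξ : ∀ x' ∈ (μ.map (x 0)).support,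
      ξ x' ∈ matchingSet f (quantile (μ.map (y 0)) τ) x' ∩ Icc ε (1 - ε))
    (hξhat : ∀ n x' ω, IsMatch ε (grid n) (fun η => βhat n η ω) (Qhat n ω) x' (ξhat n x' ω))
    (hm : MatchingAssumption μ y x f fY τ ε β βhat Qhat m grid)
    (happ : ApproxAssumption μ (μ.map (x 0)).support f ε (quantile (μ.map (y 0)) τ) β ξ βhat Qhat
      ξhat)
    {X : ℕ → Fin d → ℝ} (hX : ∀ k, X k ∈ (μ.map (x 0)).support)
    (hXtop : Tendsto (fun k => ‖X k‖) atTop atTop) {v : Fin d → ℝ} {η : ℝ}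
    (hv : Tendsto (fun k => ‖X k‖⁻¹ • X k) atTop (𝓝 v)) (hη : η ∈ Icc ε (1 - ε))
    (hξη : Tendsto (fun k => ξ (X k)) atTop (𝓝 η)) :
    IsLittleOp μ (sampleMean (fun i ω => (y i ω, x i ω))
      (score (β η) η (v ᵥ* (J μ (x 0) f β η)⁻¹))) fun n => (n : ℝ) ^ (-(1 / 2) : ℝ) := by
  set Q := quantile (μ.map (y 0)) τ with hQ
  set Z : ℕ → Ω → ℝ × (Fin d → ℝ) := fun i ω => (y i ω, x i ω) with hZ
  set a := v ᵥ* (J μ (x 0) f β η)⁻¹ with ha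
  set V : ℕ → Fin d → ℝ := fun k => ‖X k‖⁻¹ • X k with hV
  set A : ℕ → Fin d → ℝ := fun k => V k ᵥ* (J μ (x 0) f β (ξ (X k)))⁻¹ with hA
  have hξI : ∀ k, ξ (X k) ∈ Icc ε (1 - ε) := fun k => (hξ _ (hX k)).2
  have hAa : Tendsto A atTop (𝓝 a) := by
    have hJ : Tendsto (fun k => (J μ (x 0) f β (ξ (X k)))⁻¹) atTop
        (𝓝 (J μ (x 0) f β η)⁻¹) :=
      (continuousOn_J_inv hm η hη).tendsto.comp
        (tendsto_nhdsWithin_iff.2 ⟨hξη, Eventually.of_forall hξI⟩)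
    have hcont : Continuous fun p : (Fin d → ℝ) × Matrix (Fin d) (Fin d) ℝ => p.1 ᵥ* p.2 :=
      continuous_fst.matrix_vecMul continuous_snd
    exact (hcont.tendsto (v, (J μ (x 0) f β η)⁻¹)).comp (hv.prodMk_nhds hJ)
  have hX2 := memLp_covariate hs hdens hε hm
  have hY := hs.measurable_y 0
  have hX0 := hs.measurable_x 0
  set N2 := ∫ ω, (∑ j, |x 0 ω j|) ^ 2 ∂μ with hN2
  set B : ℕ → ℝ := fun k => (4 * ‖a‖ ^ 2 * ((η - ξ (X k)) ^ 2 + |η - ξ (X k)|) +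
    2 * ‖a - A k‖ ^ 2) * N2 with hB
  have hB0 : Tendsto B atTop (𝓝 0) := by
    have h1 : Tendsto (fun k => η - ξ (X k)) atTop (𝓝 0) := by
      simpa using hξη.const_sub η
    have h2 : Tendsto (fun k => ‖a - A k‖) atTop (𝓝 0) := by
      simpa using (hAa.const_sub a).norm
    simpa using ((((h1.pow 2).add h1.abs).const_mul (4 * ‖a‖ ^ 2)).add
      ((h2.pow 2).const_mul 2)).mul_const N2
  have hlaw : ∀ η ∈ Icc ε (1 - ε), ∀ x' ∈ (μ.map (x 0)).support,
      condLaw f x' (Iic (x' ⬝ᵥ β η)) = ENNReal.ofReal η :=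
    fun η hη x' hx => condLaw_Iic_eq hdens hε hm hη hx
  have hI : ∀ η ∈ Icc ε (1 - ε), η ∈ Icc (0 : ℝ) 1 :=
    fun η hη => Ioo_subset_Icc_self (Icc_subset_Ioo_zero_one hε hη)
  -- Both scores are centred, so Chebyshev leaves only the mean-square distance `B k`, which tends
  -- to 0 in `k`.
  have hdiff : ∀ k n, n ≠ 0 → ∀ t : ℝ, 0 < t →
      μ {ω | t < |sampleMean Z (score (β η) η a) n ω -
        sampleMean Z (score (β (ξ (X k))) (ξ (X k)) (A k)) n ω|} ≤
        ENNReal.ofReal (B k / n / t ^ 2) := by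
    intro k n hn t ht
    have hm1 := memLp_score hY hX0 hX2 (hI η hη) (β η) a
    have hm2 := memLp_score hY hX0 hX2 (hI _ (hξI k)) (β (ξ (X k))) (A k)
    have h0 : ∫ ω, (score (β η) η a (Z 0 ω) -
        score (β (ξ (X k))) (ξ (X k)) (A k) (Z 0 ω)) ∂μ = 0 := by
      rw [integral_sub (hm1.integrable (by norm_num)) (hm2.integrable (by norm_num)),
        hdens.integral_score hY hX0 hX2 (hI η hη).1 (hlaw η hη),
        hdens.integral_score hY hX0 hX2 (hI _ (hξI k)).1 (hlaw _ (hξI k)), sub_zero]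
    have h1 := measure_sampleMean_sub_le hs.indep hs.identDistrib
      (φ := fun p => score (β η) η a p - score (β (ξ (X k))) (ξ (X k)) (A k) p)
      ((measurable_score _ _ _).sub (measurable_score _ _ _)) (hm1.sub hm2) hn ht
    rw [h0] at h1
    refine le_trans (le_of_eq ?_) (h1.trans (ENNReal.ofReal_le_ofReal ?_))
    · congr 1
      ext ω
      simp only [sampleMean, sub_zero, Finset.sum_sub_distrib, mul_sub, hZ]
    · gcongr
      refine hdens.integral_score_sub_sq_le hY hX0 hX2 (hI η hη) (hI _ (hξI k)) (hlaw η hη)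
        (hlaw _ (hξI k)) ?_ a (A k)
      rcases le_total η (ξ (X k)) with h | h
      · exact Or.inl fun x' hx => dotProduct_mono hdens hε hm hη (hξI k) h hx
      · exact Or.inr fun x' hx => dotProduct_mono hdens hε hm (hξI k) hη h hx
  obtain ⟨c, hc, hcf⟩ := exists_le_density hdens hε hm hξ
  intro δ hδ
  rw [ENNReal.tendsto_nhds_zero]
  intro κ hκ
  have hκ4 : 0 < κ / 2 / 2 := ENNReal.half_pos (ENNReal.half_pos hκ.ne').ne'
  have hd : (0 : ℝ) < d := by exact_mod_cast Nat.pos_of_ne_zero (NeZero.ne d)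
  have hQ1 : IsLittleOp μ (fun n ω => Qhat n ω - Q) fun _ => 1 :=
    (isBigOp_sampleQuantile hs hdens hτ hm).isLittleOp fun δ hδ => by
      filter_upwards [tendsto_rpow_neg_half.eventually (gt_mem_nhds hδ)] with n hn
      linarith
  -- The factor `1 / d` pays for bounding a dot product by sup norms; the third of `δ` is one of
  -- three error sources.
  have hE1 := (ENNReal.tendsto_nhds_zero.1 (hm.bahadur (δ / 3 / d) (by positivity))) _ hκ4
  have hE2 := (ENNReal.tendsto_nhds_zero.1 (happ.remainder 1 one_pos)) _ hκ4
  have hE3 := (ENNReal.tendsto_nhds_zero.1 (hQ1 1 one_pos)) _ hκ4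
  filter_upwards [hE1, hE2, hE3, eventually_ge_atTop 1] with n h1 h2 h3 hn
  have hn0 : (0 : ℝ) < n := by exact_mod_cast hn
  have hr := rpow_neg_half_pos hn
  have hr1 := rpow_neg_half_le_one hn
  set r := (n : ℝ) ^ (-(1 / 2) : ℝ) with hrdef
  have hlim4 : Tendsto (fun k => ENNReal.ofReal (B k / n / (δ / 3 * r) ^ 2)) atTop (𝓝 0) := by
    simpa using ENNReal.tendsto_ofReal ((hB0.div_const (n : ℝ)).div_const ((δ / 3 * r) ^ 2))
  -- The index `k` is chosen after `n`, large enough to beat `n^{-1/2}`. The first three events hold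
  -- uniformly over the support or do not involve it, so they do not depend on this choice.
  obtain ⟨k, hk4, hkX⟩ := ((ENNReal.tendsto_nhds_zero.1 hlim4 _ hκ4).and
    (hXtop.eventually_ge_atTop (max 1 ((2 / c + 1) / (δ / 3 * r))))).exists
  have hXk1 : 1 ≤ ‖X k‖ := (le_max_left _ _).trans hkX
  have hXk0 : 0 < ‖X k‖ := one_pos.trans_le hXk1
  have hXk2 : (2 / c + 1) / ‖X k‖ ≤ δ / 3 * r := by
    rw [div_le_iff₀ hXk0, ← div_le_iff₀' (by positivity)]
    exact (le_max_right _ _).trans hkX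
  have h4 := (hdiff k n (by omega) (δ / 3 * r) (by positivity)).trans hk4
  have hκsum : κ = (κ / 2 / 2 + κ / 2 / 2) + (κ / 2 / 2 + κ / 2 / 2) := by
    rw [ENNReal.add_halves, ENNReal.add_halves]
  rw [hκsum]
  refine le_trans (measure_mono fun ω hω => ?_) ((measure_union_le _ _).trans (add_le_add
    ((measure_union_le _ _).trans (add_le_add h1 h2))
    ((measure_union_le _ _).trans (add_le_add h3 h4))))
  by_contra hcon
  simp only [mem_union, mem_ofPred_eq, not_or, not_exists, not_and, not_lt] at hcon
  obtain ⟨⟨c1, c2⟩, c3, c4⟩ := hcon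
  have hω' : δ * r < |sampleMean Z (score (β η) η a) n ω| := hω
  have c1' := c1 (ξ (X k)) (hξI k)
  have c2' := c2 (X k) (hX k)
  rw [one_mul, Real.norm_eq_abs, dotProduct_matching hm hξ (hX k)] at c2'
  have hu := abs_dotProduct_sub_le hc (hcf _ (hX k)) (by
    have h1 := matchEstimate_mem_Icc hm (hξhat n (X k) ω)
    have h2 := hξI k
    rw [abs_le]
    constructor <;> linarith [h1.1, h1.2, h2.1, h2.2, hε.1]) hr1 c2' (by simpa using c3)
  have hdec := sampleMean_score (J μ (x 0) f β (ξ (X k))) (β (ξ (X k))) (ξ (X k)) (V k) y x n ω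
  set G := (n : ℝ)⁻¹ • ∑ i ∈ Finset.range n,
    influenceQR (J μ (x 0) f β (ξ (X k))) (β (ξ (X k))) (ξ (X k)) (y i ω) (x i ω) with hG
  have hVnorm : ‖V k‖ = 1 := by
    simp only [hV, norm_smul, norm_inv, norm_norm]
    exact inv_mul_cancel₀ hXk0.ne'
  have hsplit : V k ⬝ᵥ G = ‖X k‖⁻¹ * (X k ⬝ᵥ (βhat n (ξ (X k)) ω - β (ξ (X k)))) -
      V k ⬝ᵥ (βhat n (ξ (X k)) ω - β (ξ (X k)) - G) := by
    rw [dotProduct_sub (V k) _ G]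
    simp only [hV, smul_dotProduct, smul_eq_mul]
    ring
  have hb1 : |‖X k‖⁻¹ * (X k ⬝ᵥ (βhat n (ξ (X k)) ω - β (ξ (X k))))| ≤ δ / 3 * r := by
    rw [abs_mul, abs_of_pos (inv_pos.2 hXk0), ← div_eq_inv_mul]
    exact (div_le_div_of_nonneg_right hu hXk0.le).trans hXk2
  have hb2 : |V k ⬝ᵥ (βhat n (ξ (X k)) ω - β (ξ (X k)) - G)| ≤ δ / 3 * r := by
    refine (abs_dotProduct_le_card _ _).trans ?_
    rw [hVnorm, mul_one]
    calc _ ≤ d * (δ / 3 / d * r) := by gcongr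
      _ = _ := by field_simp
  have hb3 : |V k ⬝ᵥ G| ≤ δ / 3 * r + δ / 3 * r := by
    rw [hsplit]
    exact (abs_sub _ _).trans (add_le_add hb1 hb2)
  rw [hdec] at hb3
  have := abs_sub_abs_le_abs_sub (sampleMean Z (score (β η) η a) n ω)
    (sampleMean Z (score (β (ξ (X k))) (ξ (X k)) (A k)) n ω)
  have hb4 : |sampleMean Z (score (β (ξ (X k))) (ξ (X k)) (A k)) n ω| ≤
      δ / 3 * r + δ / 3 * r := hb3
  linarith

/-- The uniform expansion of the estimated matching function forces the support of the covariates
to be bounded. -/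
theorem isBounded_support [IsProbabilityMeasure μ] [SFinite ν]
    (hs : IsRandomSample μ y x)
    (hdens : HasDensities μ (y 0) (x 0) ν fX f fY) (hτ : τ ∈ Ioo (0 : ℝ) 1)
    (hε : ε ∈ Ioo (0 : ℝ) (1 / 2))
    (hξ : ∀ x' ∈ (μ.map (x 0)).support,
      ξ x' ∈ matchingSet f (quantile (μ.map (y 0)) τ) x' ∩ Icc ε (1 - ε))
    (hξhat : ∀ n x' ω, IsMatch ε (grid n) (fun η => βhat n η ω) (Qhat n ω) x' (ξhat n x' ω))
    (hm : MatchingAssumption μ y x f fY τ ε β βhat Qhat m grid)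
    (happ : ApproxAssumption μ (μ.map (x 0)).support f ε (quantile (μ.map (y 0)) τ) β ξ βhat Qhat
      ξhat) : Bornology.IsBounded (μ.map (x 0)).support := by
  by_contra hunb
  have hex : ∀ k : ℕ, ∃ x' ∈ (μ.map (x 0)).support, (k : ℝ) < ‖x'‖ := by
    intro k
    by_contra hcon
    push Not at hcon
    exact hunb (isBounded_iff_forall_norm_le.2 ⟨k, hcon⟩)
  choose X hXS hXk using hex
  have hXtop : Tendsto (fun k => ‖X k‖) atTop atTop :=
    tendsto_atTop_mono (fun k => (hXk k).le) tendsto_natCast_atTop_atTop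
  have hnorm : ∀ k, ‖‖X k‖⁻¹ • X k‖ = 1 := fun k => by
    rw [norm_smul, norm_inv, norm_norm]
    exact inv_mul_cancel₀ ((Nat.cast_nonneg k).trans_lt (hXk k)).ne'
  have hcomp : IsCompact (Metric.closedBall (0 : Fin d → ℝ) 1 ×ˢ Icc ε (1 - ε)) :=
    (isCompact_closedBall _ _).prod isCompact_Icc
  -- Normalised directions and matching levels lie in a compact set, so both converge along a common
  -- subsequence.
  obtain ⟨⟨v, η⟩, hvη, s, hsmono, hslim⟩ := hcomp.tendsto_subseq
    (x := fun k => (‖X k‖⁻¹ • X k, ξ (X k))) fun k =>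
      ⟨by rw [mem_closedBall_zero_iff]; exact (hnorm k).le, (hξ _ (hXS k)).2⟩
  have hv : Tendsto (fun k => ‖X (s k)‖⁻¹ • X (s k)) atTop (𝓝 v) :=
    (continuous_fst.tendsto _).comp hslim
  have hη : Tendsto (fun k => ξ (X (s k))) atTop (𝓝 η) := (continuous_snd.tendsto _).comp hslim
  have hv1 : ‖v‖ = 1 := by
    refine tendsto_nhds_unique hv.norm ?_
    simp_rw [hnorm]
    exact tendsto_const_nhds
  have hv0 : v ≠ 0 := by
    rintro rfl
    simp at hv1
  exact not_isLittleOp_score hs hdens hε hm hvη.2 hv0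
    (isLittleOp_score_of_tendsto hs hdens hτ hε hξ hξhat hm happ (X := fun k => X (s k))
      (fun k => hXS _) (hXtop.comp hsmono.tendsto_atTop) hv hvη.2 hη)

end BoundedSupport

/-! ### Rates implied by the bandwidth assumption. -/

section Bandwidth

/-- The rate `(n h)^{-1/2}`. -/
def kernelRate (h : ℕ → ℝ) (n : ℕ) : ℝ := (n : ℝ) ^ (-(1 / 2) : ℝ) * h n ^ (-(1 / 2) : ℝ)

variable {h : ℕ → ℝ} {a : ℝ} {r : ℕ}

theorem BandwidthAssumption.pos_exponent (hb : BandwidthAssumption h a r) : 0 < a :=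
  lt_of_lt_of_le (by positivity) hb.lower

theorem BandwidthAssumption.eventually_pos (hb : BandwidthAssumption h a r) :
    ∀ᶠ n in atTop, 0 < h n := by
  obtain ⟨c, C, hc, hrate⟩ := hb.rate
  filter_upwards [hrate, eventually_ge_atTop 1] with n hn h1
  have : (0 : ℝ) < n := by exact_mod_cast h1
  exact lt_of_lt_of_le (by positivity) hn.1

theorem tendsto_natCast_rpow_neg {b : ℝ} (hb : 0 < b) :
    Tendsto (fun n : ℕ => (n : ℝ) ^ (-b)) atTop (𝓝 0) :=
  (tendsto_rpow_neg_atTop hb).comp tendsto_natCast_atTop_atTop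

theorem BandwidthAssumption.tendsto_zero (hb : BandwidthAssumption h a r) :
    Tendsto h atTop (𝓝 0) := by
  obtain ⟨c, C, hc, hrate⟩ := hb.rate
  have hlim := (tendsto_natCast_rpow_neg hb.pos_exponent).const_mul C
  rw [mul_zero] at hlim
  refine tendsto_of_tendsto_of_tendsto_of_le_of_le' tendsto_const_nhds hlim ?_ ?_
  · filter_upwards [hb.eventually_pos] with n hn using hn.le
  · filter_upwards [hrate] with n hn using hn.2

theorem BandwidthAssumption.tendsto_rpow_div (hb : BandwidthAssumption h a r) :
    Tendsto (fun n : ℕ => (n : ℝ) ^ (-(1 / 2) : ℝ) / h n) atTop (𝓝 0) := by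
  obtain ⟨c, C, hc, hrate⟩ := hb.rate
  have hlim := (tendsto_natCast_rpow_neg (b := 1 / 2 - a) (by linarith [hb.upper])).const_mul c⁻¹
  rw [mul_zero] at hlim
  refine tendsto_of_tendsto_of_tendsto_of_le_of_le' tendsto_const_nhds hlim ?_ ?_
  · filter_upwards [hb.eventually_pos] with n hn
    positivity
  · filter_upwards [hrate, eventually_ge_atTop 1] with n hn h1
    have hn0 : (0 : ℝ) < n := by exact_mod_cast h1
    have hp : 0 < c * (n : ℝ) ^ (-a) := by positivity
    calc _ ≤ (n : ℝ) ^ (-(1 / 2) : ℝ) / (c * (n : ℝ) ^ (-a)) := by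
          gcongr
          exact hn.1
      _ = c⁻¹ * ((n : ℝ) ^ (-(1 / 2) : ℝ) / (n : ℝ) ^ (-a)) := by field_simp
      _ = _ := by
          rw [← Real.rpow_sub hn0]
          congr 2
          ring

/-- The cube is the cost of chaining: one logarithm for the number of levels, two for the squared
reciprocal of the threshold at each level. -/
theorem BandwidthAssumption.tendsto_log_mul (hb : BandwidthAssumption h a r) :
    Tendsto (fun n => ((Nat.log 2 n : ℝ) + 2) ^ 3 * h n) atTop (𝓝 0) := by
  obtain ⟨c, C, hc, hrate⟩ := hb.rate
  have ha := hb.pos_exponent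
  -- The power `n^{-a}` is split into three factors `n^{-a/3}`, one for each logarithm.
  have hlog : Tendsto (fun n : ℕ => (Real.log n / Real.log 2 + 2) * (n : ℝ) ^ (-(a / 3)))
      atTop (𝓝 0) := by
    have h1 : Tendsto (fun n : ℕ => Real.log n / (n : ℝ) ^ (a / 3)) atTop (𝓝 0) :=
      ((isLittleO_log_rpow_atTop (by positivity : 0 < a / 3)).tendsto_div_nhds_zero).comp
        tendsto_natCast_atTop_atTop
    have h2 := tendsto_natCast_rpow_neg (b := a / 3) (by positivity)
    have h3 := (h1.const_mul (Real.log 2)⁻¹).add (h2.const_mul 2)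
    rw [mul_zero, mul_zero, add_zero] at h3
    refine h3.congr fun n => ?_
    rw [Real.rpow_neg (Nat.cast_nonneg n)]
    ring
  have hlim := (hlog.pow 3).const_mul |C|
  rw [zero_pow (by norm_num), mul_zero] at hlim
  refine tendsto_of_tendsto_of_tendsto_of_le_of_le' tendsto_const_nhds hlim ?_ ?_
  · filter_upwards [hb.eventually_pos] with n hn
    positivity
  · filter_upwards [hrate, eventually_ge_atTop 1] with n hn h1
    have hn0 : (0 : ℝ) < n := by exact_mod_cast h1
    have hL : (Nat.log 2 n : ℝ) ≤ Real.log n / Real.log 2 := by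
      have := Real.natLog_le_logb n 2
      simpa [Real.logb] using this
    have hpow : ((n : ℝ) ^ (-(a / 3))) ^ 3 = (n : ℝ) ^ (-a) := by
      rw [← Real.rpow_natCast, ← Real.rpow_mul hn0.le]
      congr 1
      push_cast
      ring
    calc _ ≤ (Real.log n / Real.log 2 + 2) ^ 3 * (|C| * (n : ℝ) ^ (-a)) := by
          have hCn : h n ≤ |C| * (n : ℝ) ^ (-a) :=
            hn.2.trans (mul_le_mul_of_nonneg_right (le_abs_self C) (by positivity))
          have h0 : 0 ≤ |C| * (n : ℝ) ^ (-a) := by positivity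
          calc _ ≤ ((Nat.log 2 n : ℝ) + 2) ^ 3 * (|C| * (n : ℝ) ^ (-a)) := by gcongr
            _ ≤ _ := by gcongr
      _ = _ := by rw [mul_pow, hpow]; ring

theorem kernelRate_pos {n : ℕ} (hn : 1 ≤ n) (hh : 0 < h n) : 0 < kernelRate h n :=
  mul_pos (rpow_neg_half_pos hn) (Real.rpow_pos_of_pos hh _)

theorem BandwidthAssumption.eventually_kernelRate_pos (hb : BandwidthAssumption h a r) :
    ∀ᶠ n in atTop, 0 < kernelRate h n := by
  filter_upwards [hb.eventually_pos, eventually_ge_atTop 1] with n h1 h2 using kernelRate_pos h2 h1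

theorem kernelRate_sq {n : ℕ} (hh : 0 < h n) : kernelRate h n ^ 2 = (n * h n)⁻¹ := by
  unfold kernelRate
  rw [mul_pow, ← Real.rpow_natCast, ← Real.rpow_natCast, ← Real.rpow_mul (Nat.cast_nonneg n),
    ← Real.rpow_mul hh.le]
  norm_num [Real.rpow_neg_one, mul_comm]

/-- The ratio of the two rates is `h^{1/2}`, which tends to 0. Every term of exact order `n^{-1/2}`
is thus negligible at the target rate. -/
theorem BandwidthAssumption.rpow_neg_half_le (hb : BandwidthAssumption h a r) {δ : ℝ}
    (hδ : 0 < δ) : ∀ᶠ n : ℕ in atTop, (n : ℝ) ^ (-(1 / 2) : ℝ) ≤ δ * kernelRate h n := by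
  have hlim : Tendsto (fun n => h n ^ (1 / 2 : ℝ)) atTop (𝓝 0) := by
    have := hb.tendsto_zero.rpow_const (p := 1 / 2) (Or.inr (by norm_num))
    rwa [Real.zero_rpow (by norm_num)] at this
  filter_upwards [hb.eventually_pos, hlim.eventually (gt_mem_nhds hδ)] with n h1 h2
  unfold kernelRate
  have h3 : 1 ≤ δ * h n ^ (-(1 / 2) : ℝ) := by
    rw [Real.rpow_neg h1.le, ← div_eq_mul_inv, one_le_div (Real.rpow_pos_of_pos h1 _)]
    exact h2.le
  calc (n : ℝ) ^ (-(1 / 2) : ℝ) = (n : ℝ) ^ (-(1 / 2) : ℝ) * 1 := (mul_one _).symm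
    _ ≤ (n : ℝ) ^ (-(1 / 2) : ℝ) * (δ * h n ^ (-(1 / 2) : ℝ)) := by gcongr
    _ = _ := by ring

theorem BandwidthAssumption.tendsto_kernelRate (hb : BandwidthAssumption h a r) :
    Tendsto (kernelRate h) atTop (𝓝 0) := by
  have h1 := hb.tendsto_rpow_div
  have h2 : Tendsto (fun n => h n ^ (1 / 2 : ℝ)) atTop (𝓝 0) := by
    have := hb.tendsto_zero.rpow_const (p := 1 / 2) (Or.inr (by norm_num))
    rwa [Real.zero_rpow (by norm_num)] at this
  have h3 := h1.mul h2
  rw [mul_zero] at h3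
  refine h3.congr' ?_
  filter_upwards [hb.eventually_pos] with n hn
  unfold kernelRate
  rw [div_mul_eq_mul_div, mul_div_assoc]
  congr 1
  nth_rewrite 2 [← Real.rpow_one (h n)]
  rw [← Real.rpow_sub hn]
  norm_num

end Bandwidth

/-! ### Uniform rate for the indicator process. -/

section UniformRate

variable {Ω : Type*} [MeasurableSpace Ω] {μ : Measure Ω} {d : ℕ}
    {y : ℕ → Ω → ℝ} {x : ℕ → Ω → Fin d → ℝ} {ν : Measure (Fin d → ℝ)}
    {fX : (Fin d → ℝ) → ℝ} {f : ℝ → (Fin d → ℝ) → ℝ} {fY : ℝ → ℝ}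
    {τ ε : ℝ} {β : ℝ → Fin d → ℝ} {ξ : (Fin d → ℝ) → ℝ}
    {m : ℕ → ℕ} {grid : (n : ℕ) → Fin (m n + 1) → ℝ}
    {βhat : ℕ → ℝ → Ω → Fin d → ℝ} {Qhat : ℕ → Ω → ℝ} {ξhat : ℕ → (Fin d → ℝ) → Ω → ℝ}
    {h : ℕ → ℝ} {a : ℝ} {r : ℕ}

theorem ae_forall_mem_support (hs : IsRandomSample μ y x) :
    ∀ᵐ ω ∂μ, ∀ i, x i ω ∈ (μ.map (x 0)).support := by
  rw [ae_all_iff]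
  intro i
  have hid : μ.map (x i) = μ.map (x 0) := ((hs.identDistrib i).comp measurable_snd).map_eq
  rw [← hid]
  exact ae_mem_support (hs.measurable_x i)

/-- The process `n⁻¹ ∑ g(x_i) 1{y_i ≤ x_i'β(η)}`, `η ∈ I`. -/
def belowMean (y : ℕ → Ω → ℝ) (x : ℕ → Ω → Fin d → ℝ) (β : ℝ → Fin d → ℝ)
    (g : (Fin d → ℝ) → ℝ) (n : ℕ) (η : ℝ) (ω : Ω) : ℝ :=
  sampleMean (fun i ω => (y i ω, x i ω)) (fun p => g p.2 * belowInd (β η) p) n ω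

/-- Monotonicity reduces the deviation of `belowMean` to its deviation at two nearby points. -/
theorem abs_sub_le_of_bracket {G Gl Gu η ηl ηu M e s : ℝ} (hM : 0 ≤ M) (hl : Gl ≤ G) (hu : G ≤ Gu)
    (hηl : η - ηl ≤ s) (hηu : ηu - η ≤ s) (hl' : |Gl - ηl * M| ≤ e) (hu' : |Gu - ηu * M| ≤ e) :
    |G - η * M| ≤ e + s * M := by
  rw [abs_le] at *
  constructor <;> nlinarith [hl'.1, hu'.2]

/-- Chebyshev's inequality with the linear modulus; this is the increment bound that feeds the
chaining inequality. -/
theorem measure_belowMean_increment_le [IsProbabilityMeasure μ] [SFinite ν]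
    (hs : IsRandomSample μ y x)
    (hdens : HasDensities μ (y 0) (x 0) ν fX f fY) (hε : ε ∈ Ioo (0 : ℝ) (1 / 2))
    (hm : MatchingAssumption μ y x f fY τ ε β βhat Qhat m grid) {g : (Fin d → ℝ) → ℝ}
    (hg : Measurable g) (hg2 : MemLp (fun ω => g (x 0 ω)) 2 μ) {η η' : ℝ}
    (hη : η ∈ Icc ε (1 - ε)) (hη' : η' ∈ Icc ε (1 - ε)) (hle : η ≤ η') {n : ℕ} (hn : n ≠ 0) {t : ℝ}
    (ht : 0 < t) :
    μ {ω | t < |(belowMean y x β g n η' ω - η' * ∫ ω, g (x 0 ω) ∂μ) -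
      (belowMean y x β g n η ω - η * ∫ ω, g (x 0 ω) ∂μ)|} ≤
      ENNReal.ofReal ((η' - η) * (∫ ω, g (x 0 ω) ^ 2 ∂μ) / n / t ^ 2) := by
  have hY := hs.measurable_y 0
  have hX := hs.measurable_x 0
  have hI : ∀ η ∈ Icc ε (1 - ε), (0 : ℝ) ≤ η := fun η hη => (Icc_subset_Ioo_zero_one hε hη).1.le
  have hlaw : ∀ η ∈ Icc ε (1 - ε), ∀ x' ∈ (μ.map (x 0)).support,
      condLaw f x' (Iic (x' ⬝ᵥ β η)) = ENNReal.ofReal η :=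
    fun η hη x' hx => condLaw_Iic_eq hdens hε hm hη hx
  have hgi : Integrable (fun ω => g (x 0 ω)) μ := hg2.integrable (by norm_num)
  set φ : ℝ × (Fin d → ℝ) → ℝ := fun p => g p.2 * (belowInd (β η') p - belowInd (β η) p) with hφ
  have hφm : Measurable φ := by fun_prop
  have hφ2 : MemLp (fun ω => φ (y 0 ω, x 0 ω)) 2 μ := by
    refine hg2.mono (hφm.comp (hY.prodMk hX)).aestronglyMeasurable (ae_of_all _ fun ω => ?_)
    simp only [hφ, norm_mul]
    refine mul_le_of_le_one_right (norm_nonneg _) ?_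
    have h1 := belowInd_nonneg (β η) (y 0 ω, x 0 ω)
    have h2 := belowInd_le_one (β η) (y 0 ω, x 0 ω)
    have h3 := belowInd_nonneg (β η') (y 0 ω, x 0 ω)
    have h4 := belowInd_le_one (β η') (y 0 ω, x 0 ω)
    rw [Real.norm_eq_abs, abs_le]
    constructor <;> linarith
  have h := measure_sampleMean_sub_le hs.indep hs.identDistrib hφm hφ2 hn ht
  have hmean : ∫ ω, φ (y 0 ω, x 0 ω) ∂μ = η' * (∫ ω, g (x 0 ω) ∂μ) - η * ∫ ω, g (x 0 ω) ∂μ := by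
    rw [← hdens.integral_mul_belowInd hY hX (hI η hη) (hlaw η hη) hg hgi,
      ← hdens.integral_mul_belowInd hY hX (hI η' hη') (hlaw η' hη') hg hgi,
      ← integral_sub (integrable_mul_belowInd hY hX hgi _) (integrable_mul_belowInd hY hX hgi _)]
    exact integral_congr_ae (ae_of_all _ fun ω => by simp only [hφ]; ring)
  have hsq : ∫ ω, φ (y 0 ω, x 0 ω) ^ 2 ∂μ = (η' - η) * ∫ ω, g (x 0 ω) ^ 2 ∂μ :=
    hdens.integral_mul_belowInd_sub_sq hY hX (hI η hη) (hI η' hη') (hlaw η hη) (hlaw η' hη')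
      (fun x' hx => dotProduct_mono hdens hε hm hη hη' hle hx) hg hg2
  rw [hmean, hsq] at h
  refine le_trans (le_of_eq ?_) h
  congr 1
  ext ω
  have : sampleMean (fun i ω => (y i ω, x i ω)) φ n ω =
      belowMean y x β g n η' ω - belowMean y x β g n η ω := by
    simp only [sampleMean, belowMean, hφ, mul_sub, Finset.sum_sub_distrib]
  rw [mem_ofPred_eq, mem_ofPred_eq, this]
  congr! 2
  ring

/-- Chaining controls the process on a grid of at least `n` cells; between grid points `g ≥ 0` makes
the mean monotone in `η`, so neighbouring points bracket it. The error budget is `δ/4` at the left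
end, `δ/4` for the chain and `δ/4` for the mesh. -/
theorem isUniformLittleOp_belowMean [IsProbabilityMeasure μ] [SFinite ν]
    (hs : IsRandomSample μ y x)
    (hdens : HasDensities μ (y 0) (x 0) ν fX f fY) (hε : ε ∈ Ioo (0 : ℝ) (1 / 2))
    (hm : MatchingAssumption μ y x f fY τ ε β βhat Qhat m grid)
    (hb : BandwidthAssumption h a r) {g : (Fin d → ℝ) → ℝ}
    (hg : Measurable g) (hg0 : ∀ x', 0 ≤ g x') (hg2 : MemLp (fun ω => g (x 0 ω)) 2 μ) :
    IsUniformLittleOp μ (Icc ε (1 - ε))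
      (fun n η ω => belowMean y x β g n η ω - η * ∫ ω, g (x 0 ω) ∂μ) (kernelRate h) := by
  set M := ∫ ω, g (x 0 ω) ∂μ with hM
  set V := ∫ ω, g (x 0 ω) ^ 2 ∂μ with hV
  have hM0 : 0 ≤ M := integral_nonneg fun _ => hg0 _
  have hV0 : 0 ≤ V := integral_nonneg fun _ => sq_nonneg _
  have hY := hs.measurable_y 0
  have hX := hs.measurable_x 0
  have hw : 0 < 1 - 2 * ε := by linarith [hε.2]
  have hεI : ε ∈ Icc ε (1 - ε) := ⟨le_rfl, by linarith⟩
  have hfirst : IsLittleOp μ (fun n ω => belowMean y x β g n ε ω - ε * M) (kernelRate h) := by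
    have hφm : Measurable fun p : ℝ × (Fin d → ℝ) => g p.2 * belowInd (β ε) p := by fun_prop
    have hφ2 : MemLp (fun ω => g (x 0 ω) * belowInd (β ε) (y 0 ω, x 0 ω)) 2 μ := by
      refine hg2.mono (hφm.comp (hY.prodMk hX)).aestronglyMeasurable (ae_of_all _ fun ω => ?_)
      rw [norm_mul]
      refine mul_le_of_le_one_right (norm_nonneg _) ?_
      rw [Real.norm_of_nonneg (belowInd_nonneg _ _)]
      exact belowInd_le_one _ _
    have h1 := isBigOp_sampleMean_sub hs.indep hs.identDistrib hφm hφ2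
    rw [hdens.integral_mul_belowInd hY hX hε.1.le
      (fun x' hx => condLaw_Iic_eq hdens hε hm hεI hx) hg (hg2.integrable (by norm_num))] at h1
    exact h1.isLittleOp fun δ hδ => hb.rpow_neg_half_le hδ
  intro δ hδ
  -- Chosen so that `2 ^ L ≥ n`: the mesh is `O(1/n)`, below the target rate.
  set L : ℕ → ℕ := fun n => Nat.log 2 n + 1 with hL
  have hlog : Tendsto (fun n => ENNReal.ofReal
      (16 * (1 - 2 * ε) * V / δ ^ 2 * (((Nat.log 2 n : ℝ) + 2) ^ 3 * h n))) atTop (𝓝 0) := by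
    simpa using ENNReal.tendsto_ofReal
      (hb.tendsto_log_mul.const_mul (16 * (1 - 2 * ε) * V / δ ^ 2))
  have hlim := hlog.add (hfirst (δ / 4) (by positivity))
  rw [add_zero] at hlim
  refine tendsto_of_tendsto_of_tendsto_of_le_of_le' tendsto_const_nhds hlim
    (Eventually.of_forall fun _ => zero_le) ?_
  filter_upwards [hb.eventually_pos, eventually_ge_atTop 1,
    hb.rpow_neg_half_le (δ := δ / (4 * ((1 - 2 * ε) * M + 1))) (by positivity)] with n hh hn hrt
  have hn0 : (0 : ℝ) < n := by exact_mod_cast hn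
  have hρ := kernelRate_pos hn hh
  set ρ := kernelRate h n with hρdef
  set P : ℝ := 2 ^ L n with hP
  have hP0 : 0 < P := by positivity
  have hnP : (n : ℝ) ≤ P := by
    have : n < 2 ^ (Nat.log 2 n + 1) := Nat.lt_pow_succ_log_self (by norm_num) n
    rw [hP]
    exact_mod_cast this.le
  set pt : ℕ → ℝ := fun j => ε + (1 - 2 * ε) * (j / P) with hpt
  have hptI : ∀ j : ℕ, (j : ℝ) ≤ P → pt j ∈ Icc ε (1 - ε) := by
    intro j hj
    have h1 : (j : ℝ) / P ≤ 1 := (div_le_one hP0).2 hj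
    have h2 : 0 ≤ (j : ℝ) / P := by positivity
    constructor
    · simp only [hpt]; nlinarith
    · simp only [hpt]; nlinarith
  have hpt0 : pt 0 = ε := by simp [hpt]
  have hLP : ∀ j : ℕ, j ≤ 2 ^ L n → (j : ℝ) ≤ P := fun j hj => by
    rw [hP]; exact_mod_cast hj
  set t := δ * ρ / (4 * (L n + 1)) with ht
  have ht0 : 0 < t := by positivity
  have hchain := measure_exists_lt_abs_sub_le (μ := μ) ht0 (L n)
    ((1 - 2 * ε) / P * V / n / t ^ 2)
    (fun j ω => belowMean y x β g n (pt j) ω - pt j * M) (by positivity) (by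
      intro i j hij hj
      have hij' : (i : ℝ) ≤ j := by exact_mod_cast hij
      have hle : pt i ≤ pt j := by simp only [hpt]; gcongr
      refine (measure_belowMean_increment_le hs hdens hε hm hg hg2
        (hptI i (hLP i (hij.trans hj))) (hptI j (hLP j hj)) hle (by omega) ht0).trans
        (ENNReal.ofReal_le_ofReal (le_of_eq ?_))
      simp only [hpt, ← hV]
      field_simp
      ring)
  -- Since the squared rate is `1 / (n h)`, the factor `n` cancels against the variance of the mean
  -- and `2 ^ L` against the mesh, leaving `(log n)^3 h` up to constants.
  have hbound : (L n + 1) * ((1 - 2 * ε) / P * V / n / t ^ 2) * 2 ^ L n =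
      16 * (1 - 2 * ε) * V / δ ^ 2 * (((Nat.log 2 n : ℝ) + 2) ^ 3 * h n) := by
    have h1 : (L n : ℝ) + 1 = (Nat.log 2 n : ℝ) + 2 := by simp only [hL]; push_cast; ring
    have h2 : t ^ 2 = δ ^ 2 / (16 * (L n + 1) ^ 2 * (n * h n)) := by
      rw [ht, div_pow, mul_pow, hρdef, kernelRate_sq hh]
      field_simp
      norm_num
    rw [h2, ← h1, ← hP]
    field_simp
  rw [hbound] at hchain
  refine le_trans (measure_mono_ae ?_) ((measure_union_le _ _).trans (add_le_add hchain le_rfl))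
  filter_upwards [ae_forall_mem_support hs] with ω hω
  rintro ⟨η, hη, hlt⟩
  change ω ∈ (_ ∪ _ : Set Ω)
  by_contra hcon
  simp only [mem_union, mem_ofPred_eq, not_or, not_exists, not_and, not_lt] at hcon
  obtain ⟨c1, c2⟩ := hcon
  rw [Real.norm_eq_abs] at c2 hlt
  have hLt : ((L n : ℝ) + 1) * t = δ / 4 * ρ := by rw [ht]; field_simp
  have hpoint : ∀ j ≤ 2 ^ L n, |belowMean y x β g n (pt j) ω - pt j * M| ≤ δ / 2 * ρ := by
    intro j hj
    have h1 := c1 j hj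
    rw [hLt, hpt0] at h1
    have h2 := abs_sub_abs_le_abs_sub (belowMean y x β g n (pt j) ω - pt j * M)
      (belowMean y x β g n ε ω - ε * M)
    linarith
  have hmono : ∀ η₁ ∈ Icc ε (1 - ε), ∀ η₂ ∈ Icc ε (1 - ε), η₁ ≤ η₂ →
      belowMean y x β g n η₁ ω ≤ belowMean y x β g n η₂ ω := by
    intro η₁ h1 η₂ h2 hle
    unfold belowMean sampleMean
    gcongr with i _
    exact mul_le_mul_of_nonneg_left
      (belowInd_mono (dotProduct_mono hdens hε hm h1 h2 hle (hω i))) (hg0 _)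
  -- Position of `η` in units of the mesh; its floor and ceiling index the bracketing grid points.
  set u := (η - ε) / (1 - 2 * ε) * P with hu
  have hu0 : 0 ≤ u := by
    have := hη.1
    have : 0 ≤ η - ε := by linarith
    positivity
  have huP : u ≤ P := by
    have : (η - ε) / (1 - 2 * ε) ≤ 1 := by
      rw [div_le_one hw]
      linarith [hη.2]
    exact mul_le_of_le_one_left hP0.le this
  have hηu : η = ε + (1 - 2 * ε) * (u / P) := by
    rw [hu, mul_div_cancel_right₀ _ hP0.ne', mul_div_cancel₀ _ hw.ne']
    ring
  have hfl : ⌊u⌋₊ ≤ 2 ^ L n := Nat.floor_le_of_le (by rw [hP] at huP; exact_mod_cast huP)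
  have hce : ⌈u⌉₊ ≤ 2 ^ L n := Nat.ceil_le.2 (by rw [hP] at huP; exact_mod_cast huP)
  have h1 : pt ⌊u⌋₊ ≤ η := by
    rw [hηu]
    simp only [hpt]
    gcongr
    exact Nat.floor_le hu0
  have h2 : η ≤ pt ⌈u⌉₊ := by
    rw [hηu]
    simp only [hpt]
    gcongr
    exact Nat.le_ceil u
  have h3 : η - pt ⌊u⌋₊ ≤ (1 - 2 * ε) / P := by
    have := Nat.lt_floor_add_one u
    calc η - pt ⌊u⌋₊ = (1 - 2 * ε) / P * (u - ⌊u⌋₊) := by rw [hηu]; simp only [hpt]; ring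
      _ ≤ (1 - 2 * ε) / P * 1 := by gcongr; linarith
      _ = _ := mul_one _
  have h4 : pt ⌈u⌉₊ - η ≤ (1 - 2 * ε) / P := by
    have := Nat.ceil_lt_add_one hu0
    calc pt ⌈u⌉₊ - η = (1 - 2 * ε) / P * (⌈u⌉₊ - u) := by rw [hηu]; simp only [hpt]; ring
      _ ≤ (1 - 2 * ε) / P * 1 := by gcongr; linarith
      _ = _ := mul_one _
  have hfinal := abs_sub_le_of_bracket hM0 (hmono _ (hptI _ (hLP _ hfl)) _ hη h1)
    (hmono _ hη _ (hptI _ (hLP _ hce)) h2) h3 h4 (hpoint _ hfl) (hpoint _ hce)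
  have h5 : (1 - 2 * ε) / P * M ≤ δ / 4 * ρ := by
    have hPn : 1 / P ≤ (n : ℝ) ^ (-(1 / 2) : ℝ) := by
      calc 1 / P ≤ 1 / n := by gcongr
        _ = (n : ℝ) ^ (-1 : ℝ) := by rw [Real.rpow_neg_one, one_div]
        _ ≤ _ := Real.rpow_le_rpow_of_exponent_le (by exact_mod_cast hn) (by norm_num)
    calc (1 - 2 * ε) / P * M = ((1 - 2 * ε) * M) * (1 / P) := by ring
      _ ≤ ((1 - 2 * ε) * M + 1) * (δ / (4 * ((1 - 2 * ε) * M + 1)) * ρ) := by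
          have := hPn.trans hrt
          gcongr
          linarith
      _ = _ := by field_simp
  have : 0 < δ * ρ := by positivity
  linarith

end UniformRate

/-! ### Uniform rates for the first-step estimators. -/

section FirstStep

variable {Ω : Type*} [MeasurableSpace Ω] {μ : Measure Ω} {d : ℕ}
    {y : ℕ → Ω → ℝ} {x : ℕ → Ω → Fin d → ℝ} {ν : Measure (Fin d → ℝ)}
    {fX : (Fin d → ℝ) → ℝ} {f : ℝ → (Fin d → ℝ) → ℝ} {fY : ℝ → ℝ}
    {τ ε : ℝ} {β : ℝ → Fin d → ℝ} {ξ : (Fin d → ℝ) → ℝ}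
    {m : ℕ → ℕ} {grid : (n : ℕ) → Fin (m n + 1) → ℝ}
    {βhat : ℕ → ℝ → Ω → Fin d → ℝ} {Qhat : ℕ → Ω → ℝ} {ξhat : ℕ → (Fin d → ℝ) → Ω → ℝ}
    {h : ℕ → ℝ} {a : ℝ} {r : ℕ}

/-- The mean of `(η - 1{y_i ≤ x_i'β(η)}) g(x_i)` is uniformly negligible, for `g ≥ 0`. -/
theorem isUniformLittleOp_centred_of_nonneg [IsProbabilityMeasure μ] [SFinite ν]
    (hs : IsRandomSample μ y x)
    (hdens : HasDensities μ (y 0) (x 0) ν fX f fY) (hε : ε ∈ Ioo (0 : ℝ) (1 / 2))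
    (hm : MatchingAssumption μ y x f fY τ ε β βhat Qhat m grid)
    (hb : BandwidthAssumption h a r) {g : (Fin d → ℝ) → ℝ}
    (hg : Measurable g) (hg0 : ∀ x', 0 ≤ g x') (hg2 : MemLp (fun ω => g (x 0 ω)) 2 μ) :
    IsUniformLittleOp μ (Icc ε (1 - ε))
      (fun n η ω => sampleMean (fun i ω => (y i ω, x i ω))
        (fun p => (η - belowInd (β η) p) * g p.2) n ω) (kernelRate h) := by
  have h1 := isUniformLittleOp_belowMean hs hdens hε hm hb hg hg0 hg2
  have h2 : IsLittleOp μ (fun n ω => sampleMean (fun i ω => (y i ω, x i ω)) (fun p => g p.2) n ω -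
      ∫ ω, g (x 0 ω) ∂μ) (kernelRate h) :=
    (isBigOp_sampleMean_sub hs.indep hs.identDistrib (φ := fun p => g p.2) (by fun_prop)
      hg2).isLittleOp fun δ hδ => hb.rpow_neg_half_le hδ
  refine (h2.uniform (Icc ε (1 - ε))).of_le_add h1 (C := 1) ?_ (fun _ _ _ => norm_nonneg _)
    (fun _ _ _ => norm_nonneg _)
  refine Eventually.of_forall fun n => ae_of_all _ fun ω η hη => ?_
  have hη' := Icc_subset_Ioo_zero_one hε hη
  have hsplit : sampleMean (fun i ω => (y i ω, x i ω))
      (fun p => (η - belowInd (β η) p) * g p.2) n ω =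
      η * (sampleMean (fun i ω => (y i ω, x i ω)) (fun p => g p.2) n ω - ∫ ω, g (x 0 ω) ∂μ) -
      (belowMean y x β g n η ω - η * ∫ ω, g (x 0 ω) ∂μ) := by
    have : sampleMean (fun i ω => (y i ω, x i ω)) (fun p => (η - belowInd (β η) p) * g p.2) n ω =
        η * sampleMean (fun i ω => (y i ω, x i ω)) (fun p => g p.2) n ω -
        belowMean y x β g n η ω := by
      simp only [sampleMean, belowMean, sub_mul, Finset.sum_sub_distrib, mul_sub, ← Finset.mul_sum]
      congr 1
      · ring
      · congr 1
        exact Finset.sum_congr rfl fun i _ => mul_comm _ _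
    rw [this]
    ring
  rw [hsplit, one_mul, one_mul]
  refine (norm_sub_le _ _).trans ?_
  rw [norm_mul]
  gcongr
  refine mul_le_of_le_one_left (norm_nonneg _) ?_
  rw [Real.norm_of_nonneg hη'.1.le]
  exact hη'.2.le

/-- Monotone bracketing needs nonnegative weights, so a coordinate is split into its positive and
negative parts. -/
theorem isUniformLittleOp_centred_coord [IsProbabilityMeasure μ] [SFinite ν]
    (hs : IsRandomSample μ y x)
    (hdens : HasDensities μ (y 0) (x 0) ν fX f fY) (hε : ε ∈ Ioo (0 : ℝ) (1 / 2))
    (hm : MatchingAssumption μ y x f fY τ ε β βhat Qhat m grid)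
    (hb : BandwidthAssumption h a r) (j : Fin d) :
    IsUniformLittleOp μ (Icc ε (1 - ε))
      (fun n η ω => sampleMean (fun i ω => (y i ω, x i ω))
        (fun p => (η - belowInd (β η) p) * p.2 j) n ω) (kernelRate h) := by
  have hX2 := memLp_covariate hs hdens hε hm j
  have h1 := isUniformLittleOp_centred_of_nonneg hs hdens hε hm hb
    (g := fun x' => max (x' j) 0) (by fun_prop) (fun _ => le_max_right _ _) hX2.pos_part
  have h2 := isUniformLittleOp_centred_of_nonneg hs hdens hε hm hb
    (g := fun x' => max (-x' j) 0) (by fun_prop) (fun _ => le_max_right _ _) hX2.neg_part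
  refine h1.of_le_add h2 (C := 1) ?_ (fun _ _ _ => norm_nonneg _) (fun _ _ _ => norm_nonneg _)
  refine Eventually.of_forall fun n => ae_of_all _ fun ω η _ => ?_
  rw [one_mul, one_mul]
  refine le_trans (le_of_eq ?_) (norm_sub_le _ _)
  congr 1
  simp only [sampleMean]
  rw [← mul_sub, ← Finset.sum_sub_distrib]
  congr 1
  refine Finset.sum_congr rfl fun i _ => ?_
  rw [← mul_sub]
  congr 1
  rcases le_total 0 (x i ω j) with h | h <;> simp [h]

/-- The quantile regression estimator converges uniformly, faster than `(n h)^{-1/2}`. -/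
theorem isUniformLittleOp_coef [IsProbabilityMeasure μ] [SFinite ν]
    (hs : IsRandomSample μ y x)
    (hdens : HasDensities μ (y 0) (x 0) ν fX f fY) (hε : ε ∈ Ioo (0 : ℝ) (1 / 2))
    (hm : MatchingAssumption μ y x f fY τ ε β βhat Qhat m grid)
    (hb : BandwidthAssumption h a r) :
    IsUniformLittleOp μ (Icc ε (1 - ε)) (fun n η ω => βhat n η ω - β η) (kernelRate h) := by
  have hR := hm.bahadur.mono_rate (s := kernelRate h) (by
    filter_upwards [hb.rpow_neg_half_le one_pos] with n hn
    rwa [one_mul] at hn)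
  have hB := IsUniformLittleOp.pi (hb.eventually_kernelRate_pos.mono fun _ => le_of_lt)
    fun j => isUniformLittleOp_centred_coord hs hdens hε hm hb j
  obtain ⟨C, hC⟩ : ∃ C : ℝ, ∀ η ∈ Icc ε (1 - ε), ∀ i j, |(J μ (x 0) f β η)⁻¹ i j| ≤ C := by
    have hc := continuousOn_J_inv hm
    choose C hC using fun p : Fin d × Fin d =>
      isCompact_Icc.exists_bound_of_continuousOn (f := fun η => (J μ (x 0) f β η)⁻¹ p.1 p.2)
        ((continuousOn_pi.1 (continuousOn_pi.1 hc p.1)) p.2)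
    refine ⟨∑ p, |C p|, fun η hη i j => (hC (i, j) η hη).trans ((le_abs_self _).trans ?_)⟩
    exact Finset.single_le_sum (f := fun p => |C p|) (fun _ _ => abs_nonneg _)
      (Finset.mem_univ (i, j))
  refine hR.of_le_add hB (C := 1 + d * |C|) ?_ (fun _ _ _ => norm_nonneg _)
    (fun _ _ _ => norm_nonneg _)
  refine Eventually.of_forall fun n => ae_of_all _ fun ω η hη => ?_
  set G := (n : ℝ)⁻¹ • ∑ i ∈ Finset.range n,
    influenceQR (J μ (x 0) f β η) (β η) η (y i ω) (x i ω) with hG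
  set B : Fin d → ℝ := fun j => sampleMean (fun i ω => (y i ω, x i ω))
    (fun p => (η - belowInd (β η) p) * p.2 j) n ω with hBdef
  -- The matrix depends on `η` but not on the observation, so it leaves the mean; uniformity in `η`
  -- then costs only a bound on its entries.
  have hGB : G = (J μ (x 0) f β η)⁻¹ *ᵥ B := by
    ext i
    have h1 := sampleMean_score (J μ (x 0) f β η) (β η) η (Pi.single i 1) y x n ω
    rw [single_one_dotProduct] at h1
    rw [hG, h1]
    simp only [Matrix.mulVec, dotProduct, hBdef, sampleMean, score, Matrix.single_one_vecMul]
    simp_rw [Finset.mul_sum]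
    rw [Finset.sum_comm]
    refine Finset.sum_congr rfl fun j _ => Finset.sum_congr rfl fun k _ => ?_
    simp only [Matrix.row]
    ring
  have hGle : ‖G‖ ≤ d * |C| * ‖B‖ := by
    rw [hGB]
    refine (pi_norm_le_iff_of_nonneg (by positivity)).2 fun i => ?_
    change ‖∑ j, (J μ (x 0) f β η)⁻¹ i j * B j‖ ≤ _
    refine (norm_sum_le _ _).trans ?_
    calc _ ≤ ∑ _j : Fin d, |C| * ‖B‖ := by
          refine Finset.sum_le_sum fun j _ => ?_
          rw [norm_mul]
          gcongr
          · exact (hC η hη i j).trans (le_abs_self C)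
          · exact norm_le_pi_norm B j
      _ = _ := by simp; ring
  have hsplit : βhat n η ω - β η = (βhat n η ω - β η - G) + G := by abel
  have hC0 : 0 ≤ (d : ℝ) * |C| := by positivity
  calc ‖βhat n η ω - β η‖ ≤ ‖βhat n η ω - β η - G‖ + ‖G‖ := by
        conv_lhs => rw [hsplit]
        exact norm_add_le _ _
    _ ≤ (1 + d * |C|) * ‖βhat n η ω - β η - G‖ + (1 + d * |C|) * ‖B‖ := by
        nlinarith [norm_nonneg (βhat n η ω - β η - G), norm_nonneg B,
          mul_nonneg hC0 (norm_nonneg (βhat n η ω - β η - G))]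

theorem isLittleOp_sampleQuantile [IsProbabilityMeasure μ]
    (hs : IsRandomSample μ y x)
    (hdens : HasDensities μ (y 0) (x 0) ν fX f fY) (hτ : τ ∈ Ioo (0 : ℝ) 1)
    (hm : MatchingAssumption μ y x f fY τ ε β βhat Qhat m grid)
    (hb : BandwidthAssumption h a r) :
    IsLittleOp μ (fun n ω => Qhat n ω - quantile (μ.map (y 0)) τ) (kernelRate h) :=
  (isBigOp_sampleQuantile hs hdens hτ hm).isLittleOp fun _ hδ => hb.rpow_neg_half_le hδ

/-- The estimated matching function converges uniformly, faster than `(n h)^{-1/2}`. -/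
theorem isUniformLittleOp_match [NeZero d] [IsProbabilityMeasure μ] [SFinite ν]
    (hs : IsRandomSample μ y x)
    (hdens : HasDensities μ (y 0) (x 0) ν fX f fY) (hτ : τ ∈ Ioo (0 : ℝ) 1)
    (hε : ε ∈ Ioo (0 : ℝ) (1 / 2))
    (hξ : ∀ x' ∈ (μ.map (x 0)).support,
      ξ x' ∈ matchingSet f (quantile (μ.map (y 0)) τ) x' ∩ Icc ε (1 - ε))
    (hm : MatchingAssumption μ y x f fY τ ε β βhat Qhat m grid)
    (hb : BandwidthAssumption h a r)
    (happ : ApproxAssumption μ (μ.map (x 0)).support f ε (quantile (μ.map (y 0)) τ) β ξ βhat Qhat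
      ξhat) (hbdd : Bornology.IsBounded (μ.map (x 0)).support) :
    IsUniformLittleOp μ (μ.map (x 0)).support (fun n x' ω => ξhat n x' ω - ξ x')
      (kernelRate h) := by
  set S := (μ.map (x 0)).support
  set Q := quantile (μ.map (y 0)) τ
  have hR := happ.remainder.mono_rate (s := kernelRate h) (by
    filter_upwards [hb.rpow_neg_half_le one_pos] with n hn
    rwa [one_mul] at hn)
  -- Uniformity in the level allows evaluation at `η = ξ(x)` for all `x` simultaneously.
  have hβ := (isUniformLittleOp_coef hs hdens hε hm hb).comp (T' := S)
    (s := fun _ x' _ => ξ x') fun _ x' hx _ => (hξ x' hx).2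
  have hQ := (isLittleOp_sampleQuantile hs hdens hτ hm hb).uniform S
  obtain ⟨C, hC⟩ := happ.density_bounded
  obtain ⟨B, hB⟩ := isBounded_iff_forall_norm_le.1 hbdd
  have hβQ : IsUniformLittleOp μ S
      (fun n x' ω => f (x' ⬝ᵥ β (ξ x')) x' *
        (-(x' ⬝ᵥ (βhat n (ξ x') ω - β (ξ x'))) + (Qhat n ω - Q))) (kernelRate h) := by
    refine hβ.of_le_add hQ (C := |C| * (d * |B| + 1)) ?_ (fun _ _ _ => norm_nonneg _)
      (fun _ _ _ => norm_nonneg _)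
    refine Eventually.of_forall fun n => ae_of_all _ fun ω x' hx => ?_
    have hf0 := hdens.f_nonneg (x' ⬝ᵥ β (ξ x')) x'
    have hfC := (hC x' hx (x' ⬝ᵥ β (ξ x'))).trans (le_abs_self C)
    have h1 := abs_dotProduct_le_card (βhat n (ξ x') ω - β (ξ x')) x'
    have hBx : ‖x'‖ ≤ |B| := (hB x' hx).trans (le_abs_self B)
    rw [norm_mul, Real.norm_of_nonneg hf0, Real.norm_eq_abs, ← mul_add, mul_assoc]
    gcongr
    calc _ ≤ |x' ⬝ᵥ (βhat n (ξ x') ω - β (ξ x'))| + |Qhat n ω - Q| := by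
          refine (abs_add_le _ _).trans_eq ?_
          rw [abs_neg]
      _ ≤ d * |B| * ‖βhat n (ξ x') ω - β (ξ x')‖ + |Qhat n ω - Q| := by
          gcongr
          refine h1.trans ?_
          gcongr
      _ ≤ _ := by
          have h2 : 0 ≤ (d : ℝ) * |B| := by positivity
          have h3 := norm_nonneg (βhat n (ξ x') ω - β (ξ x'))
          have h4 := abs_nonneg (Qhat n ω - Q)
          rw [Real.norm_eq_abs]
          nlinarith [mul_nonneg h2 h4]
  refine hR.of_le_add hβQ (C := 1) ?_ (fun _ _ _ => norm_nonneg _) (fun _ _ _ => norm_nonneg _)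
  refine Eventually.of_forall fun n => ae_of_all _ fun ω x' _ => ?_
  rw [one_mul, one_mul]
  refine le_trans (le_of_eq ?_) (norm_add_le _ _)
  rw [sub_add_cancel]

/-- The estimated regression weights converge uniformly, faster than `(n h)^{-1/2}`. -/
theorem isUniformLittleOp_weight [NeZero d] [IsProbabilityMeasure μ] [SFinite ν]
    (hs : IsRandomSample μ y x)
    (hdens : HasDensities μ (y 0) (x 0) ν fX f fY) (hτ : τ ∈ Ioo (0 : ℝ) 1)
    (hε : ε ∈ Ioo (0 : ℝ) (1 / 2))
    (hξ : ∀ x' ∈ (μ.map (x 0)).support,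
      ξ x' ∈ matchingSet f (quantile (μ.map (y 0)) τ) x' ∩ Icc ε (1 - ε))
    (hξhat : ∀ n x' ω, IsMatch ε (grid n) (fun η => βhat n η ω) (Qhat n ω) x' (ξhat n x' ω))
    (hm : MatchingAssumption μ y x f fY τ ε β βhat Qhat m grid)
    (hb : BandwidthAssumption h a r)
    (happ : ApproxAssumption μ (μ.map (x 0)).support f ε (quantile (μ.map (y 0)) τ) β ξ βhat Qhat
      ξhat) (hbdd : Bornology.IsBounded (μ.map (x 0)).support) :
    IsUniformLittleOp μ (μ.map (x 0)).support
      (fun n x' ω => βhat n (ξhat n x' ω) ω 0 - β (ξ x') 0) (kernelRate h) := by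
  set S := (μ.map (x 0)).support
  have hI : ∀ n x' ω, ξhat n x' ω ∈ Icc ε (1 - ε) :=
    fun n x' ω => matchEstimate_mem_Icc hm (hξhat n x' ω)
  have hβ := (isUniformLittleOp_coef hs hdens hε hm hb).comp (T' := S)
    (s := ξhat) fun n x' _ ω => hI n x' ω
  have hξr := isUniformLittleOp_match hs hdens hτ hε hξ hm hb happ hbdd
  obtain ⟨C, hC⟩ := happ.beta_deriv_bounded
  refine hβ.of_le_add hξr (C := 1 + |C|) ?_ (fun _ _ _ => norm_nonneg _)
    (fun _ _ _ => norm_nonneg _)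
  refine Eventually.of_forall fun n => ae_of_all _ fun ω x' hx => ?_
  -- Mean value inequality on `I`, which contains both the true and the estimated level.
  have h1 : ‖β (ξhat n x' ω) 0 - β (ξ x') 0‖ ≤ C * ‖ξhat n x' ω - ξ x'‖ :=
    (convex_Icc ε (1 - ε)).norm_image_sub_le_of_norm_derivWithin_le
      happ.beta_differentiable hC (hξ x' hx).2 (hI n x' ω)
  have h2 : ‖βhat n (ξhat n x' ω) ω 0 - β (ξhat n x' ω) 0‖ ≤
      ‖βhat n (ξhat n x' ω) ω - β (ξhat n x' ω)‖ :=
    norm_le_pi_norm (βhat n (ξhat n x' ω) ω - β (ξhat n x' ω)) 0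
  have h3 : βhat n (ξhat n x' ω) ω 0 - β (ξ x') 0 =
      (βhat n (ξhat n x' ω) ω 0 - β (ξhat n x' ω) 0) + (β (ξhat n x' ω) 0 - β (ξ x') 0) := by ring
  calc _ ≤ ‖βhat n (ξhat n x' ω) ω 0 - β (ξhat n x' ω) 0‖ +
        ‖β (ξhat n x' ω) 0 - β (ξ x') 0‖ := by rw [h3]; exact norm_add_le _ _
    _ ≤ ‖βhat n (ξhat n x' ω) ω - β (ξhat n x' ω)‖ + |C| * ‖ξhat n x' ω - ξ x'‖ :=
        add_le_add h2 (h1.trans (mul_le_mul_of_nonneg_right (le_abs_self C) (norm_nonneg _)))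
    _ ≤ _ := by
        nlinarith [norm_nonneg (ξhat n x' ω - ξ x'), abs_nonneg C,
          mul_nonneg (abs_nonneg C) (norm_nonneg (βhat n (ξhat n x' ω) ω - β (ξhat n x' ω)))]

end FirstStep

/-! ### Scaling and boundedness of the kernel. -/

section Kernel

variable {K : ℝ → ℝ} {r : ℕ}

/-- The derivative of `q ↦ K_h(y - q)`. -/
def rescaleDeriv (K : ℝ → ℝ) (h u : ℝ) : ℝ := -(h⁻¹ * h⁻¹ * deriv K (u / h))

theorem KernelAssumption.continuous_deriv (hK : KernelAssumption K r) : Continuous (deriv K) :=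
  hK.differentiable_deriv.continuous

theorem KernelAssumption.continuous (hK : KernelAssumption K r) : Continuous K :=
  hK.differentiable.continuous

/-- Fundamental theorem of calculus. The bound depends on `ρ` only and not on `q`, so it applies at
a random point without any supremum over a class. -/
theorem abs_sub_le_integral_abs_deriv {F G : ℝ → ℝ} (hF : ∀ q, HasDerivAt F (G q) q)
    (hG : Continuous G) {Q q ρ : ℝ} (hq : |q - Q| ≤ ρ) :
    |F q - F Q| ≤ ∫ s in Icc (Q - ρ) (Q + ρ), |G s| := by
  rw [← intervalIntegral.integral_eq_sub_of_hasDerivAt (fun s _ => hF s)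
    (hG.intervalIntegrable _ _), ← Real.norm_eq_abs]
  refine (intervalIntegral.norm_integral_le_integral_norm_uIoc).trans ?_
  refine setIntegral_mono_set (hG.norm.continuousOn.integrableOn_compact isCompact_Icc)
    (ae_of_all _ fun _ => norm_nonneg _) (LE.le.eventuallyLE ?_)
  have h1 := abs_le.1 hq
  refine uIoc_subset_uIcc.trans (uIcc_subset_Icc ⟨?_, ?_⟩ ⟨?_, ?_⟩) <;> linarith [abs_nonneg (q - Q)]

/-- An integrable derivative bounds the total variation of `K`. -/
theorem KernelAssumption.exists_bound (hK : KernelAssumption K r) : ∃ M : ℝ, ∀ u, |K u| ≤ M := by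
  refine ⟨|K 0| + ∫ s, |deriv K s|, fun u => ?_⟩
  have h1 := abs_sub_le_integral_abs_deriv (fun q => (hK.differentiable q).hasDerivAt)
    hK.continuous_deriv (Q := 0) (q := u) le_rfl
  have h2 := setIntegral_le_integral (s := Icc (0 - |u - 0|) (0 + |u - 0|)) hK.deriv_integrable.abs
    (ae_of_all _ fun _ => abs_nonneg _)
  have h3 := abs_sub_abs_le_abs_sub (K u) (K 0)
  linarith

theorem integrable_comp_sub_div {g : ℝ → ℝ} (hg : Integrable g) {h : ℝ} (hh : 0 < h) (q : ℝ) :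
    Integrable fun y => g ((y - q) / h) :=
  (hg.comp_div hh.ne').comp_sub_right q

theorem integral_comp_sub_div {g : ℝ → ℝ} {h : ℝ} (hh : 0 < h) (q : ℝ) :
    ∫ y, g ((y - q) / h) = h * ∫ u, g u := by
  rw [integral_sub_right_eq_self (fun y => g (y / h)) q, Measure.integral_comp_div,
    abs_of_pos hh, smul_eq_mul]

theorem hasDerivAt_rescale (hK : Differentiable ℝ K) (h y q : ℝ) :
    HasDerivAt (fun q => rescale K h (y - q)) (rescaleDeriv K h (y - q)) q := by
  have h1 : HasDerivAt (fun q => (y - q) / h) (-1 / h) q :=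
    ((hasDerivAt_id q).const_sub y).div_const h
  have h2 := ((hK ((y - q) / h)).hasDerivAt.comp q h1).const_mul h⁻¹
  refine h2.congr_deriv ?_
  unfold rescaleDeriv
  ring

theorem hasDerivAt_rescale_left (hK : Differentiable ℝ K) (h y q : ℝ) :
    HasDerivAt (fun y => rescale K h (y - q)) (-rescaleDeriv K h (y - q)) y := by
  have h1 : HasDerivAt (fun y => (y - q) / h) (1 / h) y :=
    ((hasDerivAt_id y).sub_const q).div_const h
  have h2 := ((hK ((y - q) / h)).hasDerivAt.comp y h1).const_mul h⁻¹
  refine h2.congr_deriv ?_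
  unfold rescaleDeriv
  ring

theorem KernelAssumption.integrable_rescale (hK : KernelAssumption K r) {h : ℝ} (hh : 0 < h)
    (q : ℝ) : Integrable fun y => rescale K h (y - q) :=
  (integrable_comp_sub_div hK.integrable hh q).const_mul _

theorem KernelAssumption.integrable_rescaleDeriv (hK : KernelAssumption K r) {h : ℝ} (hh : 0 < h)
    (q : ℝ) : Integrable fun y => rescaleDeriv K h (y - q) :=
  ((integrable_comp_sub_div hK.deriv_integrable hh q).const_mul _).neg

theorem integral_abs_rescale {h : ℝ} (hh : 0 < h) (q : ℝ) :
    ∫ y, |rescale K h (y - q)| = ∫ u, |K u| := by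
  simp_rw [rescale, abs_mul, abs_of_pos (inv_pos.2 hh)]
  rw [integral_const_mul, integral_comp_sub_div (g := fun u => |K u|) hh q]
  field_simp

theorem integral_abs_rescaleDeriv {h : ℝ} (hh : 0 < h) (q : ℝ) :
    ∫ y, |rescaleDeriv K h (y - q)| = h⁻¹ * ∫ u, |deriv K u| := by
  simp_rw [rescaleDeriv, abs_neg, abs_mul, abs_of_pos (inv_pos.2 hh)]
  rw [integral_const_mul, integral_comp_sub_div (g := fun u => |deriv K u|) hh q]
  field_simp

theorem integral_rescale_sq {h : ℝ} (hh : 0 < h) (q : ℝ) :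
    ∫ y, rescale K h (y - q) ^ 2 = h⁻¹ * ∫ u, K u ^ 2 := by
  simp_rw [rescale, mul_pow]
  rw [integral_const_mul, integral_comp_sub_div (g := fun u => K u ^ 2) hh q]
  field_simp

/-- Squaring contributes `h⁻⁴` and the change of variable `h`; the resulting `h⁻³` governs the
variance of the derivative of a kernel mean. -/
theorem integral_rescaleDeriv_sq {h : ℝ} (hh : 0 < h) (q : ℝ) :
    ∫ y, rescaleDeriv K h (y - q) ^ 2 = (h ^ 3)⁻¹ * ∫ u, deriv K u ^ 2 := by
  simp_rw [rescaleDeriv, neg_sq, mul_pow]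
  rw [integral_const_mul, integral_comp_sub_div (g := fun u => deriv K u ^ 2) hh q]
  field_simp

theorem KernelAssumption.integrable_sq (hK : KernelAssumption K r) :
    Integrable fun u => K u ^ 2 := by
  obtain ⟨M, hM⟩ := hK.exists_bound
  simp_rw [sq]
  exact hK.integrable.bdd_mul hK.continuous.aestronglyMeasurable (ae_of_all _ hM)

theorem KernelAssumption.continuous_rescale (hK : KernelAssumption K r) (h : ℝ) :
    Continuous (rescale K h) := by
  have := hK.continuous
  unfold rescale
  fun_prop

theorem KernelAssumption.continuous_rescaleDeriv (hK : KernelAssumption K r) (h : ℝ) :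
    Continuous (rescaleDeriv K h) := by
  have := hK.continuous_deriv
  unfold rescaleDeriv
  fun_prop

theorem KernelAssumption.exists_bound_rescale (hK : KernelAssumption K r) (h : ℝ) :
    ∃ M : ℝ, ∀ u, |rescale K h u| ≤ M := by
  obtain ⟨M, hM⟩ := hK.exists_bound
  refine ⟨|h⁻¹| * M, fun u => ?_⟩
  rw [rescale, abs_mul]
  gcongr
  exact hM _

theorem KernelAssumption.exists_bound_rescaleDeriv (hK : KernelAssumption K r) (h : ℝ) :
    ∃ M : ℝ, ∀ u, |rescaleDeriv K h u| ≤ M := by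
  obtain ⟨M, hM⟩ := hK.deriv_bounded
  refine ⟨|h⁻¹ * h⁻¹| * M, fun u => ?_⟩
  rw [rescaleDeriv, abs_neg, abs_mul]
  gcongr
  exact hM _

/-- Integration by parts against the derivative of the kernel. -/
theorem KernelAssumption.abs_integral_mul_rescaleDeriv_le (hK : KernelAssumption K r) {h : ℝ}
    (hh : 0 < h) (q : ℝ) {F : ℝ → ℝ} (hF : ContDiff ℝ 1 F) {B C : ℝ} (hB : ∀ y, |F y| ≤ B)
    (hC : ∀ y, |deriv F y| ≤ C) :
    |∫ y, F y * rescaleDeriv K h (y - q)| ≤ C * ∫ u, |K u| := by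
  have hF' : Continuous (deriv F) := hF.continuous_deriv le_rfl
  have h1 := integral_mul_deriv_eq_deriv_mul_of_integrable (u := F)
    (v := fun y => rescale K h (y - q)) (u' := deriv F) (v' := fun y => -rescaleDeriv K h (y - q))
    (fun y _ => (hF.differentiable one_ne_zero y).hasDerivAt)
    (fun y _ => hasDerivAt_rescale_left hK.differentiable h y q)
    ((hK.integrable_rescaleDeriv hh q).neg.bdd_mul hF.continuous.aestronglyMeasurable
      (ae_of_all _ hB))
    ((hK.integrable_rescale hh q).bdd_mul hF'.aestronglyMeasurable (ae_of_all _ hC))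
    ((hK.integrable_rescale hh q).bdd_mul hF.continuous.aestronglyMeasurable (ae_of_all _ hB))
  have h2 : ∫ y, F y * rescaleDeriv K h (y - q) = ∫ y, deriv F y * rescale K h (y - q) := by
    simp only [mul_neg, integral_neg, neg_inj] at h1
    exact h1
  rw [h2, ← integral_abs_rescale hh q, ← integral_const_mul, ← Real.norm_eq_abs]
  refine norm_integral_le_of_norm_le ((hK.integrable_rescale hh q).abs.const_mul C)
    (ae_of_all _ fun y => ?_)
  rw [norm_mul]
  exact mul_le_mul_of_nonneg_right (hC y) (abs_nonneg _)

end Kernel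

/-! ### Expectations of kernel terms. -/

section KernelMeans

variable {Ω : Type*} [MeasurableSpace Ω] {μ : Measure Ω} [IsProbabilityMeasure μ] {d : ℕ}
    {Y : Ω → ℝ} {X : Ω → Fin d → ℝ} {ν : Measure (Fin d → ℝ)} [SFinite ν]
    {fX : (Fin d → ℝ) → ℝ} {f : ℝ → (Fin d → ℝ) → ℝ} {fY : ℝ → ℝ} {K : ℝ → ℝ} {r : ℕ}

theorem HasDensities.integral_le_of_nonneg (hd : HasDensities μ Y X ν fX f fY) (hY : Measurable Y)
    (hX : Measurable X) {C : ℝ} (hC0 : 0 ≤ C) (hC : ∀ x ∈ (μ.map X).support, ∀ y, f y x ≤ C)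
    {φ : ℝ → ℝ} (hφ : Measurable φ) (hφ0 : ∀ y, 0 ≤ φ y) (hφi : Integrable φ) :
    Integrable (fun ω => φ (Y ω)) μ ∧ ∫ ω, φ (Y ω) ∂μ ≤ C * ∫ y, φ y := by
  have h := hd.lintegral_le hY hX hC (φ := fun y => ENNReal.ofReal (φ y)) (by fun_prop)
  rw [← ofReal_integral_eq_lintegral_ofReal hφi (ae_of_all _ hφ0), ← ENNReal.ofReal_mul hC0] at h
  have hm : AEStronglyMeasurable (fun ω => φ (Y ω)) μ := (hφ.comp hY).aestronglyMeasurable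
  refine ⟨⟨hm, ?_⟩, ?_⟩
  · rw [hasFiniteIntegral_iff_ofReal (ae_of_all _ fun _ => hφ0 _)]
    exact h.trans_lt ENNReal.ofReal_lt_top
  · rw [integral_eq_lintegral_of_nonneg_ae (ae_of_all _ fun _ => hφ0 _) hm]
    exact ENNReal.toReal_le_of_le_ofReal
      (mul_nonneg hC0 (integral_nonneg hφ0)) h

/-- The mean of the derivative of the kernel estimator is bounded, as `ν` is finite on the
support of `X`. -/
theorem HasDensities.abs_integral_rescaleDeriv_le (hd : HasDensities μ Y X ν fX f fY)
    (hY : Measurable Y) (hX : Measurable X) {C : ℝ}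
    (hC : ∀ x ∈ (μ.map X).support, ∀ y, f y x ≤ C)
    (hν : ν (μ.map X).support < ⊤) (hD : DensityAssumption (μ.map X).support fX f fY r)
    (hK : KernelAssumption K r) {W : (Fin d → ℝ) → ℝ} (hW : Measurable W) {B : ℝ}
    (hB : ∀ x, |W x| ≤ B) :
    ∃ A : ℝ, 0 ≤ A ∧ ∀ h : ℝ, 0 < h → ∀ q,
      |∫ ω, rescaleDeriv K h (Y ω - q) * W (X ω) ∂μ| ≤ A := by
  obtain ⟨D, hDb⟩ := hD.joint_bounded
  refine ⟨|B| * (|D| * ∫ u, |K u|) * ν.real (μ.map X).support, ?_, fun h hh q => ?_⟩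
  · have : 0 ≤ ∫ u, |K u| := integral_nonneg fun _ => abs_nonneg _
    positivity
  obtain ⟨M, hM⟩ := hK.exists_bound_rescaleDeriv h
  have hcont := hK.continuous_rescaleDeriv h
  set φ : ℝ × (Fin d → ℝ) → ℝ := fun p => rescaleDeriv K h (p.1 - q) * W p.2 with hφ
  have hφm : Measurable φ := by
    have := hcont.measurable
    fun_prop
  have hi : Integrable (fun ω => φ (Y ω, X ω)) μ := by
    refine Integrable.of_bound (hφm.comp (hY.prodMk hX)).aestronglyMeasurable (M * B)
      (ae_of_all _ fun ω => ?_)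
    rw [norm_mul]
    exact mul_le_mul (hM _) (hB _) (norm_nonneg _) ((abs_nonneg _).trans (hM 0))
  change |∫ ω, φ (Y ω, X ω) ∂μ| ≤ _
  rw [hd.integral_eq hY hX hφm hi, ← Real.norm_eq_abs]
  -- Integration by parts bounds the inner integral by a constant rather than by a multiple of `fX
  -- x`, as the derivative bound is on the joint density. Integrating a constant over `x` requires
  -- finite `ν`-mass.
  refine norm_setIntegral_le_of_norm_le_const hν fun x hx => ?_
  have hsplit : ∫ y, (f y x * fX x) * φ (y, x) =
      W x * ∫ y, (f y x * fX x) * rescaleDeriv K h (y - q) := by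
    rw [← integral_const_mul]
    refine integral_congr_ae (ae_of_all _ fun y => ?_)
    simp only [hφ]
    ring
  rw [hsplit, norm_mul]
  have hcd : ContDiff ℝ 1 fun y => f y x * fX x :=
    (hD.joint_contDiff x hx).of_le (by exact_mod_cast Nat.le_add_left 1 r)
  have hb : ∀ y, |f y x * fX x| ≤ C * fX x := fun y => by
    rw [abs_of_nonneg (mul_nonneg (hd.f_nonneg y x) (hd.fX_nonneg x))]
    exact mul_le_mul_of_nonneg_right (hC x hx y) (hd.fX_nonneg x)
  have hd1 : ∀ y, |deriv (fun y => f y x * fX x) y| ≤ |D| := fun y => by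
    have := hDb x hx 1 (Finset.mem_Icc.2 ⟨le_rfl, Nat.le_add_left 1 r⟩) y
    rw [iteratedDeriv_one] at this
    exact this.trans (le_abs_self D)
  have h1 := hK.abs_integral_mul_rescaleDeriv_le hh q hcd hb hd1
  exact mul_le_mul ((hB x).trans (le_abs_self B)) h1 (norm_nonneg _) (abs_nonneg _)

theorem HasDensities.integral_rescaleDeriv_sq_le (hd : HasDensities μ Y X ν fX f fY)
    (hY : Measurable Y) (hX : Measurable X) {C : ℝ} (hC0 : 0 ≤ C)
    (hC : ∀ x ∈ (μ.map X).support, ∀ y, f y x ≤ C)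
    (hK : KernelAssumption K r) {W : (Fin d → ℝ) → ℝ} {B : ℝ}
    (hB : ∀ x, |W x| ≤ B) {h : ℝ} (hh : 0 < h) (q : ℝ) :
    ∫ ω, (rescaleDeriv K h (Y ω - q) * W (X ω)) ^ 2 ∂μ ≤
      B ^ 2 * C * (∫ u, deriv K u ^ 2) * (h ^ 3)⁻¹ := by
  have hcont := hK.continuous_rescaleDeriv h
  have hint : Integrable fun y => rescaleDeriv K h (y - q) ^ 2 := by
    simp_rw [rescaleDeriv, neg_sq, mul_pow]
    exact (integrable_comp_sub_div hK.deriv_sq_integrable hh q).const_mul _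
  obtain ⟨h1, h2⟩ := hd.integral_le_of_nonneg hY hX hC0 hC
    (φ := fun y => rescaleDeriv K h (y - q) ^ 2)
    (by have := hcont.measurable; fun_prop) (fun _ => sq_nonneg _) hint
  rw [integral_rescaleDeriv_sq hh q] at h2
  calc _ ≤ ∫ ω, B ^ 2 * rescaleDeriv K h (Y ω - q) ^ 2 ∂μ := by
        refine integral_mono_of_nonneg (ae_of_all _ fun _ => sq_nonneg _) (h1.const_mul _)
          (ae_of_all _ fun ω => ?_)
        simp only [mul_pow]
        rw [mul_comm]
        gcongr ?_ * _
        rw [← sq_abs]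
        exact pow_le_pow_left₀ (abs_nonneg _) (hB _) 2
    _ ≤ B ^ 2 * (C * ((h ^ 3)⁻¹ * ∫ u, deriv K u ^ 2)) := by
        rw [integral_const_mul]
        gcongr
    _ = _ := by ring

/-- Substitute `y = Q + h u` and apply dominated convergence in `u` and then in `x`, with dominating
function `C fX(x) |K(u)|`; continuity of the joint density in `y` identifies the limit. -/
theorem HasDensities.tendsto_integral_rescale (hd : HasDensities μ Y X ν fX f fY)
    (hY : Measurable Y) (hX : Measurable X) {C : ℝ}
    (hC : ∀ x ∈ (μ.map X).support, ∀ y, f y x ≤ C)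
    (hD : DensityAssumption (μ.map X).support fX f fY r)
    (hK : KernelAssumption K r) (Q : ℝ) :
    Tendsto (fun h : ℝ => ∫ ω, rescale K h (Y ω - Q) ∂μ) (𝓝[>] 0)
      (𝓝 (∫ x in (μ.map X).support, f Q x * fX x ∂ν)) := by
  set S := (μ.map X).support with hS
  have hSm : MeasurableSet S := measurableSet_support _
  have heq : ∀ h : ℝ, 0 < h → ∫ ω, rescale K h (Y ω - Q) ∂μ =
      ∫ x in S, (∫ u, (f (Q + h * u) x * fX x) * K u) ∂ν := by
    intro h hh
    obtain ⟨M, hM⟩ := hK.exists_bound_rescale h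
    have hm : Measurable fun p : ℝ × (Fin d → ℝ) => rescale K h (p.1 - Q) := by
      have := (hK.continuous_rescale h).measurable
      fun_prop
    have h1 := hd.integral_eq hY hX (φ := fun p => rescale K h (p.1 - Q)) hm
      (Integrable.of_bound (hm.comp (hY.prodMk hX)).aestronglyMeasurable M
        (ae_of_all _ fun ω => hM _))
    simp only at h1
    rw [h1]
    refine integral_congr_ae (ae_of_all _ fun x => ?_)
    have h2 := integral_comp_sub_div (g := fun u => (f (Q + h * u) x * fX x) * K u) hh Q
    have h3 : ∀ y, h * ((y - Q) / h) = y - Q := fun y => by field_simp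
    simp only [h3, add_sub_cancel] at h2
    simp only [rescale]
    rw [← mul_right_inj' hh.ne', ← h2, ← integral_const_mul]
    refine integral_congr_ae (ae_of_all _ fun y => ?_)
    field_simp
  have hcongr : (fun h : ℝ => ∫ x in S, (∫ u, (f (Q + h * u) x * fX x) * K u) ∂ν) =ᶠ[𝓝[>] 0]
      fun h : ℝ => ∫ ω, rescale K h (Y ω - Q) ∂μ := by
    filter_upwards [self_mem_nhdsWithin] with h hh using (heq h hh).symm
  refine Tendsto.congr' hcongr ?_
  have hbound : ∀ x ∈ S, ∀ h u : ℝ, ‖(f (Q + h * u) x * fX x) * K u‖ ≤ C * fX x * |K u| := by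
    intro x hx h u
    rw [norm_mul, Real.norm_of_nonneg (mul_nonneg (hd.f_nonneg _ x) (hd.fX_nonneg x))]
    exact mul_le_mul_of_nonneg_right
      (mul_le_mul_of_nonneg_right (hC x hx _) (hd.fX_nonneg x)) (norm_nonneg _)
  have hf := hd.measurable_f
  have hfX := hd.measurable_fX
  have hKm := hK.continuous.measurable
  refine tendsto_integral_filter_of_dominated_convergence
    (fun x => C * fX x * ∫ u, |K u|) ?_ ?_ ?_ ?_
  · refine Eventually.of_forall fun h => ?_
    have : Measurable fun p : (Fin d → ℝ) × ℝ => (f (Q + h * p.2) p.1 * fX p.1) * K p.2 := by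
      have : Measurable fun p : (Fin d → ℝ) × ℝ => f (Q + h * p.2) p.1 :=
        hf.comp (((measurable_const.add (measurable_snd.const_mul h))).prodMk measurable_fst)
      fun_prop
    exact (this.stronglyMeasurable.integral_prod_right').aestronglyMeasurable
  · refine Eventually.of_forall fun h => ?_
    filter_upwards [ae_restrict_mem hSm] with x hx
    rw [← integral_const_mul]
    exact norm_integral_le_of_norm_le (hK.integrable.abs.const_mul _)
      (ae_of_all _ fun u => hbound x hx h u)
  · exact ((hd.integrable_fX hY hX).const_mul C).mul_const _
  · filter_upwards [ae_restrict_mem hSm] with x hx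
    have hc : Continuous fun y => f y x * fX x := (hD.joint_contDiff x hx).continuous
    have hlim : Tendsto (fun h : ℝ => ∫ u, (f (Q + h * u) x * fX x) * K u) (𝓝[>] 0)
        (𝓝 (∫ u, (f Q x * fX x) * K u)) := by
      refine tendsto_integral_filter_of_dominated_convergence (fun u => C * fX x * |K u|) ?_ ?_
        (hK.integrable.abs.const_mul _) ?_
      · refine Eventually.of_forall fun h => ?_
        have : Continuous fun u => (f (Q + h * u) x * fX x) * K u :=
          (hc.comp (by fun_prop : Continuous fun u => Q + h * u)).mul hK.continuous
        exact this.aestronglyMeasurable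
      · exact Eventually.of_forall fun h => ae_of_all _ fun u => hbound x hx h u
      · refine ae_of_all _ fun u => ?_
        have h1 : Tendsto (fun h : ℝ => Q + h * u) (𝓝[>] 0) (𝓝 Q) := by
          have : Continuous fun h : ℝ => Q + h * u := by fun_prop
          simpa using (this.tendsto 0).mono_left nhdsWithin_le_nhds
        exact ((hc.tendsto Q).comp h1).mul_const _
    rwa [integral_const_mul, hK.integral_eq_one, mul_one] at hlim

end KernelMeans

/-! ### Local variation of random functions. -/

section LocalVariation

variable {Ω : Type*} [MeasurableSpace Ω] {μ : Measure Ω}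

theorem measurable_integral_abs {G : Ω → ℝ → ℝ} (hG : Measurable (Function.uncurry G)) (s : Set ℝ) :
    Measurable fun ω => ∫ q in s, |G ω q| :=
  (hG.abs.stronglyMeasurable.integral_prod_right').measurable

/-- Tonelli's theorem: a first-moment bound at each fixed `q` already controls the variation over
the interval. -/
theorem lintegral_integral_abs_le [SFinite μ] {G : Ω → ℝ → ℝ} (hG : Measurable (Function.uncurry G))
    (hc : ∀ ω, Continuous (G ω)) {b ρ : ℝ} (hρ : 0 ≤ ρ) (Q : ℝ)
    (hb : ∀ q, ∫⁻ ω, ENNReal.ofReal |G ω q| ∂μ ≤ ENNReal.ofReal b) :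
    ∫⁻ ω, ENNReal.ofReal |(∫ q in Icc (Q - ρ) (Q + ρ), |G ω q|)| ∂μ ≤
      ENNReal.ofReal (2 * ρ * b) := by
  calc _ = ∫⁻ ω, (∫⁻ q in Icc (Q - ρ) (Q + ρ), ENNReal.ofReal |G ω q|) ∂μ := by
        refine lintegral_congr fun ω => ?_
        rw [abs_of_nonneg (integral_nonneg fun _ => abs_nonneg _),
          ofReal_integral_eq_lintegral_ofReal
            ((hc ω).abs.continuousOn.integrableOn_compact isCompact_Icc)
            (ae_of_all _ fun _ => abs_nonneg _)]
    _ = ∫⁻ q in Icc (Q - ρ) (Q + ρ), (∫⁻ ω, ENNReal.ofReal |G ω q| ∂μ) :=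
        lintegral_lintegral_swap (hG.abs.ennreal_ofReal.aemeasurable)
    _ ≤ ∫⁻ _q in Icc (Q - ρ) (Q + ρ), ENNReal.ofReal b := lintegral_mono fun q => hb q
    _ = _ := by
        rw [setLIntegral_const, Real.volume_Icc, mul_comm, ← ENNReal.ofReal_mul (by linarith)]
        congr 1
        ring

/-- The increment of a process over a random interval of length `O_p(s n)` is negligible if the
total variation over every deterministic interval of length of order `s n` is. -/
theorem IsBigOp.isLittleOp_increment {R D : ℕ → Ω → ℝ} {s r : ℕ → ℝ} (hR : IsBigOp μ R s)
    {V : ℝ → ℕ → Ω → ℝ} (hV : ∀ M, 0 < M → IsLittleOp μ (V M) r)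
    (h : ∀ᶠ n in atTop, ∀ᵐ ω ∂μ, ∀ M, |R n ω| ≤ M * s n → |D n ω| ≤ |V M n ω|) :
    IsLittleOp μ D r := by
  intro δ hδ
  rw [ENNReal.tendsto_nhds_zero]
  intro κ hκ
  obtain ⟨M, hM, hRM⟩ := hR (κ / 2) (ENNReal.half_pos hκ.ne')
  have hVM := (ENNReal.tendsto_nhds_zero.1 (hV M hM δ hδ)) (κ / 2) (ENNReal.half_pos hκ.ne')
  filter_upwards [hRM, hVM, h] with n h1 h2 h3
  rw [← ENNReal.add_halves κ]
  refine le_trans (measure_mono_ae ?_) ((measure_union_le _ _).trans (add_le_add h1 h2))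
  filter_upwards [h3] with ω hω
  intro hlt
  change ω ∈ (_ ∪ _ : Set Ω)
  by_contra hcon
  simp only [mem_ofPred_eq, not_or, not_lt, mem_union] at hcon
  have h4 : δ * r n < |D n ω| := hlt
  have h5 : |V M n ω| ≤ δ * r n := hcon.2
  linarith [hω M hcon.1]

theorem lintegral_abs_sampleMean_le_integral {E : Type*} [MeasurableSpace E] {Z : ℕ → Ω → E}
    (hid : ∀ i, IdentDistrib (Z i) (Z 0) μ μ) {φ : E → ℝ} (hφ : Measurable φ)
    (h1 : Integrable (fun ω => φ (Z 0 ω)) μ) {n : ℕ} (hn : n ≠ 0) :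
    ∫⁻ ω, ENNReal.ofReal |sampleMean Z φ n ω| ∂μ ≤ ENNReal.ofReal (∫ ω, |φ (Z 0 ω)| ∂μ) := by
  have habs : Measurable fun e => |φ e| := by fun_prop
  have hi : ∀ i, Integrable (fun ω => |φ (Z i ω)|) μ := fun i =>
    IdentDistrib.integrable_iff (g := fun ω => |φ (Z 0 ω)|) ((hid i).comp habs) |>.2 h1.abs
  have hint : Integrable (sampleMean Z (fun e => |φ e|) n) μ := by
    unfold sampleMean
    exact (integrable_finsetSum _ fun i _ => hi i).const_mul _
  have h0 : ∀ ω, 0 ≤ sampleMean Z (fun e => |φ e|) n ω := fun ω =>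
    mul_nonneg (by positivity) (Finset.sum_nonneg fun _ _ => abs_nonneg _)
  rw [← integral_sampleMean hid habs h1.abs hn,
    ofReal_integral_eq_lintegral_ofReal hint (ae_of_all _ h0)]
  refine lintegral_mono fun ω => ENNReal.ofReal_le_ofReal ?_
  unfold sampleMean
  rw [abs_mul, abs_of_nonneg (by positivity : (0 : ℝ) ≤ (n : ℝ)⁻¹)]
  gcongr
  exact Finset.abs_sum_le_sum_abs _ _

end LocalVariation

/-! ### Kernel estimators at the true and at the estimated quantile. -/

section KernelEstimators

/-- The mean of `|K_h(y_i - q)|`. -/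
def absKernelMean {Ω : Type*} (y : ℕ → Ω → ℝ) (K : ℝ → ℝ) (h : ℝ) (n : ℕ) (q : ℝ) (ω : Ω) : ℝ :=
  (n : ℝ)⁻¹ * ∑ i ∈ Finset.range n, |rescale K h (y i ω - q)|

theorem absKernelMean_nonneg {Ω : Type*} (y : ℕ → Ω → ℝ) (K : ℝ → ℝ) (h : ℝ) (n : ℕ) (q : ℝ) (ω : Ω) :
    0 ≤ absKernelMean y K h n q ω :=
  mul_nonneg (by positivity) (Finset.sum_nonneg fun _ _ => abs_nonneg _)

variable {Ω : Type*} [MeasurableSpace Ω] {μ : Measure Ω} [IsProbabilityMeasure μ] {d : ℕ}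
    {y : ℕ → Ω → ℝ} {x : ℕ → Ω → Fin d → ℝ} {ν : Measure (Fin d → ℝ)} [SFinite ν]
    {fX : (Fin d → ℝ) → ℝ} {f : ℝ → (Fin d → ℝ) → ℝ} {fY : ℝ → ℝ} {K : ℝ → ℝ} {r : ℕ}
    {h : ℕ → ℝ} {a : ℝ} {Q : ℝ} {Qhat : ℕ → Ω → ℝ}

/-- The kernel estimator `n⁻¹ ∑ K_h(y_i - q) W(x_i)`. -/
def kernelMean (y : ℕ → Ω → ℝ) (x : ℕ → Ω → Fin d → ℝ) (K : ℝ → ℝ) (h : ℝ)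
    (W : (Fin d → ℝ) → ℝ) (n : ℕ) (q : ℝ) (ω : Ω) : ℝ :=
  sampleMean (fun i ω => (y i ω, x i ω)) (fun p => rescale K h (p.1 - q) * W p.2) n ω

/-- Shifting the evaluation point of the kernel estimator by `O_p(n^{-1/2})` changes it by
`o_p((n h)^{-1/2})`. -/
theorem isLittleOp_kernelMean_sub (hs : IsRandomSample μ y x)
    (hd : HasDensities μ (y 0) (x 0) ν fX f fY) {C : ℝ} (hC0 : 0 ≤ C)
    (hC : ∀ x' ∈ (μ.map (x 0)).support, ∀ y', f y' x' ≤ C)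
    (hν : ν (μ.map (x 0)).support < ⊤) (hD : DensityAssumption (μ.map (x 0)).support fX f fY r)
    (hK : KernelAssumption K r) (hb : BandwidthAssumption h a r)
    (hQ : IsBigOp μ (fun n ω => Qhat n ω - Q) fun n => (n : ℝ) ^ (-(1 / 2) : ℝ))
    {W : (Fin d → ℝ) → ℝ} (hW : Measurable W) {B : ℝ} (hB : ∀ x', |W x'| ≤ B) :
    IsLittleOp μ (fun n ω => kernelMean y x K (h n) W n (Qhat n ω) ω -
      kernelMean y x K (h n) W n Q ω) (kernelRate h) := by
  obtain ⟨A, hA0, hA⟩ := hd.abs_integral_rescaleDeriv_le (hs.measurable_y 0) (hs.measurable_x 0)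
    hC hν hD hK hW hB
  set Z : ℕ → Ω → ℝ × (Fin d → ℝ) := fun i ω => (y i ω, x i ω) with hZ
  set ψ : ℝ → ℝ → ℝ × (Fin d → ℝ) → ℝ := fun h q p => rescaleDeriv K h (p.1 - q) * W p.2 with hψ
  set G : ℕ → Ω → ℝ → ℝ := fun n ω q => sampleMean Z (ψ (h n) q) n ω with hGdef
  set D2 := B ^ 2 * C * ∫ u, deriv K u ^ 2 with hD2
  have hD20 : 0 ≤ D2 := by
    have : 0 ≤ ∫ u, deriv K u ^ 2 := integral_nonneg fun _ => sq_nonneg _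
    positivity
  have hYm := hs.measurable_y
  have hXm := hs.measurable_x
  have hderm : ∀ h, Measurable (rescaleDeriv K h) :=
    fun h => (hK.continuous_rescaleDeriv h).measurable
  have hψm : ∀ h q, Measurable (ψ h q) := fun h q => by
    have := hderm h
    simp only [hψ]
    fun_prop
  have hGm : ∀ n, Measurable (Function.uncurry (G n)) := fun n => by
    have hterm : ∀ i, Measurable fun p : Ω × ℝ =>
        rescaleDeriv K (h n) (y i p.1 - p.2) * W (x i p.1) := fun i => by
      have := hderm (h n)
      have := hYm i
      have := hXm i
      fun_prop
    simp only [hGdef, Function.uncurry_def, sampleMean, hψ, hZ]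
    fun_prop
  have hGc : ∀ n ω, Continuous (G n ω) := fun n ω => by
    have := hK.continuous_rescaleDeriv (h n)
    simp only [hGdef, sampleMean, hψ]
    fun_prop
  have hGder : ∀ n ω q, HasDerivAt (fun q => kernelMean y x K (h n) W n q ω) (G n ω q) q := by
    intro n ω q
    simp only [kernelMean, hGdef, sampleMean, hψ]
    exact (HasDerivAt.fun_sum fun i _ =>
      (hasDerivAt_rescale hK.differentiable (h n) (y i ω) q).mul_const (W (x i ω))).const_mul _
  -- Mean plus standard deviation: the mean is bounded uniformly in `h` and `q`, and the standard
  -- deviation is of order `(n h^3)^{-1/2}`.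
  have hbound : ∀ᶠ n in atTop, ∀ q, ∫⁻ ω, ENNReal.ofReal |G n ω q| ∂μ ≤
      ENNReal.ofReal (A + √(D2 * (h n ^ 3)⁻¹ / n)) := by
    filter_upwards [hb.eventually_pos, eventually_ge_atTop 1] with n hn h1 q
    obtain ⟨M, hM⟩ := hK.exists_bound_rescaleDeriv (h n)
    have h2 : MemLp (fun ω => ψ (h n) q (Z 0 ω)) 2 μ := by
      refine MemLp.of_bound ((hψm _ q).comp ((hYm 0).prodMk (hXm 0))).aestronglyMeasurable (M * B)
        (ae_of_all _ fun ω => ?_)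
      rw [norm_mul]
      exact mul_le_mul (hM _) (hB _) (norm_nonneg _) ((abs_nonneg _).trans (hM 0))
    refine (lintegral_abs_sampleMean_le hs.indep hs.identDistrib (hψm (h n) q) h2
      (by omega)).trans (ENNReal.ofReal_le_ofReal ?_)
    gcongr
    · exact hA (h n) hn q
    · exact hd.integral_rescaleDeriv_sq_le (hYm 0) (hXm 0) hC0 hC hK hB hn q
  refine hQ.isLittleOp_increment (V := fun M n ω =>
    ∫ q in Icc (Q - M * (n : ℝ) ^ (-(1 / 2) : ℝ)) (Q + M * (n : ℝ) ^ (-(1 / 2) : ℝ)), |G n ω q|)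
    (fun M hM => ?_) ?_
  · refine isLittleOp_of_lintegral_le hb.eventually_kernelRate_pos
      (Eventually.of_forall fun n => (measurable_integral_abs (hGm n) _).aemeasurable)
      (e := fun n => 2 * (M * (n : ℝ) ^ (-(1 / 2) : ℝ)) * (A + √(D2 * (h n ^ 3)⁻¹ / n))) ?_ ?_
    · filter_upwards [hbound] with n hn
      exact lintegral_integral_abs_le (hGm n) (hGc n) (by positivity) Q hn
    · have hh : Tendsto (fun n => h n ^ (1 / 2 : ℝ)) atTop (𝓝 0) := by
        have := hb.tendsto_zero.rpow_const (p := 1 / 2) (Or.inr (by norm_num))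
        rwa [Real.zero_rpow (by norm_num)] at this
      -- Divided by `(n h)^{-1/2}`, the two contributions become `A h^{1/2}` and `√D2 n^{-1/2} / h`.
      have hlim := ((hh.const_mul A).add (hb.tendsto_rpow_div.const_mul √D2)).const_mul (2 * M)
      simp only [mul_zero, add_zero] at hlim
      refine hlim.congr' ?_
      filter_upwards [hb.eventually_pos, eventually_ge_atTop 1] with n hn h1
      have hn0 : (0 : ℝ) < n := by exact_mod_cast h1
      have hrp : (n : ℝ) ^ (-(1 / 2) : ℝ) = (√n)⁻¹ := by
        rw [Real.rpow_neg hn0.le, Real.sqrt_eq_rpow]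
      have hhp : h n ^ (-(1 / 2) : ℝ) = (√(h n))⁻¹ := by
        rw [Real.rpow_neg hn.le, Real.sqrt_eq_rpow]
      have hsq : √(D2 * (h n ^ 3)⁻¹ / n) = √D2 * ((h n)⁻¹ * (√(h n))⁻¹ * (√n)⁻¹) := by
        rw [div_eq_mul_inv, mul_assoc, Real.sqrt_mul hD20,
          Real.sqrt_mul (inv_nonneg.2 (pow_nonneg hn.le 3)),
          Real.sqrt_inv, Real.sqrt_inv]
        congr 2
        rw [pow_succ, Real.sqrt_mul (by positivity), Real.sqrt_sq hn.le, mul_inv]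
      unfold kernelRate
      rw [hsq, hrp, hhp, ← Real.sqrt_eq_rpow]
      have hs1 : 0 < √(h n) := Real.sqrt_pos.2 hn
      have hs2 : 0 < √(n : ℝ) := Real.sqrt_pos.2 hn0
      field_simp
  · refine Eventually.of_forall fun n => ae_of_all _ fun ω M hM => ?_
    exact (abs_sub_le_integral_abs_deriv (hGder n ω) (hGc n ω) hM).trans (le_abs_self _)

/-- Markov's inequality: by scaling, the expectation is at most `C ∫ |K|`, whatever the bandwidth.
-/
theorem isBigOp_absKernelMean (hs : IsRandomSample μ y x)
    (hd : HasDensities μ (y 0) (x 0) ν fX f fY) {C : ℝ} (hC0 : 0 ≤ C)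
    (hC : ∀ x' ∈ (μ.map (x 0)).support, ∀ y', f y' x' ≤ C)
    (hK : KernelAssumption K r) (hb : BandwidthAssumption h a r) (Q : ℝ) :
    IsBigOp μ (fun n ω => absKernelMean y K (h n) n Q ω) fun _ => 1 := by
  have hYm := hs.measurable_y
  have hkm : ∀ h, Measurable (rescale K h) := fun h => (hK.continuous_rescale h).measurable
  refine isBigOp_of_lintegral_le (C := C * ∫ u, |K u|) (Eventually.of_forall fun _ => one_pos)
    (Eventually.of_forall fun n => ?_) ?_
  · have := hkm (h n)
    unfold absKernelMean
    exact Measurable.aemeasurable (by fun_prop)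
  · filter_upwards [hb.eventually_pos, eventually_ge_atTop 1] with n hn h1
    have hm : Measurable fun y' => |rescale K (h n) (y' - Q)| := by
      have := hkm (h n)
      fun_prop
    obtain ⟨hi, hle⟩ := hd.integral_le_of_nonneg (hYm 0) (hs.measurable_x 0) hC0 hC hm
      (fun _ => abs_nonneg _) (hK.integrable_rescale hn Q).abs
    rw [integral_abs_rescale hn] at hle
    refine (lintegral_abs_sampleMean_le_integral hs.identDistrib
      (φ := fun p => |rescale K (h n) (p.1 - Q)|) (hm.comp measurable_fst) hi
      (by omega)).trans (ENNReal.ofReal_le_ofReal ?_)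
    simpa only [abs_abs, mul_one] using hle

/-- Absolute values rule out cancellation, so the derivative is only bounded by order `h⁻¹` in mean.
Over a distance of order `n^{-1/2}` this still gives `n^{-1/2} / h → 0`, enough for boundedness in
probability. -/
theorem isBigOp_absKernelMean_sampleQuantile (hs : IsRandomSample μ y x)
    (hd : HasDensities μ (y 0) (x 0) ν fX f fY) {C : ℝ} (hC0 : 0 ≤ C)
    (hC : ∀ x' ∈ (μ.map (x 0)).support, ∀ y', f y' x' ≤ C)
    (hK : KernelAssumption K r) (hb : BandwidthAssumption h a r)
    (hQ : IsBigOp μ (fun n ω => Qhat n ω - Q) fun n => (n : ℝ) ^ (-(1 / 2) : ℝ)) :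
    IsBigOp μ (fun n ω => absKernelMean y K (h n) n (Qhat n ω) ω) fun _ => 1 := by
  set Z : ℕ → Ω → ℝ × (Fin d → ℝ) := fun i ω => (y i ω, x i ω) with hZ
  set ψ : ℝ → ℝ → ℝ × (Fin d → ℝ) → ℝ := fun h q p => |rescaleDeriv K h (p.1 - q)| with hψ
  set G : ℕ → Ω → ℝ → ℝ := fun n ω q => sampleMean Z (ψ (h n) q) n ω with hGdef
  have hYm := hs.measurable_y
  have hderm : ∀ h, Measurable (rescaleDeriv K h) :=
    fun h => (hK.continuous_rescaleDeriv h).measurable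
  have hGm : ∀ n, Measurable (Function.uncurry (G n)) := fun n => by
    have hterm : ∀ i, Measurable fun p : Ω × ℝ => rescaleDeriv K (h n) (y i p.1 - p.2) :=
      fun i => by
        have := hderm (h n)
        have := hYm i
        fun_prop
    simp only [hGdef, Function.uncurry_def, sampleMean, hψ, hZ]
    fun_prop
  have hGc : ∀ n ω, Continuous (G n ω) := fun n ω => by
    have := hK.continuous_rescaleDeriv (h n)
    simp only [hGdef, sampleMean, hψ]
    fun_prop
  have hbound : ∀ᶠ n in atTop, ∀ q, ∫⁻ ω, ENNReal.ofReal |G n ω q| ∂μ ≤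
      ENNReal.ofReal (C * ((h n)⁻¹ * ∫ u, |deriv K u|)) := by
    filter_upwards [hb.eventually_pos, eventually_ge_atTop 1] with n hn h1 q
    have hm : Measurable fun y' => |rescaleDeriv K (h n) (y' - q)| := by
      have := hderm (h n)
      fun_prop
    obtain ⟨hi, hle⟩ := hd.integral_le_of_nonneg (hYm 0) (hs.measurable_x 0) hC0 hC hm
      (fun _ => abs_nonneg _) (hK.integrable_rescaleDeriv hn q).abs
    rw [integral_abs_rescaleDeriv hn] at hle
    refine (lintegral_abs_sampleMean_le_integral hs.identDistrib
      (φ := ψ (h n) q) (hm.comp measurable_fst) hi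
      (by omega)).trans (ENNReal.ofReal_le_ofReal ?_)
    simpa only [hψ, abs_abs] using hle
  have hlittle : IsLittleOp μ (fun n ω => absKernelMean y K (h n) n (Qhat n ω) ω -
      absKernelMean y K (h n) n Q ω) fun _ => 1 := by
    refine hQ.isLittleOp_increment (V := fun M n ω =>
      ∫ q in Icc (Q - M * (n : ℝ) ^ (-(1 / 2) : ℝ)) (Q + M * (n : ℝ) ^ (-(1 / 2) : ℝ)), |G n ω q|)
      (fun M hM => ?_) ?_
    · refine isLittleOp_of_lintegral_le (Eventually.of_forall fun _ => one_pos)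
        (Eventually.of_forall fun n => (measurable_integral_abs (hGm n) _).aemeasurable)
        (e := fun n => 2 * (M * (n : ℝ) ^ (-(1 / 2) : ℝ)) *
          (C * ((h n)⁻¹ * ∫ u, |deriv K u|))) ?_ ?_
      · filter_upwards [hbound] with n hn
        exact lintegral_integral_abs_le (hGm n) (hGc n) (by positivity) Q hn
      · have hlim := hb.tendsto_rpow_div.const_mul (2 * M * (C * ∫ u, |deriv K u|))
        rw [mul_zero] at hlim
        refine hlim.congr fun n => ?_
        rw [div_one]
        ring
    · refine Eventually.of_forall fun n => ae_of_all _ fun ω M hM => ?_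
      refine le_trans ?_ (le_abs_self _)
      -- The variation bound is applied to each summand before taking absolute values, as `|K_h|`
      -- need not be differentiable.
      have hterm : ∀ i, |rescale K (h n) (y i ω - Qhat n ω) - rescale K (h n) (y i ω - Q)| ≤
          ∫ q in Icc (Q - M * (n : ℝ) ^ (-(1 / 2) : ℝ)) (Q + M * (n : ℝ) ^ (-(1 / 2) : ℝ)),
            |rescaleDeriv K (h n) (y i ω - q)| := fun i => by
        have := hK.continuous_rescaleDeriv (h n)
        exact abs_sub_le_integral_abs_deriv
          (hasDerivAt_rescale hK.differentiable (h n) (y i ω)) (by fun_prop) hM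
      have hint : ∀ i, IntegrableOn (fun q => |rescaleDeriv K (h n) (y i ω - q)|)
          (Icc (Q - M * (n : ℝ) ^ (-(1 / 2) : ℝ)) (Q + M * (n : ℝ) ^ (-(1 / 2) : ℝ))) :=
        fun i => by
          have := hK.continuous_rescaleDeriv (h n)
          exact (by fun_prop : Continuous fun q =>
            |rescaleDeriv K (h n) (y i ω - q)|).continuousOn.integrableOn_compact isCompact_Icc
      have hG0 : ∀ q, |G n ω q| = (n : ℝ)⁻¹ * ∑ i ∈ Finset.range n,
          |rescaleDeriv K (h n) (y i ω - q)| := fun q =>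
        abs_of_nonneg (mul_nonneg (by positivity) (Finset.sum_nonneg fun _ _ => abs_nonneg _))
      simp_rw [hG0]
      rw [integral_const_mul, integral_finsetSum _ fun i _ => hint i]
      unfold absKernelMean
      rw [← mul_sub, ← Finset.sum_sub_distrib, abs_mul,
        abs_of_nonneg (by positivity : (0 : ℝ) ≤ (n : ℝ)⁻¹)]
      gcongr
      refine (Finset.abs_sum_le_sum_abs _ _).trans (Finset.sum_le_sum fun i _ => ?_)
      exact (abs_abs_sub_abs_le _ _).trans (hterm i)
  refine (isBigOp_absKernelMean hs hd hC0 hC hK hb Q).of_le_add hlittle.isBigOp ?_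
  refine Eventually.of_forall fun n => ae_of_all _ fun ω => ?_
  have := abs_add_le (absKernelMean y K (h n) n Q ω)
    (absKernelMean y K (h n) n (Qhat n ω) ω - absKernelMean y K (h n) n Q ω)
  rwa [add_sub_cancel] at this

/-- The kernel density estimator is consistent at `Q`, with a positive limit. -/
theorem exists_isLittleOp_kernelMean_one (hs : IsRandomSample μ y x)
    (hd : HasDensities μ (y 0) (x 0) ν fX f fY) {C : ℝ} (hC0 : 0 ≤ C)
    (hC : ∀ x' ∈ (μ.map (x 0)).support, ∀ y', f y' x' ≤ C)
    (hD : DensityAssumption (μ.map (x 0)).support fX f fY r)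
    (hK : KernelAssumption K r) (hb : BandwidthAssumption h a r) {c : ℝ} (hc : 0 < c)
    (hcf : ∀ x' ∈ (μ.map (x 0)).support, c ≤ f Q x') :
    ∃ f₀ : ℝ, 0 < f₀ ∧
      IsLittleOp μ (fun n ω => kernelMean y x K (h n) (fun _ => 1) n Q ω - f₀) fun _ => 1 := by
  have hYm := hs.measurable_y
  have hXm := hs.measurable_x
  have hkm : ∀ h, Measurable (rescale K h) := fun h => (hK.continuous_rescale h).measurable
  set f₀ := ∫ x' in (μ.map (x 0)).support, f Q x' * fX x' ∂ν with hf₀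
  have hfX := hd.integrable_fX (hYm 0) (hXm 0)
  have hSm := measurableSet_support (μ.map (x 0))
  -- The limit dominates `c` times the total mass of `fX` on the support, which is 1.
  have hf₀pos : 0 < f₀ := by
    have h1 : ∫ x' in (μ.map (x 0)).support, c * fX x' ∂ν ≤ f₀ := by
      refine integral_mono_ae (hfX.const_mul c) ?_ ?_
      · have hfm : Measurable fun x' => f Q x' :=
          hd.measurable_f.comp (measurable_const.prodMk measurable_id)
        refine hfX.bdd_mul (c := C) hfm.aestronglyMeasurable ?_
        filter_upwards [ae_restrict_mem hSm] with x' hx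
        rw [Real.norm_of_nonneg (hd.f_nonneg _ _)]
        exact hC x' hx Q
      · filter_upwards [ae_restrict_mem hSm] with x' hx
        exact mul_le_mul_of_nonneg_right (hcf x' hx) (hd.fX_nonneg x')
    rw [integral_const_mul, hd.integral_fX (hYm 0) (hXm 0), mul_one] at h1
    exact hc.trans_le h1
  refine ⟨f₀, hf₀pos, ?_⟩
  set φ : ℝ → ℝ × (Fin d → ℝ) → ℝ := fun h p => rescale K h (p.1 - Q) * 1 with hφ
  have hφm : ∀ h, Measurable (φ h) := fun h => by
    have := hkm h
    simp only [hφ]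
    fun_prop
  have hlim : Tendsto (fun n => ∫ ω, φ (h n) (y 0 ω, x 0 ω) ∂μ) atTop (𝓝 f₀) := by
    simp only [hφ, mul_one]
    exact (hd.tendsto_integral_rescale (hYm 0) (hXm 0) hC hD hK Q).comp
      (tendsto_nhdsWithin_iff.2 ⟨hb.tendsto_zero, hb.eventually_pos⟩)
  intro δ hδ
  -- The second moment of a kernel term is at most `A / h`, so the variance of the mean is at most
  -- `A` times the squared rate.
  set A := C * ∫ u, K u ^ 2 with hA
  have hlimB : Tendsto (fun n => ENNReal.ofReal (A * kernelRate h n ^ 2 / (δ / 2) ^ 2)) atTop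
      (𝓝 0) := by
    simpa using ENNReal.tendsto_ofReal
      (((hb.tendsto_kernelRate.pow 2).const_mul A).div_const ((δ / 2) ^ 2))
  refine tendsto_of_tendsto_of_tendsto_of_le_of_le' tendsto_const_nhds hlimB
    (Eventually.of_forall fun _ => zero_le) ?_
  have hclose : ∀ᶠ n in atTop, |∫ ω, φ (h n) (y 0 ω, x 0 ω) ∂μ - f₀| < δ / 2 := by
    have := hlim.eventually (Metric.ball_mem_nhds f₀ (by positivity : 0 < δ / 2))
    filter_upwards [this] with n hn
    exact hn
  filter_upwards [hb.eventually_pos, eventually_ge_atTop 1, hclose] with n hn h1 hcl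
  obtain ⟨M, hM⟩ := hK.exists_bound_rescale (h n)
  have h2 : MemLp (fun ω => φ (h n) (y 0 ω, x 0 ω)) 2 μ := by
    refine MemLp.of_bound ((hφm _).comp ((hYm 0).prodMk (hXm 0))).aestronglyMeasurable M
      (ae_of_all _ fun ω => ?_)
    simp only [hφ, mul_one]
    exact hM _
  have hdev := measure_sampleMean_sub_le hs.indep hs.identDistrib (hφm (h n)) h2 (n := n)
    (by omega) (half_pos hδ)
  refine le_trans (measure_mono fun ω hω => ?_) (hdev.trans (ENNReal.ofReal_le_ofReal ?_))
  · have hω' : δ * 1 < |kernelMean y x K (h n) (fun _ => 1) n Q ω - f₀| := hω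
    change δ / 2 < |kernelMean y x K (h n) (fun _ => 1) n Q ω - _|
    have := abs_sub_le (kernelMean y x K (h n) (fun _ => 1) n Q ω)
      (∫ ω, φ (h n) (y 0 ω, x 0 ω) ∂μ) f₀
    linarith
  · have hint : Integrable fun y' => rescale K (h n) (y' - Q) ^ 2 := by
      simp_rw [rescale, mul_pow]
      exact (integrable_comp_sub_div hK.integrable_sq hn Q).const_mul _
    have hle := (hd.integral_le_of_nonneg (hYm 0) (hXm 0) hC0 hC
      (φ := fun y' => rescale K (h n) (y' - Q) ^ 2)
      (by have := hkm (h n); fun_prop) (fun _ => sq_nonneg _) hint).2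
    rw [integral_rescale_sq hn] at hle
    rw [kernelRate_sq hn]
    simp only [hφ, mul_one]
    gcongr
    calc _ ≤ C * ((h n)⁻¹ * ∫ u, K u ^ 2) / n := by gcongr
      _ = _ := by
        rw [hA, mul_inv]
        ring

end KernelEstimators

/-! ### Perturbation of ratios. -/

section Ratio

/-- The hypotheses keep `D' ≥ f₀/2` and `D ≥ f₀/4`; hence `4/f₀` from `1/D` and `8/f₀²` from `1/(D
D')`. -/
theorem abs_div_sub_div_le {N N' D D' f₀ : ℝ} (hf : 0 < f₀) (hD' : |D' - f₀| ≤ f₀ / 2)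
    (hD : |D - D'| ≤ f₀ / 4) :
    |N / D - N' / D'| ≤ 4 / f₀ * |N - N'| + 8 / f₀ ^ 2 * (|N'| * |D - D'|) := by
  have h1 : f₀ / 2 ≤ D' := by linarith [(abs_le.1 hD').1]
  have h2 : f₀ / 4 ≤ D := by linarith [(abs_le.1 hD).1]
  have hD'0 : 0 < D' := by linarith
  have hD0 : 0 < D := by linarith
  have hsplit : N / D - N' / D' = (N - N') / D - N' * (D - D') / (D * D') := by
    field_simp
    ring
  rw [hsplit]
  refine (abs_sub _ _).trans (add_le_add ?_ ?_)
  · rw [abs_div, abs_of_pos hD0, div_mul_eq_mul_div, div_le_div_iff₀ hD0 hf]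
    nlinarith [abs_nonneg (N - N')]
  · rw [abs_div, abs_mul, abs_of_pos (mul_pos hD0 hD'0), div_mul_eq_mul_div,
      div_le_div_iff₀ (mul_pos hD0 hD'0) (by positivity)]
    have h3 : f₀ / 4 * (f₀ / 2) ≤ D * D' := by gcongr
    have h4 : 0 ≤ |N'| * |D - D'| := by positivity
    nlinarith [mul_le_mul_of_nonneg_left h3 h4]

variable {Ω : Type*} [MeasurableSpace Ω] {μ : Measure Ω}

/-- A ratio changes by `o_p(ρ n)` if numerator and denominator do, provided that the denominator
has a positive limit. -/
theorem isLittleOp_div_sub_div {N N' D D' : ℕ → Ω → ℝ} {ρ : ℕ → ℝ} {f₀ : ℝ} (hf : 0 < f₀)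
    (hρ : ∀ᶠ n in atTop, 0 ≤ ρ n) (hρ1 : ∀ᶠ n in atTop, ρ n ≤ 1)
    (hN : IsLittleOp μ (fun n ω => N n ω - N' n ω) ρ)
    (hD : IsLittleOp μ (fun n ω => D n ω - D' n ω) ρ) (hN' : IsBigOp μ N' fun _ => 1)
    (hD' : IsLittleOp μ (fun n ω => D' n ω - f₀) fun _ => 1) :
    IsLittleOp μ (fun n ω => N n ω / D n ω - N' n ω / D' n ω) ρ := by
  have hprod : IsLittleOp μ (fun n ω => N' n ω * (D n ω - D' n ω)) ρ :=
    hN'.mul_littleOp hD hρ (Eventually.of_forall fun n => ae_of_all _ fun ω => (abs_mul _ _).le)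
  have hE : IsLittleOp μ (fun n ω => 4 / f₀ * |N n ω - N' n ω| +
      8 / f₀ ^ 2 * (|N' n ω| * |D n ω - D' n ω|)) ρ := by
    refine hN.of_le_add hprod (4 / f₀ + 8 / f₀ ^ 2)
      (Eventually.of_forall fun n => ae_of_all _ fun ω => ?_)
    rw [abs_of_nonneg (by positivity), abs_mul]
    have h1 : 0 < 4 / f₀ := by positivity
    have h2 : 0 < 8 / f₀ ^ 2 := by positivity
    have h3 := abs_nonneg (N n ω - N' n ω)
    have h4 : 0 ≤ |N' n ω| * |D n ω - D' n ω| := by positivity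
    nlinarith [mul_nonneg h1.le h4, mul_nonneg h2.le h3]
  have hD1 : IsLittleOp μ (fun n ω => D n ω - D' n ω) fun _ => 1 := hD.mono_rate hρ1
  intro δ hδ
  have hlim := ((hE δ hδ).add (hD' (f₀ / 2) (by positivity))).add (hD1 (f₀ / 4) (by positivity))
  simp only [add_zero] at hlim
  refine tendsto_of_tendsto_of_tendsto_of_le_of_le tendsto_const_nhds hlim
    (fun _ => zero_le) fun n => ?_
  refine le_trans (measure_mono fun ω hω => ?_)
    ((measure_union_le _ _).trans (add_le_add_left (measure_union_le _ _) _))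
  by_contra hcon
  simp only [mem_ofPred_eq, not_or, not_lt, mem_union, mul_one] at hcon
  obtain ⟨⟨c1, c2⟩, c3⟩ := hcon
  have hω' : δ * ρ n < |N n ω / D n ω - N' n ω / D' n ω| := hω
  have := (abs_div_sub_div_le (N := N n ω) (N' := N' n ω) hf c2 c3).trans (le_abs_self _)
  exact absurd (this.trans c1) (not_le.2 hω')

end Ratio

/-! ### A measurable version of the oracle weight. -/

section Weights

variable {Ω : Type*} [MeasurableSpace Ω] {μ : Measure Ω} {d : ℕ} [NeZero d]
    {y : ℕ → Ω → ℝ} {x : ℕ → Ω → Fin d → ℝ} {ν : Measure (Fin d → ℝ)}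
    {fX : (Fin d → ℝ) → ℝ} {f : ℝ → (Fin d → ℝ) → ℝ} {fY : ℝ → ℝ}
    {τ ε Q : ℝ} {β : ℝ → Fin d → ℝ} {ξ : (Fin d → ℝ) → ℝ}
    {βhat : ℕ → ℝ → Ω → Fin d → ℝ} {Qhat : ℕ → Ω → ℝ} {ξhat : ℕ → (Fin d → ℝ) → Ω → ℝ}

/-- The oracle weight `β₁(ξ(x))` agrees on the support of `X` with a bounded measurable
function. -/
theorem exists_measurable_weight (hdens : HasDensities μ (y 0) (x 0) ν fX f fY)
    (hε : ε ∈ Ioo (0 : ℝ) (1 / 2))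
    (hξ : ∀ x' ∈ (μ.map (x 0)).support,
      ξ x' ∈ matchingSet f (quantile (μ.map (y 0)) τ) x' ∩ Icc ε (1 - ε))
    (happ : ApproxAssumption μ (μ.map (x 0)).support f ε Q β ξ βhat Qhat ξhat) :
    ∃ (W : (Fin d → ℝ) → ℝ) (B : ℝ), Measurable W ∧ (∀ x', |W x'| ≤ B) ∧
      ∀ x' ∈ (μ.map (x 0)).support, W x' = β (ξ x') 0 := by
  have hle : ε ≤ 1 - ε := by linarith [hε.2]
  have hcont : ContinuousOn (fun η => β η 0) (Icc ε (1 - ε)) :=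
    happ.beta_differentiable.continuousOn
  obtain ⟨B, hB⟩ := isCompact_Icc.exists_bound_of_continuousOn hcont
  -- Extending `β₁` by its end values outside `I` keeps it continuous and bounded. Composing with
  -- the conditional distribution function at `Q` gives a measurable weight defined for every `x`.
  set b : ℝ → ℝ := IccExtend hle fun η : Icc ε (1 - ε) => β η 0 with hb
  have hbc : Continuous b := (continuousOn_iff_continuous_domRestrict.1 hcont).Icc_extend'
  refine ⟨fun x' => b (condLaw f x' (Iic (quantile (μ.map (y 0)) τ))).toReal, B,
    hbc.measurable.comp (measurable_condLaw_Iic hdens _), fun x' => ?_, fun x' hx => ?_⟩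
  · exact hB _ (projIcc ε (1 - ε) hle _).2
  · simp only [hb]
    rw [condLaw_real_Iic_quantile hdens hξ hx, IccExtend_of_mem hle _ (hξ x' hx).2]

end Weights

theorem nadarayaWatson_eq (K : ℝ → ℝ) (h : ℝ) {n : ℕ} (hn : n ≠ 0) (y w : ℕ → ℝ) (q : ℝ) :
    nadarayaWatson K h n y w q =
      ((n : ℝ)⁻¹ * ∑ i ∈ Finset.range n, rescale K h (y i - q) * w i) /
        ((n : ℝ)⁻¹ * ∑ i ∈ Finset.range n, rescale K h (y i - q)) := by
  unfold nadarayaWatson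
  rw [mul_div_mul_left]
  exact inv_ne_zero (Nat.cast_ne_zero.2 hn)

end UQPE

end

/-! ### Assembly of the asymptotic equivalence. -/

theorem theorem2 {Ω : Type*} [MeasurableSpace Ω] (μ : Measure Ω) [IsProbabilityMeasure μ]
    {d : ℕ} [NeZero d]
    -- the sample and its densities
    (y : ℕ → Ω → ℝ) (x : ℕ → Ω → Fin d → ℝ) (hsample : UQPE.IsRandomSample μ y x)
    (ν : Measure (Fin d → ℝ)) [IsLocallyFiniteMeasure ν]
    (fX : (Fin d → ℝ) → ℝ) (f : ℝ → (Fin d → ℝ) → ℝ) (fY : ℝ → ℝ)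
    (hdens : UQPE.HasDensities μ (y 0) (x 0) ν fX f fY)
    -- the quantile levels, the coefficients and the true matching function
    (τ : ℝ) (hτ : τ ∈ Ioo (0 : ℝ) 1) (ε : ℝ) (hε : ε ∈ Ioo (0 : ℝ) (1 / 2))
    (β : ℝ → Fin d → ℝ) (ξ : (Fin d → ℝ) → ℝ)
    (hξ : ∀ x' ∈ (μ.map (x 0)).support,
      ξ x' ∈ UQPE.matchingSet f (UQPE.quantile (μ.map (y 0)) τ) x' ∩ Icc ε (1 - ε))
    -- the first-step estimators
    (m : ℕ → ℕ) (grid : (n : ℕ) → Fin (m n + 1) → ℝ)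
    (βhat : ℕ → ℝ → Ω → Fin d → ℝ)
    (hβhat : ∀ n, ∀ η ∈ Icc ε (1 - ε), ∀ ω,
      UQPE.IsQRCoef n (fun i => y i ω) (fun i => x i ω) η (βhat n η ω))
    (Qhat : ℕ → Ω → ℝ)
    (hQhat : ∀ n ω, UQPE.IsSampleQuantile n (fun i => y i ω) τ (Qhat n ω))
    (ξhat : ℕ → (Fin d → ℝ) → Ω → ℝ)
    (hξhat : ∀ n x' ω,
      UQPE.IsMatch ε (grid n) (fun η => βhat n η ω) (Qhat n ω) x' (ξhat n x' ω))
    -- the kernel and the bandwidth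
    (K : ℝ → ℝ) (r : ℕ) (h : ℕ → ℝ) (a : ℝ)
    -- the assumptions
    (hmatching : UQPE.MatchingAssumption μ y x f fY τ ε β βhat Qhat m grid)
    (hkernel : UQPE.KernelAssumption K r)
    (hbandwidth : UQPE.BandwidthAssumption h a r)
    (hdensity : UQPE.DensityAssumption (μ.map (x 0)).support fX f fY r)
    (happrox : UQPE.ApproxAssumption μ (μ.map (x 0)).support f ε
      (UQPE.quantile (μ.map (y 0)) τ) β ξ βhat Qhat ξhat) :
    UQPE.IsLittleOp μ
      (fun n ω =>
        UQPE.nadarayaWatson K (h n) n (fun i => y i ω)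
            (fun i => βhat n (ξhat n (x i ω) ω) ω 0) (Qhat n ω)
          - UQPE.nadarayaWatson K (h n) n (fun i => y i ω)
            (fun i => β (ξ (x i ω)) 0) (UQPE.quantile (μ.map (y 0)) τ))
      (fun n => (n : ℝ) ^ (-(1 / 2) : ℝ) * h n ^ (-(1 / 2) : ℝ)) := by
  open UQPE in
  set Q := quantile (μ.map (y 0)) τ with hQdef
  -- The support is closed and now bounded, hence compact, so the locally finite `ν` has finite mass
  -- on it.
  have hbdd := isBounded_support hsample hdens hτ hε hξ hξhat hmatching happrox
  have hν : ν (μ.map (x 0)).support < ⊤ :=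
    (Metric.isCompact_of_isClosed_isBounded Measure.isClosed_support hbdd).measure_lt_top
  obtain ⟨C', hC'⟩ := happrox.density_bounded
  have hC : ∀ x' ∈ (μ.map (x 0)).support, ∀ y', f y' x' ≤ |C'| :=
    fun x' hx y' => (hC' x' hx y').trans (le_abs_self _)
  obtain ⟨c, hc, hcf⟩ := exists_le_density hdens hε hmatching hξ
  obtain ⟨W, B, hWm, hWB, hWξ⟩ := exists_measurable_weight hdens hε hξ happrox
  have hQ := isBigOp_sampleQuantile hsample hdens hτ hmatching
  obtain ⟨f₀, hf₀, hden⟩ := exists_isLittleOp_kernelMean_one (Q := Q) hsample hdens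
    (abs_nonneg C') hC hdensity hkernel hbandwidth hc hcf
  -- The denominator is the kernel mean with constant weight 1, so one lemma treats both parts of
  -- the ratio.
  have hdenQ := isLittleOp_kernelMean_sub hsample hdens (abs_nonneg C') hC hν hdensity hkernel
    hbandwidth hQ (W := fun _ => 1) measurable_const (B := 1) (fun _ => by simp)
  have hnumQ := isLittleOp_kernelMean_sub hsample hdens (abs_nonneg C') hC hν hdensity hkernel
    hbandwidth hQ hWm hWB
  have hρ : ∀ᶠ n in atTop, 0 ≤ kernelRate h n :=
    hbandwidth.eventually_kernelRate_pos.mono fun _ => le_of_lt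
  have hρ1 : ∀ᶠ n in atTop, kernelRate h n ≤ 1 :=
    (hbandwidth.tendsto_kernelRate.eventually (gt_mem_nhds one_pos)).mono fun _ => le_of_lt
  set N : ℕ → Ω → ℝ := fun n ω => (n : ℝ)⁻¹ * ∑ i ∈ Finset.range n,
    rescale K (h n) (y i ω - Qhat n ω) * βhat n (ξhat n (x i ω) ω) ω 0 with hN
  -- The weights are changed while the evaluation point stays at `Qhat`; the shift of that point is
  -- then needed only for the deterministic weight `W`.
  have hweight : IsLittleOp μ (fun n ω => N n ω - kernelMean y x K (h n) W n (Qhat n ω) ω)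
      (kernelRate h) := by
    refine (isBigOp_absKernelMean_sampleQuantile hsample hdens (abs_nonneg C') hC hkernel
      hbandwidth hQ).mul_uniformLittleOp (isUniformLittleOp_weight hsample hdens hτ hε hξ hξhat
      hmatching hbandwidth happrox hbdd) hρ (Eventually.of_forall fun n => ?_)
    filter_upwards [ae_forall_mem_support hsample] with ω hω b hb0 hb
    rw [abs_of_nonneg (absKernelMean_nonneg _ _ _ _ _ _)]
    simp only [hN, kernelMean, sampleMean, absKernelMean]
    rw [← mul_sub, ← Finset.sum_sub_distrib, abs_mul,
      abs_of_nonneg (by positivity : (0 : ℝ) ≤ (n : ℝ)⁻¹), mul_assoc, Finset.sum_mul]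
    gcongr
    refine (Finset.abs_sum_le_sum_abs _ _).trans (Finset.sum_le_sum fun i _ => ?_)
    rw [← mul_sub, abs_mul, hWξ _ (hω i)]
    gcongr
    exact hb _ (hω i)
  have hnum : IsLittleOp μ (fun n ω => N n ω - kernelMean y x K (h n) W n Q ω)
      (kernelRate h) := by
    refine hweight.of_le_add hnumQ 1 (Eventually.of_forall fun n => ae_of_all _ fun ω => ?_)
    rw [one_mul, one_mul]
    exact abs_sub_le _ _ _
  have hbig : IsBigOp μ (fun n ω => kernelMean y x K (h n) W n Q ω) fun _ => 1 := by
    refine (isBigOp_absKernelMean hsample hdens (abs_nonneg C') hC hkernel hbandwidth Q).of_le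
      (C := B) (Eventually.of_forall fun _ => zero_le_one)
      (Eventually.of_forall fun n => ae_of_all _ fun ω => ?_)
    rw [abs_of_nonneg (absKernelMean_nonneg _ _ _ _ _ _)]
    simp only [kernelMean, sampleMean, absKernelMean]
    rw [abs_mul, abs_of_nonneg (by positivity : (0 : ℝ) ≤ (n : ℝ)⁻¹), mul_left_comm,
      Finset.mul_sum]
    gcongr
    refine (Finset.abs_sum_le_sum_abs _ _).trans (Finset.sum_le_sum fun i _ => ?_)
    rw [abs_mul, mul_comm]
    gcongr
    exact hWB _
  have hratio := isLittleOp_div_sub_div hf₀ hρ hρ1 hnum hdenQ hbig hden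
  -- `W` equals the oracle weight only on the support, so the ratios agree almost surely and for `n
  -- ≥ 1`; domination by the same term, doubled, transfers the rate.
  refine IsLittleOp.of_le_add hratio hratio 1 ?_
  filter_upwards [eventually_ge_atTop 1] with n hn
  filter_upwards [ae_forall_mem_support hsample] with ω hω
  rw [nadarayaWatson_eq K _ (by omega), nadarayaWatson_eq K _ (by omega)]
  have h1 : ∀ q, kernelMean y x K (h n) (fun _ => 1) n q ω =
      (n : ℝ)⁻¹ * ∑ i ∈ Finset.range n, rescale K (h n) (y i ω - q) := fun q => by
    simp only [kernelMean, sampleMean, mul_one]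
  have h2 : kernelMean y x K (h n) W n Q ω = (n : ℝ)⁻¹ * ∑ i ∈ Finset.range n,
      rescale K (h n) (y i ω - Q) * β (ξ (x i ω)) 0 := by
    simp only [kernelMean, sampleMean]
    congr 1
    exact Finset.sum_congr rfl fun i _ => by rw [hWξ _ (hω i)]
  rw [h1, h1, h2, one_mul]
  exact le_add_of_nonneg_right (abs_nonneg _)
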